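/- **Setting.** Let $L$ be a finite-dimensional complex simple Lie algebra of type $G_2$ with Cartan subalgebra $H$, root system $\Phi$ and fundamental roots $a$ (short) and $b$ (long), so that the positive roots are $a,\ b,\ a+b,\ 2a+b,\ 3a+b,\ 3a+2b$. Let $\{e_r\ (r\in\Phi),\ h_a, h_b\}$ be a Chevalley basis of $L$: $e_r$ is a root vector for $r$, $[e_r,e_{-r}]=h_r$ is the coroot of $r$, and $[e_r,e_s]=N_{r,s}e_{r+s}$ with $N_{r,s}=\pm(p+1)$ whenever $r,s,r+s\in\Phi$, where $p$ is the greatest integer for which $s-pr$ is a root; put $N_{r,s}=0$ otherwise. Write $$N_{a,b}=\epsilon_1,\quad N_{a,a+b}=2\epsilon_2,\quad N_{a,2a+b}=3\epsilon_3,\quad N_{b,3a+b}=\epsilon_4,\quad \epsilon_5=\frac{\epsilon_1\epsilon_3}{\epsilon_4}.$$ Let $K$ be a commutative ring with identity, $L_{\mathbb Z}$ the $\mathbb Z$-span of the Chevalley basis and $L_K=K\otimes L_{\mathbb Z}$. For $r\in\Phi$ and $t\in K$ let $x_r(t)=\sum_{n\ge 0}t^n\,\frac{(\mathrm{ad}\,e_r)^n}{n!}$,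 acting on $L_K$; these operators generate the Chevalley group over $K$. Let $[g,h]=g^{-1}h^{-1}gh$, and let $$M_{r,s,i}=\frac1{i!}N_{r,s}N_{r,r+s}\cdots N_{r,(i-1)r+s},$$ $$C_{i1,rs}=M_{r,s,i},\quad C_{1j,rs}=(-1)^jM_{s,r,j},\quad C_{32,rs}=\tfrac13M_{r+s,r,2},\quad C_{23,rs}=-\tfrac23M_{s+r,s,2}.$$ **Claim.** (A) For all $r,s\in\Phi$ with $r+s\in\Phi$, every pair of positive integers $(i,j)$ with $ir+js\in\Phi$ is one of $(1,1),(2,1),(1,2),(3,1),(1,3),(3,2),(2,3)$, the corresponding $C_{ij,rs}$ are integers, and for all $t,u\in K$ $$[x_s(u),x_r(t)]=\prod_{i,j>0,\ ir+js\in\Phi}x_{ir+js}\bigl(C_{ij,rs}(-t)^iu^j\bigr),$$ the factors being taken in the order of that list (increasing $i+j$). (B) For each of the 60 ordered pairs $(s,r)$ below (these are all pairs of roots whose sum is a root) every $C_{ij,rs}$ with $ir+js\in\Phi$ is the signed monomial in $\epsilon_1,\dots,\epsilon_5$ for which the factor $x_{ir+js}(C_{ij,rs}(-t)^iu^j)$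 of (A) is the one displayed; and for all $t,u\in K$ the following formulas hold. 1. $[x_{b}(u),x_{a}(t)]=x_{a+b}(-\epsilon_1tu)\,x_{2a+b}(\epsilon_1\epsilon_2t^2u)\,x_{3a+b}(-\epsilon_1\epsilon_2\epsilon_3t^3u)\,x_{3a+2b}(-\epsilon_2\epsilon_5t^3u^2)$ 2. $[x_{a}(u),x_{b}(t)]=x_{a+b}(\epsilon_1tu)\,x_{2a+b}(-\epsilon_1\epsilon_2tu^2)\,x_{3a+b}(\epsilon_1\epsilon_2\epsilon_3tu^3)\,x_{3a+2b}(-2\epsilon_2\epsilon_5t^2u^3)$ 3. $[x_{a+b}(u),x_{a}(t)]=x_{2a+b}(-2\epsilon_2tu)\,x_{3a+b}(3\epsilon_2\epsilon_3t^2u)\,x_{3a+2b}(-3\epsilon_2\epsilon_5tu^2)$ 4. $[x_{2a+b}(u),x_{a}(t)]=x_{3a+b}(-3\epsilon_3tu)$ 5. $[x_{3a+b}(u),x_{b}(t)]=x_{3a+2b}(-\epsilon_4tu)$ 6. $[x_{2a+b}(u),x_{a+b}(t)]=x_{3a+2b}(3\epsilon_5tu)$ 7. $[x_{-b}(u),x_{-a}(t)]=x_{-a-b}(\epsilon_1tu)\,x_{-2a-b}(\epsilon_1\epsilon_2t^2u)\,x_{-3a-b}(\epsilon_1\epsilon_2\epsilon_3t^3u)\,x_{-3a-2b}(-\epsilon_2\epsilon_5t^3u^2)$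 8. $[x_{-a}(u),x_{-b}(t)]=x_{-a-b}(-\epsilon_1tu)\,x_{-2a-b}(-\epsilon_1\epsilon_2tu^2)\,x_{-3a-b}(-\epsilon_1\epsilon_2\epsilon_3tu^3)\,x_{-3a-2b}(-2\epsilon_2\epsilon_5t^2u^3)$ 9. $[x_{-a-b}(u),x_{-a}(t)]=x_{-2a-b}(2\epsilon_2tu)\,x_{-3a-b}(3\epsilon_2\epsilon_3t^2u)\,x_{-3a-2b}(-3\epsilon_2\epsilon_5tu^2)$ 10. $[x_{-2a-b}(u),x_{-a}(t)]=x_{-3a-b}(3\epsilon_3tu)$ 11. $[x_{-3a-b}(u),x_{-b}(t)]=x_{-3a-2b}(\epsilon_4tu)$ 12. $[x_{-2a-b}(u),x_{-a-b}(t)]=x_{-3a-2b}(-3\epsilon_5tu)$ 13. $[x_{-a-b}(u),x_{a}(t)]=x_{-b}(3\epsilon_1tu)$ 14. $[x_{-2a-b}(u),x_{a}(t)]=x_{-a-b}(2\epsilon_2tu)\,x_{-b}(3\epsilon_1\epsilon_2t^2u)\,x_{-3a-2b}(3\epsilon_2\epsilon_5tu^2)$ 15. $[x_{-3a-b}(u),x_{a}(t)]=x_{-2a-b}(\epsilon_3tu)\,x_{-a-b}(\epsilon_2\epsilon_3t^2u)\,x_{-b}(\epsilon_1\epsilon_2\epsilon_3t^3u)\,x_{-3a-2b}(\epsilon_2\epsilon_5t^3u^2)$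 16. $[x_{a}(u),x_{-3a-b}(t)]=x_{-2a-b}(-\epsilon_3tu)\,x_{-a-b}(-\epsilon_2\epsilon_3tu^2)\,x_{-b}(-\epsilon_1\epsilon_2\epsilon_3tu^3)\,x_{-3a-2b}(2\epsilon_2\epsilon_5t^2u^3)$ 17. $[x_{b}(u),x_{-a-b}(t)]=x_{-a}(\epsilon_1tu)\,x_{-2a-b}(-\epsilon_1\epsilon_2t^2u)\,x_{-3a-2b}(\epsilon_1\epsilon_2\epsilon_5t^3u)\,x_{-3a-b}(-\epsilon_2\epsilon_3t^3u^2)$ 18. $[x_{-a-b}(u),x_{b}(t)]=x_{-a}(-\epsilon_1tu)\,x_{-2a-b}(\epsilon_1\epsilon_2tu^2)\,x_{-3a-2b}(-\epsilon_1\epsilon_2\epsilon_5tu^3)\,x_{-3a-b}(-2\epsilon_2\epsilon_3t^2u^3)$ 19. $[x_{-3a-2b}(u),x_{b}(t)]=x_{-3a-b}(\epsilon_4tu)$ 20. $[x_{-a}(u),x_{a+b}(t)]=x_{b}(3\epsilon_1tu)$ 21. $[x_{-b}(u),x_{a+b}(t)]=x_{a}(-\epsilon_1tu)\,x_{2a+b}(-\epsilon_1\epsilon_2t^2u)\,x_{3a+2b}(-\epsilon_1\epsilon_2\epsilon_5t^3u)\,x_{3a+b}(-\epsilon_2\epsilon_3t^3u^2)$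 22. $[x_{a+b}(u),x_{-b}(t)]=x_{a}(\epsilon_1tu)\,x_{2a+b}(\epsilon_1\epsilon_2tu^2)\,x_{3a+2b}(\epsilon_1\epsilon_2\epsilon_5tu^3)\,x_{3a+b}(-2\epsilon_2\epsilon_3t^2u^3)$ 23. $[x_{-2a-b}(u),x_{a+b}(t)]=x_{-a}(-2\epsilon_2tu)\,x_{b}(-3\epsilon_1\epsilon_2t^2u)\,x_{-3a-b}(3\epsilon_2\epsilon_3tu^2)$ 24. $[x_{-3a-2b}(u),x_{a+b}(t)]=x_{-2a-b}(-\epsilon_5tu)\,x_{-a}(\epsilon_2\epsilon_5t^2u)\,x_{b}(\epsilon_1\epsilon_2\epsilon_5t^3u)\,x_{-3a-b}(\epsilon_2\epsilon_3t^3u^2)$ 25. $[x_{a+b}(u),x_{-3a-2b}(t)]=x_{-2a-b}(\epsilon_5tu)\,x_{-a}(-\epsilon_2\epsilon_5tu^2)\,x_{b}(-\epsilon_1\epsilon_2\epsilon_5tu^3)\,x_{-3a-b}(2\epsilon_2\epsilon_3t^2u^3)$ 26. $[x_{-a}(u),x_{2a+b}(t)]=x_{a+b}(2\epsilon_2tu)\,x_{3a+2b}(-3\epsilon_2\epsilon_5t^2u)\,x_{b}(-3\epsilon_1\epsilon_2tu^2)$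 27. $[x_{-a-b}(u),x_{2a+b}(t)]=x_{a}(-2\epsilon_2tu)\,x_{3a+b}(-3\epsilon_2\epsilon_3t^2u)\,x_{-b}(3\epsilon_1\epsilon_2tu^2)$ 28. $[x_{-3a-b}(u),x_{2a+b}(t)]=x_{-a}(-\epsilon_3tu)\,x_{a+b}(-\epsilon_2\epsilon_3t^2u)\,x_{3a+2b}(\epsilon_2\epsilon_3\epsilon_5t^3u)\,x_{b}(-\epsilon_1\epsilon_2t^3u^2)$ 29. $[x_{2a+b}(u),x_{-3a-b}(t)]=x_{-a}(\epsilon_3tu)\,x_{a+b}(\epsilon_2\epsilon_3tu^2)\,x_{3a+2b}(-\epsilon_2\epsilon_3\epsilon_5tu^3)\,x_{b}(-2\epsilon_1\epsilon_2t^2u^3)$ 30. $[x_{-3a-2b}(u),x_{2a+b}(t)]=x_{-a-b}(\epsilon_5tu)\,x_{a}(-\epsilon_2\epsilon_5t^2u)\,x_{3a+b}(-\epsilon_2\epsilon_3\epsilon_5t^3u)\,x_{-b}(\epsilon_1\epsilon_2t^3u^2)$ 31. $[x_{2a+b}(u),x_{-3a-2b}(t)]=x_{-a-b}(-\epsilon_5tu)\,x_{a}(\epsilon_2\epsilon_5tu^2)\,x_{3a+b}(\epsilon_2\epsilon_3\epsilon_5tu^3)\,x_{-b}(2\epsilon_1\epsilon_2t^2u^3)$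 32. $[x_{-a}(u),x_{3a+b}(t)]=x_{2a+b}(\epsilon_3tu)\,x_{a+b}(-\epsilon_2\epsilon_3tu^2)\,x_{b}(\epsilon_1\epsilon_2\epsilon_3tu^3)\,x_{3a+2b}(2\epsilon_2\epsilon_5t^2u^3)$ 33. $[x_{3a+b}(u),x_{-a}(t)]=x_{2a+b}(-\epsilon_3tu)\,x_{a+b}(\epsilon_2\epsilon_3t^2u)\,x_{b}(-\epsilon_1\epsilon_2\epsilon_3t^3u)\,x_{3a+2b}(\epsilon_2\epsilon_5t^3u^2)$ 34. $[x_{-2a-b}(u),x_{3a+b}(t)]=x_{a}(-\epsilon_3tu)\,x_{-a-b}(\epsilon_2\epsilon_3tu^2)\,x_{-3a-2b}(\epsilon_2\epsilon_3\epsilon_5tu^3)\,x_{-b}(-2\epsilon_1\epsilon_2t^2u^3)$ 35. $[x_{3a+b}(u),x_{-2a-b}(t)]=x_{a}(\epsilon_3tu)\,x_{-a-b}(-\epsilon_2\epsilon_3t^2u)\,x_{-3a-2b}(-\epsilon_2\epsilon_3\epsilon_5t^3u)\,x_{-b}(-\epsilon_1\epsilon_2t^3u^2)$ 36. $[x_{-3a-2b}(u),x_{3a+b}(t)]=x_{-b}(-\epsilon_4tu)$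 37. $[x_{-a-b}(u),x_{3a+2b}(t)]=x_{2a+b}(-\epsilon_5tu)\,x_{a}(-\epsilon_2\epsilon_5tu^2)\,x_{-b}(\epsilon_1\epsilon_2\epsilon_5tu^3)\,x_{3a+b}(2\epsilon_2\epsilon_3t^2u^3)$ 38. $[x_{3a+2b}(u),x_{-a-b}(t)]=x_{2a+b}(\epsilon_5tu)\,x_{a}(\epsilon_2\epsilon_5t^2u)\,x_{-b}(-\epsilon_1\epsilon_2\epsilon_5t^3u)\,x_{3a+b}(\epsilon_2\epsilon_3t^3u^2)$ 39. $[x_{-2a-b}(u),x_{3a+2b}(t)]=x_{a+b}(\epsilon_5tu)\,x_{-a}(\epsilon_2\epsilon_5tu^2)\,x_{-3a-b}(-\epsilon_2\epsilon_3\epsilon_5tu^3)\,x_{b}(2\epsilon_1\epsilon_2t^2u^3)$ 40. $[x_{3a+2b}(u),x_{-2a-b}(t)]=x_{a+b}(-\epsilon_5tu)\,x_{-a}(-\epsilon_2\epsilon_5t^2u)\,x_{-3a-b}(\epsilon_2\epsilon_3\epsilon_5t^3u)\,x_{b}(\epsilon_1\epsilon_2t^3u^2)$ 41. $[x_{-3a-b}(u),x_{3a+2b}(t)]=x_{b}(-\epsilon_4tu)$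 42. $[x_{b}(u),x_{-3a-2b}(t)]=x_{-3a-b}(-\epsilon_4tu)$ 43. $[x_{3a+b}(u),x_{-3a-2b}(t)]=x_{-b}(\epsilon_4tu)$ 44. $[x_{-b}(u),x_{-3a-b}(t)]=x_{-3a-2b}(-\epsilon_4tu)$ 45. $[x_{3a+2b}(u),x_{-3a-b}(t)]=x_{b}(\epsilon_4tu)$ 46. $[x_{-a-b}(u),x_{-2a-b}(t)]=x_{-3a-2b}(3\epsilon_5tu)$ 47. $[x_{-a}(u),x_{-2a-b}(t)]=x_{-3a-b}(-3\epsilon_3tu)$ 48. $[x_{a}(u),x_{-2a-b}(t)]=x_{-a-b}(-2\epsilon_2tu)\,x_{-3a-2b}(-3\epsilon_2\epsilon_5t^2u)\,x_{-b}(-3\epsilon_1\epsilon_2tu^2)$ 49. $[x_{a+b}(u),x_{-2a-b}(t)]=x_{-a}(2\epsilon_2tu)\,x_{-3a-b}(-3\epsilon_2\epsilon_3t^2u)\,x_{b}(3\epsilon_1\epsilon_2tu^2)$ 50. $[x_{-a}(u),x_{-a-b}(t)]=x_{-2a-b}(-2\epsilon_2tu)\,x_{-3a-2b}(3\epsilon_2\epsilon_5t^2u)\,x_{-3a-b}(-3\epsilon_2\epsilon_3tu^2)$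 51. $[x_{a}(u),x_{-a-b}(t)]=x_{-b}(-3\epsilon_1tu)$ 52. $[x_{2a+b}(u),x_{-a-b}(t)]=x_{a}(2\epsilon_2tu)\,x_{-b}(-3\epsilon_1\epsilon_2t^2u)\,x_{3a+b}(3\epsilon_2\epsilon_3tu^2)$ 53. $[x_{a+b}(u),x_{-a}(t)]=x_{b}(-3\epsilon_1tu)$ 54. $[x_{2a+b}(u),x_{-a}(t)]=x_{a+b}(-2\epsilon_2tu)\,x_{b}(3\epsilon_1\epsilon_2t^2u)\,x_{3a+2b}(3\epsilon_2\epsilon_5tu^2)$ 55. $[x_{3a+2b}(u),x_{-b}(t)]=x_{3a+b}(-\epsilon_4tu)$ 56. $[x_{a}(u),x_{a+b}(t)]=x_{2a+b}(2\epsilon_2tu)\,x_{3a+2b}(3\epsilon_2\epsilon_5t^2u)\,x_{3a+b}(-3\epsilon_2\epsilon_3tu^2)$ 57. $[x_{a}(u),x_{2a+b}(t)]=x_{3a+b}(3\epsilon_3tu)$ 58. $[x_{a+b}(u),x_{2a+b}(t)]=x_{3a+2b}(-3\epsilon_5tu)$ 59. $[x_{b}(u),x_{3a+b}(t)]=x_{3a+2b}(\epsilon_4tu)$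 60. $[x_{-b}(u),x_{3a+2b}(t)]=x_{3a+b}(\epsilon_4tu)$ -/

import Mathlib

namespace G2

open Module TensorProduct

section LieAlgebra

open LieAlgebra.IsKilling (rootSystem)

variable {L : Type*} [LieRing L] [LieAlgebra ℂ L] [FiniteDimensional ℂ L]
  [LieAlgebra.IsSimple ℂ L]

/-- The set of roots of a complex simple Lie algebra with respect to a Cartan subalgebra `H`,
as linear forms on `H`. -/
abbrev roots (H : LieSubalgebra ℂ L) [H.IsCartanSubalgebra] : Set (Dual ℂ H) :=
  Set.range (rootSystem H).root

/-- `a` and `b` are roots with `2 (b, a) / (a, a) = -3`. As the Lie algebra is simple, this says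
that its root system has type `G₂` and that `a`, `b` are fundamental roots, `a` being short. -/
def IsFundamentalPair (H : LieSubalgebra ℂ L) [H.IsCartanSubalgebra] (a b : Dual ℂ H) : Prop :=
  ∃ i j : H.root, (rootSystem H).root i = a ∧
    (rootSystem H).root j = b ∧
    (rootSystem H).pairing j i = -3

/-- A Chevalley basis of a complex simple Lie algebra: root vectors `e r` with
`[e r, e (-r)] = h r` (the coroot of `r`) and `[e r, e s] = ± (p + 1) e (r + s)` whenever
`r`, `s`, `r + s` are roots, where `p` is the greatest integer for which `s - p r` is a root.
The basis itself consists of all `e r` and of the `h r` with `r` fundamental. The `N r s` are the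
structure constants. For convenience `e` and `N` are extended by zero
to linear forms that are not roots. -/
structure ChevalleyBasis (H : LieSubalgebra ℂ L) [H.IsCartanSubalgebra] where
  /-- the root vectors -/
  e : Dual ℂ H → L
  /-- the structure constants -/
  N : Dual ℂ H → Dual ℂ H → ℤ
  e_mem : ∀ r ∈ roots H, e r ∈ LieAlgebra.rootSpace H r
  lie_e_neg : ∀ i : H.root, ⁅e ((rootSystem H).root i),
    e (-(rootSystem H).root i)⁆ =
      ((rootSystem H).coroot i : L)
  lie_e_e : ∀ r ∈ roots H, ∀ s ∈ roots H, r + s ∈ roots H → ⁅e r, e s⁆ = N r s • e (r + s)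
  abs_N : ∀ i j : H.root, (rootSystem H).root i +
      (rootSystem H).root j ∈ roots H →
    |N ((rootSystem H).root i)
      ((rootSystem H).root j)| =
        (rootSystem H).chainBotCoeff i j + 1
  e_eq_zero : ∀ r, r ∉ roots H → e r = 0
  N_eq_zero : ∀ r s, ¬ (r ∈ roots H ∧ s ∈ roots H ∧ r + s ∈ roots H) → N r s = 0

namespace ChevalleyBasis

variable {H : LieSubalgebra ℂ L} [H.IsCartanSubalgebra] (B : ChevalleyBasis H)

/-- The lattice `L_ℤ` spanned over `ℤ` by the Chevalley basis. (Every coroot is an integral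
combination of the fundamental ones, so that all of them may be listed here.) -/
def lattice : Submodule ℤ L :=
  Submodule.span ℤ (B.e '' roots H ∪
    Set.range fun i : H.root => ((rootSystem H).coroot i : L))

/-- The operator `(ad e_r)ⁿ / n!` on `L`. -/
noncomputable def adDiv (r : Dual ℂ H) (n : ℕ) : L →ₗ[ℂ] L :=
  (n.factorial : ℂ)⁻¹ • (LieAlgebra.ad ℂ L (B.e r)) ^ n

lemma e_mem_lattice (r : Dual ℂ H) : B.e r ∈ B.lattice := by
  by_cases hr : r ∈ roots H
  · exact Submodule.subset_span (Or.inl ⟨r, hr, rfl⟩)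
  · rw [B.e_eq_zero r hr]; exact zero_mem _

lemma coroot_mem_lattice (i : H.root) : ((rootSystem H).coroot i : L) ∈ B.lattice :=
  Submodule.subset_span (Or.inr ⟨i, rfl⟩)

lemma lie_eq_zero {r s : Dual ℂ H} (hr : r ∈ roots H) (hs : s ∈ roots H) (h0 : r + s ≠ 0)
    (hrs : r + s ∉ roots H) : ⁅B.e r, B.e s⁆ = 0 := by
  have h := LieAlgebra.lie_mem_genWeightSpace_of_mem_genWeightSpace (B.e_mem r hr) (B.e_mem s hs)
  by_contra hne
  have hbot : LieModule.genWeightSpace L ((r : H → ℂ) + (s : H → ℂ)) ≠ ⊥ := by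
    intro hb
    rw [hb] at h
    exact hne (by simpa using h)
  let W : LieModule.Weight ℂ H L := ⟨_, hbot⟩
  have hW : W.IsNonZero := fun hz => h0 (LinearMap.ext fun x => congrFun hz x)
  exact hrs ⟨⟨W, by simpa using hW⟩, LinearMap.ext fun x => rfl⟩

lemma lie_coroot (i : H.root) {r : Dual ℂ H} (hr : r ∈ roots H) :
    ⁅B.e r, ((rootSystem H).coroot i : L)⁆ =
      -(r ((rootSystem H).coroot i) • B.e r) := by
  rw [← lie_skew]
  congr 1
  exact LieAlgebra.IsKilling.lie_eq_smul_of_mem_rootSpace (B.e_mem r hr) _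

lemma exists_int (i : H.root) {r : Dual ℂ H} (hr : r ∈ roots H) :
    ∃ m : ℤ, r ((rootSystem H).coroot i) = m := by
  obtain ⟨j, rfl⟩ := hr
  obtain ⟨m, hm⟩ := (rootSystem H).exists_value (S := ℤ) j i
  exact ⟨m, by simpa using hm.symm⟩

lemma ad_pow_e (i j : H.root)
    (hij : LinearIndependent ℂ ![(rootSystem H).root i,
      (rootSystem H).root j]) (n : ℕ) :
    (LieAlgebra.ad ℂ L (B.e ((rootSystem H).root i)) ^ n)
        (B.e ((rootSystem H).root j)) = 0 ∨
      ∃ (k : H.root) (m : ℤ),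
        LinearIndependent ℂ ![(rootSystem H).root i,
          (rootSystem H).root k] ∧
        (rootSystem H).chainBotCoeff i k =
          (rootSystem H).chainBotCoeff i j + n ∧
        |m| = ((rootSystem H).chainBotCoeff i j + 1).ascFactorial n ∧
        (LieAlgebra.ad ℂ L (B.e ((rootSystem H).root i)) ^ n)
          (B.e ((rootSystem H).root j)) =
            m • B.e ((rootSystem H).root k) := by
  induction n with
  | zero => exact Or.inr ⟨j, 1, hij, by simp, by simp, by simp⟩
  | succ n ih =>
    rcases ih with h | ⟨k, m, hik, hc, hm, h⟩
    · left; rw [pow_succ', Module.End.mul_apply, h, map_zero]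
    · rw [pow_succ', Module.End.mul_apply, h, map_zsmul, LieAlgebra.ad_apply]
      by_cases hk : (rootSystem H).root i + (rootSystem H).root k ∈ roots H
      · right
        obtain ⟨l, hl⟩ := id hk
        have hl' : (rootSystem H).root l = (rootSystem H).root k + (rootSystem H).root i := by rw [hl, add_comm]
        refine ⟨l, m * B.N ((rootSystem H).root i) ((rootSystem H).root k), ?_, ?_, ?_, ?_⟩
        · rw [hl', add_comm]; simpa [-LieAlgebra.IsKilling.rootSystem_root_apply] using hik
        · rw [RootPairing.chainBotCoeff_of_add hik hl', hc]; ring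
        · rw [abs_mul, hm, B.abs_N i k hk, hc, Nat.ascFactorial_succ]
          push_cast; ring
        · rw [B.lie_e_e _ ⟨i, rfl⟩ _ ⟨k, rfl⟩ hk, smul_smul, hl', add_comm]
      · left
        rw [B.lie_eq_zero ⟨i, rfl⟩ ⟨k, rfl⟩ _ hk, smul_zero]
        intro h0
        have := LinearIndependent.pair_iff.1 hik 1 1 (by simpa [-LieAlgebra.IsKilling.rootSystem_root_apply] using h0)
        exact one_ne_zero this.1

lemma adDiv_e_mem (r s : Dual ℂ H) (n : ℕ) : B.adDiv r n (B.e s) ∈ B.lattice := by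
  rcases Nat.eq_zero_or_pos n with rfl | hn
  · simpa [-LieAlgebra.IsKilling.rootSystem_root_apply, -LieAlgebra.IsKilling.rootSystem_coroot_apply,
        adDiv] using B.e_mem_lattice s
  by_cases hr : r ∈ roots H
  swap
  · simp [-LieAlgebra.IsKilling.rootSystem_root_apply, -LieAlgebra.IsKilling.rootSystem_coroot_apply,
        adDiv, B.e_eq_zero r hr, hn.ne']
  by_cases hs : s ∈ roots H
  swap
  · simp [B.e_eq_zero s hs]
  obtain ⟨i, rfl⟩ := hr
  obtain ⟨j, rfl⟩ := hs
  by_cases h1 : i = j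
  · subst h1
    obtain ⟨m, rfl⟩ := Nat.exists_eq_succ_of_ne_zero hn.ne'
    simp [-LieAlgebra.IsKilling.rootSystem_root_apply, -LieAlgebra.IsKilling.rootSystem_coroot_apply,
        adDiv, pow_succ]
  by_cases h2 : (rootSystem H).root i = -(rootSystem H).root j
  · have h2' : (rootSystem H).root j = -(rootSystem H).root i := by rw [h2, neg_neg]
    have hi : ((rootSystem H).coroot i : L) ∈ B.lattice := Submodule.subset_span (Or.inr ⟨i, rfl⟩)
    have e1 := B.lie_e_neg i
    have e2 := B.lie_coroot i (r := (rootSystem H).root i) ⟨i, rfl⟩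
    have e3 : (rootSystem H).root i ((rootSystem H).coroot i) = 2 := (rootSystem H).root_coroot_two i
    rw [e3] at e2
    rw [h2']
    rcases n with _ | _ | _ | n
    · omega
    · simpa [-LieAlgebra.IsKilling.rootSystem_root_apply, -LieAlgebra.IsKilling.rootSystem_coroot_apply,
        adDiv, e1] using hi
    · have : B.adDiv ((rootSystem H).root i) 2 (B.e (-(rootSystem H).root i)) = -B.e ((rootSystem H).root i) := by
        simp [-LieAlgebra.IsKilling.rootSystem_root_apply, -LieAlgebra.IsKilling.rootSystem_coroot_apply,
        adDiv, pow_succ, e1, e2, Nat.factorial]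
      rw [this]
      exact neg_mem (B.e_mem_lattice _)
    · simp [-LieAlgebra.IsKilling.rootSystem_root_apply, -LieAlgebra.IsKilling.rootSystem_coroot_apply,
        adDiv, pow_succ, e1, e2]
  · have hij : LinearIndependent ℂ ![(rootSystem H).root i, (rootSystem H).root j] :=
      RootPairing.IsReduced.linearIndependent (rootSystem H) h1 h2
    rcases B.ad_pow_e i j hij n with h | ⟨k, m, -, -, hm, h⟩
    · simp [-LieAlgebra.IsKilling.rootSystem_root_apply, -LieAlgebra.IsKilling.rootSystem_coroot_apply,
        adDiv, h]
    · have hd : (n.factorial : ℤ) ∣ m := by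
        rw [← dvd_abs, hm]
        exact_mod_cast Nat.factorial_dvd_ascFactorial _ _
      obtain ⟨c, rfl⟩ := hd
      have hf : (n.factorial : ℂ) ≠ 0 := by exact_mod_cast n.factorial_ne_zero
      have : B.adDiv ((rootSystem H).root i) n (B.e ((rootSystem H).root j)) = c • B.e ((rootSystem H).root k) := by
        rw [adDiv, LinearMap.smul_apply, h, ← Int.cast_smul_eq_zsmul ℂ, smul_smul,
          ← Int.cast_smul_eq_zsmul ℂ]
        push_cast
        rw [inv_mul_cancel_left₀ hf]
      rw [this]
      exact Submodule.smul_mem _ _ (B.e_mem_lattice _)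

lemma adDiv_coroot_mem (r : Dual ℂ H) (i : H.root) (n : ℕ) :
    B.adDiv r n ((rootSystem H).coroot i : L) ∈ B.lattice := by
  by_cases hr : r ∈ roots H
  · obtain ⟨m, hm⟩ := exists_int i hr
    have e1 := B.lie_coroot i hr
    rw [hm, Int.cast_smul_eq_zsmul] at e1
    rcases n with _ | _ | n
    · simpa [-LieAlgebra.IsKilling.rootSystem_root_apply, -LieAlgebra.IsKilling.rootSystem_coroot_apply,
        adDiv] using B.coroot_mem_lattice i
    · simpa [-LieAlgebra.IsKilling.rootSystem_root_apply, -LieAlgebra.IsKilling.rootSystem_coroot_apply,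
        adDiv, e1] using Submodule.smul_mem _ m (B.e_mem_lattice r)
    · simp [-LieAlgebra.IsKilling.rootSystem_root_apply, -LieAlgebra.IsKilling.rootSystem_coroot_apply,
        adDiv, pow_succ, e1]
  · rcases Nat.eq_zero_or_pos n with rfl | hn
    · simpa [-LieAlgebra.IsKilling.rootSystem_root_apply, -LieAlgebra.IsKilling.rootSystem_coroot_apply,
        adDiv] using B.coroot_mem_lattice i
    · simp [-LieAlgebra.IsKilling.rootSystem_root_apply, -LieAlgebra.IsKilling.rootSystem_coroot_apply,
        adDiv, B.e_eq_zero r hr, hn.ne']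

lemma adDiv_mem (r : Dual ℂ H) (n : ℕ) (v : L) (hv : v ∈ B.lattice) :
    B.adDiv r n v ∈ B.lattice := by
  induction hv using Submodule.span_induction with
  | mem v hv =>
    rcases hv with ⟨s, -, rfl⟩ | ⟨i, rfl⟩
    · exact B.adDiv_e_mem r s n
    · exact B.adDiv_coroot_mem r i n
  | zero => simp
  | add v w _ _ hv hw => simpa using add_mem hv hw
  | smul c v _ hv => simpa using Submodule.smul_mem _ c hv

/-- The operator `(ad e_r)ⁿ / n!` on the lattice `L_ℤ`. -/
noncomputable def latticeDiv (r : Dual ℂ H) (n : ℕ) : B.lattice →ₗ[ℤ] B.lattice :=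
  ((B.adDiv r n).restrictScalars ℤ).restrict (B.adDiv_mem r n)

lemma isNilpotent_ad (r : Dual ℂ H) : IsNilpotent (LieAlgebra.ad ℂ L (B.e r)) := by
  by_cases hr : r ∈ roots H
  · have h0 : (r : H → ℂ) ≠ 0 := by
      obtain ⟨i, rfl⟩ := hr
      intro h
      exact (rootSystem H).ne_zero i (LinearMap.ext fun x => congrFun h x)
    exact LieAlgebra.isNilpotent_ad_of_mem_rootSpace H h0 (B.e_mem r hr)
  · simp [B.e_eq_zero r hr]

lemma latticeDiv_zero (r : Dual ℂ H) : B.latticeDiv r 0 = 1 := by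
  ext v; simp [latticeDiv, adDiv]

lemma latticeDiv_eq_zero (r : Dual ℂ H) {n : ℕ}
    (hn : nilpotencyClass (LieAlgebra.ad ℂ L (B.e r)) ≤ n) : B.latticeDiv r n = 0 := by
  ext v
  simp [latticeDiv, adDiv, pow_eq_zero_of_le hn (pow_nilpotencyClass (B.isNilpotent_ad r))]

lemma latticeDiv_mul (r : Dual ℂ H) (m n : ℕ) :
    B.latticeDiv r m * B.latticeDiv r n = ((m + n).choose m) • B.latticeDiv r (m + n) := by
  have h : B.adDiv r m * B.adDiv r n = ((m + n).choose m : ℂ) • B.adDiv r (m + n) := by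
    rw [adDiv, adDiv, adDiv, smul_mul_smul_comm, ← pow_add, smul_smul]
    congr 1
    have h1 : (m.factorial : ℂ) ≠ 0 := by exact_mod_cast m.factorial_ne_zero
    have h2 : (n.factorial : ℂ) ≠ 0 := by exact_mod_cast n.factorial_ne_zero
    have h3 : ((m + n).factorial : ℂ) ≠ 0 := by exact_mod_cast (m + n).factorial_ne_zero
    have h4 : ((m + n).choose m : ℂ) * m.factorial * n.factorial = (m + n).factorial := by
      rw [Nat.choose_symm_add]
      exact_mod_cast Nat.add_choose_mul_factorial_mul_factorial m n
    field_simp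
    rw [← h4]; ring
  ext v
  have := LinearMap.congr_fun h (v : L)
  rw [Nat.cast_smul_eq_nsmul] at this
  exact this

variable (K : Type*) [CommRing K]

/-- The operator `x_r(t) = exp (t ad e_r) = ∑ tⁿ (ad e_r)ⁿ / n!` on `L_K = K ⊗ L_ℤ`. -/
noncomputable def expEnd (r : Dual ℂ H) (t : K) : Module.End K (K ⊗[ℤ] B.lattice) :=
  ∑ n ∈ Finset.range (nilpotencyClass (LieAlgebra.ad ℂ L (B.e r))),
    t ^ n • (B.latticeDiv r n).baseChange K

lemma expEnd_zero (r : Dual ℂ H) : B.expEnd K r 0 = 1 := by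
  have h : nilpotencyClass (LieAlgebra.ad ℂ L (B.e r)) ≠ 0 := by
    have : Nontrivial L := by
      by_contra h
      have : Subsingleton L := not_nontrivial_iff_subsingleton.1 h
      exact LieAlgebra.IsSimple.non_abelian ℂ (L := L) ⟨fun x y => Subsingleton.elim _ _⟩
    exact (pos_nilpotencyClass_iff.2 (B.isNilpotent_ad r)).ne'
  obtain ⟨k, hk⟩ := Nat.exists_eq_succ_of_ne_zero h
  rw [expEnd, hk, Finset.sum_range_succ']
  simp [latticeDiv_zero]

lemma expEnd_add (r : Dual ℂ H) (s t : K) :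
    B.expEnd K r (s + t) = B.expEnd K r s * B.expEnd K r t := by
  set k := nilpotencyClass (LieAlgebra.ad ℂ L (B.e r)) with hk
  have hmul : ∀ i j : ℕ, (s ^ i • (B.latticeDiv r i).baseChange K) *
      (t ^ j • (B.latticeDiv r j).baseChange K) =
        (s ^ i * t ^ j * ((i + j).choose i : K)) • (B.latticeDiv r (i + j)).baseChange K := by
    intro i j
    rw [smul_mul_smul_comm, Module.End.mul_eq_comp, ← LinearMap.baseChange_comp,
      ← Module.End.mul_eq_comp, latticeDiv_mul, mul_smul (s ^ i * t ^ j)]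
    congr 1
    rw [← Nat.cast_smul_eq_nsmul ℤ, LinearMap.baseChange_smul, Nat.cast_smul_eq_nsmul,
      Nat.cast_smul_eq_nsmul]
  have hR : B.expEnd K r s * B.expEnd K r t = ∑ i ∈ Finset.range k, ∑ j ∈ Finset.range (k - i),
      (s ^ i * t ^ j * ((i + j).choose i : K)) • (B.latticeDiv r (i + j)).baseChange K := by
    rw [expEnd, expEnd, Finset.sum_mul_sum]
    refine Finset.sum_congr rfl fun i _ => ?_
    simp only [hmul]
    symm
    refine Finset.sum_subset (Finset.range_mono (Nat.sub_le k i)) fun j _ hj => ?_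
    rw [B.latticeDiv_eq_zero r (n := i + j) (by rw [Finset.mem_range] at hj; omega)]
    simp
  rw [hR, ← Finset.sum_range_diag_flip k fun i j =>
    (s ^ i * t ^ j * ((i + j).choose i : K)) • (B.latticeDiv r (i + j)).baseChange K, expEnd]
  refine Finset.sum_congr rfl fun n _ => ?_
  rw [add_pow, Finset.sum_smul]
  refine Finset.sum_congr rfl fun i hi => ?_
  rw [Nat.add_sub_cancel' (Finset.mem_range_succ_iff.1 hi)]

/-- The root element `x_r(t)` as an invertible operator on `L_K`. -/
noncomputable def expUnit (r : Dual ℂ H) (t : K) :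
    LinearMap.GeneralLinearGroup K (K ⊗[ℤ] B.lattice) where
  val := B.expEnd K r t
  inv := B.expEnd K r (-t)
  val_inv := by rw [← expEnd_add, add_neg_cancel, expEnd_zero]
  inv_val := by rw [← expEnd_add, neg_add_cancel, expEnd_zero]

/-- The Chevalley group over `K`: the group of operators on `L_K` generated by all `x_r(t)`,
where `r` is a root and `t ∈ K`. -/
def chevalleyGroup : Subgroup (LinearMap.GeneralLinearGroup K (K ⊗[ℤ] B.lattice)) :=
  Subgroup.closure {g | ∃ r ∈ roots H, ∃ t : K, B.expUnit K r t = g}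

lemma expUnit_mem (r : Dual ℂ H) (t : K) : B.expUnit K r t ∈ B.chevalleyGroup K := by
  by_cases hr : r ∈ roots H
  · exact Subgroup.subset_closure ⟨r, hr, t, rfl⟩
  · have h : B.expUnit K r t = 1 := by
      have hn : ∀ n ≠ 0, B.latticeDiv r n = 0 := fun n hn => by
        ext v; simp [latticeDiv, adDiv, B.e_eq_zero r hr, hn]
      ext1
      change B.expEnd K r t = 1
      rw [← B.expEnd_zero K r, expEnd, expEnd]
      refine Finset.sum_congr rfl fun n _ => ?_
      rcases eq_or_ne n 0 with rfl | h0
      · simp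
      · simp [hn n h0]
    rw [h]
    exact one_mem _

variable {K} in
/-- The root element `x_r(t)` of the Chevalley group over `K`. (It is the identity if the linear
form `r` is not a root.) -/
noncomputable def x (r : Dual ℂ H) (t : K) : B.chevalleyGroup K :=
  ⟨B.expUnit K r t, B.expUnit_mem K r t⟩

/-- `M_{r,s,i} = N_{r,s} N_{r,r+s} ⋯ N_{r,(i-1)r+s} / i!`. -/
def M (r s : Dual ℂ H) (i : ℕ) : ℚ :=
  (∏ k ∈ Finset.range i, (B.N r (k • r + s) : ℚ)) / i.factorial

/-- The constants `C_{ij,rs}` of Chevalley's commutator formula. -/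
def C (i j : ℕ) (r s : Dual ℂ H) : ℚ :=
  match i, j with
  | i, 1 => B.M r s i
  | 1, j => (-1) ^ j * B.M s r j
  | 3, 2 => 1 / 3 * B.M (r + s) r 2
  | 2, 3 => -(2 / 3) * B.M (s + r) s 2
  | _, _ => 0


end ChevalleyBasis

/-- The commutator `[g, h] = g⁻¹ h⁻¹ g h`. -/
def comm {G : Type*} [Group G] (g h : G) : G := g⁻¹ * h⁻¹ * g * h

/-- The pairs `(i, j)` in the order of the factors of Chevalley's commutator formula
(increasing `i + j`). -/
def orderedPairs : List (ℕ × ℕ) := [(1, 1), (2, 1), (1, 2), (3, 1), (1, 3), (3, 2), (2, 3)]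

open Classical in
/-- The product of the root elements `x_{ir+js}(c_{ij} (-t)^i u^j)` over all pairs `(i, j)` of the
list for which `i r + j s` is a root, in the order of the list. -/
noncomputable def rootProduct {H : LieSubalgebra ℂ L} [H.IsCartanSubalgebra]
    (B : ChevalleyBasis H) {K : Type*} [CommRing K] (c : ℕ → ℕ → ℤ) (r s : Dual ℂ H) (t u : K) :
    B.chevalleyGroup K :=
  ((orderedPairs.filter fun p => p.1 • r + p.2 • s ∈ roots H).map fun p =>
    B.x (p.1 • r + p.2 • s) ((c p.1 p.2 : K) * (-t) ^ p.1 * u ^ p.2)).prod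

end LieAlgebra

/-- `C_{ij,rs} = c` for all entries `((i, j), c)` of the list `l`. -/
def ConstantsAre {V : Type*} (C : ℕ → ℕ → V → V → ℚ) (r s : V) (l : List ((ℕ × ℕ) × ℚ)) : Prop :=
  ∀ p ∈ l, C p.1.1 p.1.2 r s = p.2

/-- The values of all constants `C_{ij,rs}` in type `G₂` (`a` short, `b` long). -/
def ConstantTable {V : Type*} [AddCommGroup V] (C : ℕ → ℕ → V → V → ℚ) (a b : V)
    (ε₁ ε₂ ε₃ ε₄ ε₅ : ℚ) : Prop :=
  ConstantsAre C a b [((1, 1), ε₁), ((2, 1), ε₁ * ε₂), ((3, 1), ε₁ * ε₂ * ε₃), ((3, 2), ε₂ * ε₅)] ∧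
  ConstantsAre C b a [((1, 1), -ε₁), ((1, 2), ε₁ * ε₂), ((1, 3), -ε₁ * ε₂ * ε₃), ((2, 3), -2 * ε₂ * ε₅)] ∧
  ConstantsAre C a (a + b) [((1, 1), 2 * ε₂), ((2, 1), 3 * ε₂ * ε₃), ((1, 2), 3 * ε₂ * ε₅)] ∧
  ConstantsAre C a ((2 : ℕ) • a + b) [((1, 1), 3 * ε₃)] ∧
  ConstantsAre C b ((3 : ℕ) • a + b) [((1, 1), ε₄)] ∧
  ConstantsAre C (a + b) ((2 : ℕ) • a + b) [((1, 1), -3 * ε₅)] ∧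
  ConstantsAre C (-a) (-b) [((1, 1), -ε₁), ((2, 1), ε₁ * ε₂), ((3, 1), -ε₁ * ε₂ * ε₃), ((3, 2), ε₂ * ε₅)] ∧
  ConstantsAre C (-b) (-a) [((1, 1), ε₁), ((1, 2), ε₁ * ε₂), ((1, 3), ε₁ * ε₂ * ε₃), ((2, 3), -2 * ε₂ * ε₅)] ∧
  ConstantsAre C (-a) (-a - b) [((1, 1), -2 * ε₂), ((2, 1), 3 * ε₂ * ε₃), ((1, 2), 3 * ε₂ * ε₅)] ∧
  ConstantsAre C (-a) (-((2 : ℕ) • a) - b) [((1, 1), -3 * ε₃)] ∧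
  ConstantsAre C (-b) (-((3 : ℕ) • a) - b) [((1, 1), -ε₄)] ∧
  ConstantsAre C (-a - b) (-((2 : ℕ) • a) - b) [((1, 1), 3 * ε₅)] ∧
  ConstantsAre C a (-a - b) [((1, 1), -3 * ε₁)] ∧
  ConstantsAre C a (-((2 : ℕ) • a) - b) [((1, 1), -2 * ε₂), ((2, 1), 3 * ε₁ * ε₂), ((1, 2), -3 * ε₂ * ε₅)] ∧
  ConstantsAre C a (-((3 : ℕ) • a) - b) [((1, 1), -ε₃), ((2, 1), ε₂ * ε₃), ((3, 1), -ε₁ * ε₂ * ε₃), ((3, 2), -ε₂ * ε₅)] ∧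
  ConstantsAre C (-((3 : ℕ) • a) - b) a [((1, 1), ε₃), ((1, 2), ε₂ * ε₃), ((1, 3), ε₁ * ε₂ * ε₃), ((2, 3), 2 * ε₂ * ε₅)] ∧
  ConstantsAre C (-a - b) b [((1, 1), -ε₁), ((2, 1), -ε₁ * ε₂), ((3, 1), -ε₁ * ε₂ * ε₅), ((3, 2), ε₂ * ε₃)] ∧
  ConstantsAre C b (-a - b) [((1, 1), ε₁), ((1, 2), -ε₁ * ε₂), ((1, 3), ε₁ * ε₂ * ε₅), ((2, 3), -2 * ε₂ * ε₃)] ∧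
  ConstantsAre C b (-((3 : ℕ) • a) - (2 : ℕ) • b) [((1, 1), -ε₄)] ∧
  ConstantsAre C (a + b) (-a) [((1, 1), -3 * ε₁)] ∧
  ConstantsAre C (a + b) (-b) [((1, 1), ε₁), ((2, 1), -ε₁ * ε₂), ((3, 1), ε₁ * ε₂ * ε₅), ((3, 2), ε₂ * ε₃)] ∧
  ConstantsAre C (-b) (a + b) [((1, 1), -ε₁), ((1, 2), -ε₁ * ε₂), ((1, 3), -ε₁ * ε₂ * ε₅), ((2, 3), -2 * ε₂ * ε₃)] ∧
  ConstantsAre C (a + b) (-((2 : ℕ) • a) - b) [((1, 1), 2 * ε₂), ((2, 1), -3 * ε₁ * ε₂), ((1, 2), -3 * ε₂ * ε₃)] ∧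
  ConstantsAre C (a + b) (-((3 : ℕ) • a) - (2 : ℕ) • b) [((1, 1), ε₅), ((2, 1), ε₂ * ε₅), ((3, 1), -ε₁ * ε₂ * ε₅), ((3, 2), -ε₂ * ε₃)] ∧
  ConstantsAre C (-((3 : ℕ) • a) - (2 : ℕ) • b) (a + b) [((1, 1), -ε₅), ((1, 2), ε₂ * ε₅), ((1, 3), ε₁ * ε₂ * ε₅), ((2, 3), 2 * ε₂ * ε₃)] ∧
  ConstantsAre C ((2 : ℕ) • a + b) (-a) [((1, 1), -2 * ε₂), ((2, 1), -3 * ε₂ * ε₅), ((1, 2), 3 * ε₁ * ε₂)] ∧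
  ConstantsAre C ((2 : ℕ) • a + b) (-a - b) [((1, 1), 2 * ε₂), ((2, 1), -3 * ε₂ * ε₃), ((1, 2), -3 * ε₁ * ε₂)] ∧
  ConstantsAre C ((2 : ℕ) • a + b) (-((3 : ℕ) • a) - b) [((1, 1), ε₃), ((2, 1), -ε₂ * ε₃), ((3, 1), -ε₂ * ε₃ * ε₅), ((3, 2), ε₁ * ε₂)] ∧
  ConstantsAre C (-((3 : ℕ) • a) - b) ((2 : ℕ) • a + b) [((1, 1), -ε₃), ((1, 2), -ε₂ * ε₃), ((1, 3), ε₂ * ε₃ * ε₅), ((2, 3), -2 * ε₁ * ε₂)] ∧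
  ConstantsAre C ((2 : ℕ) • a + b) (-((3 : ℕ) • a) - (2 : ℕ) • b) [((1, 1), -ε₅), ((2, 1), -ε₂ * ε₅), ((3, 1), ε₂ * ε₃ * ε₅), ((3, 2), -ε₁ * ε₂)] ∧
  ConstantsAre C (-((3 : ℕ) • a) - (2 : ℕ) • b) ((2 : ℕ) • a + b) [((1, 1), ε₅), ((1, 2), -ε₂ * ε₅), ((1, 3), -ε₂ * ε₃ * ε₅), ((2, 3), 2 * ε₁ * ε₂)] ∧
  ConstantsAre C ((3 : ℕ) • a + b) (-a) [((1, 1), -ε₃), ((1, 2), ε₂ * ε₃), ((1, 3), -ε₁ * ε₂ * ε₃), ((2, 3), 2 * ε₂ * ε₅)] ∧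
  ConstantsAre C (-a) ((3 : ℕ) • a + b) [((1, 1), ε₃), ((2, 1), ε₂ * ε₃), ((3, 1), ε₁ * ε₂ * ε₃), ((3, 2), -ε₂ * ε₅)] ∧
  ConstantsAre C ((3 : ℕ) • a + b) (-((2 : ℕ) • a) - b) [((1, 1), ε₃), ((1, 2), -ε₂ * ε₃), ((1, 3), -ε₂ * ε₃ * ε₅), ((2, 3), -2 * ε₁ * ε₂)] ∧
  ConstantsAre C (-((2 : ℕ) • a) - b) ((3 : ℕ) • a + b) [((1, 1), -ε₃), ((2, 1), -ε₂ * ε₃), ((3, 1), ε₂ * ε₃ * ε₅), ((3, 2), ε₁ * ε₂)] ∧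
  ConstantsAre C ((3 : ℕ) • a + b) (-((3 : ℕ) • a) - (2 : ℕ) • b) [((1, 1), ε₄)] ∧
  ConstantsAre C ((3 : ℕ) • a + (2 : ℕ) • b) (-a - b) [((1, 1), ε₅), ((1, 2), ε₂ * ε₅), ((1, 3), -ε₁ * ε₂ * ε₅), ((2, 3), 2 * ε₂ * ε₃)] ∧
  ConstantsAre C (-a - b) ((3 : ℕ) • a + (2 : ℕ) • b) [((1, 1), -ε₅), ((2, 1), ε₂ * ε₅), ((3, 1), ε₁ * ε₂ * ε₅), ((3, 2), -ε₂ * ε₃)] ∧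
  ConstantsAre C ((3 : ℕ) • a + (2 : ℕ) • b) (-((2 : ℕ) • a) - b) [((1, 1), -ε₅), ((1, 2), -ε₂ * ε₅), ((1, 3), ε₂ * ε₃ * ε₅), ((2, 3), 2 * ε₁ * ε₂)] ∧
  ConstantsAre C (-((2 : ℕ) • a) - b) ((3 : ℕ) • a + (2 : ℕ) • b) [((1, 1), ε₅), ((2, 1), -ε₂ * ε₅), ((3, 1), -ε₂ * ε₃ * ε₅), ((3, 2), -ε₁ * ε₂)] ∧
  ConstantsAre C ((3 : ℕ) • a + (2 : ℕ) • b) (-((3 : ℕ) • a) - b) [((1, 1), ε₄)] ∧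
  ConstantsAre C (-((3 : ℕ) • a) - (2 : ℕ) • b) b [((1, 1), ε₄)] ∧
  ConstantsAre C (-((3 : ℕ) • a) - (2 : ℕ) • b) ((3 : ℕ) • a + b) [((1, 1), -ε₄)] ∧
  ConstantsAre C (-((3 : ℕ) • a) - b) (-b) [((1, 1), ε₄)] ∧
  ConstantsAre C (-((3 : ℕ) • a) - b) ((3 : ℕ) • a + (2 : ℕ) • b) [((1, 1), -ε₄)] ∧
  ConstantsAre C (-((2 : ℕ) • a) - b) (-a - b) [((1, 1), -3 * ε₅)] ∧
  ConstantsAre C (-((2 : ℕ) • a) - b) (-a) [((1, 1), 3 * ε₃)] ∧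
  ConstantsAre C (-((2 : ℕ) • a) - b) a [((1, 1), 2 * ε₂), ((2, 1), -3 * ε₂ * ε₅), ((1, 2), 3 * ε₁ * ε₂)] ∧
  ConstantsAre C (-((2 : ℕ) • a) - b) (a + b) [((1, 1), -2 * ε₂), ((2, 1), -3 * ε₂ * ε₃), ((1, 2), -3 * ε₁ * ε₂)] ∧
  ConstantsAre C (-a - b) (-a) [((1, 1), 2 * ε₂), ((2, 1), 3 * ε₂ * ε₅), ((1, 2), 3 * ε₂ * ε₃)] ∧
  ConstantsAre C (-a - b) a [((1, 1), 3 * ε₁)] ∧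
  ConstantsAre C (-a - b) ((2 : ℕ) • a + b) [((1, 1), -2 * ε₂), ((2, 1), -3 * ε₁ * ε₂), ((1, 2), -3 * ε₂ * ε₃)] ∧
  ConstantsAre C (-a) (a + b) [((1, 1), 3 * ε₁)] ∧
  ConstantsAre C (-a) ((2 : ℕ) • a + b) [((1, 1), 2 * ε₂), ((2, 1), 3 * ε₁ * ε₂), ((1, 2), -3 * ε₂ * ε₅)] ∧
  ConstantsAre C (-b) ((3 : ℕ) • a + (2 : ℕ) • b) [((1, 1), ε₄)] ∧
  ConstantsAre C (a + b) a [((1, 1), -2 * ε₂), ((2, 1), 3 * ε₂ * ε₅), ((1, 2), 3 * ε₂ * ε₃)] ∧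
  ConstantsAre C ((2 : ℕ) • a + b) a [((1, 1), -3 * ε₃)] ∧
  ConstantsAre C ((2 : ℕ) • a + b) (a + b) [((1, 1), 3 * ε₅)] ∧
  ConstantsAre C ((3 : ℕ) • a + b) b [((1, 1), -ε₄)] ∧
  ConstantsAre C ((3 : ℕ) • a + (2 : ℕ) • b) (-b) [((1, 1), -ε₄)]

/-- The commutator formulas for two positive roots. -/
def PositiveFormulas {V K G : Type*} [AddCommGroup V] [CommRing K] [Group G] (x : V → K → G)
    (a b : V) (ε₁ ε₂ ε₃ ε₄ ε₅ : K) (t u : K) : Prop :=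
  comm (x b u) (x a t) =
      x (a + b) (-ε₁ * t * u) * x ((2 : ℕ) • a + b) (ε₁ * ε₂ * t ^ 2 * u) *
        x ((3 : ℕ) • a + b) (-ε₁ * ε₂ * ε₃ * t ^ 3 * u) * x ((3 : ℕ) • a + (2 : ℕ) • b) (-ε₂ * ε₅ * t ^ 3 * u ^ 2) ∧
  comm (x a u) (x b t) =
      x (a + b) (ε₁ * t * u) * x ((2 : ℕ) • a + b) (-ε₁ * ε₂ * t * u ^ 2) *
        x ((3 : ℕ) • a + b) (ε₁ * ε₂ * ε₃ * t * u ^ 3) *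
        x ((3 : ℕ) • a + (2 : ℕ) • b) (-2 * ε₂ * ε₅ * t ^ 2 * u ^ 3) ∧
  comm (x (a + b) u) (x a t) =
      x ((2 : ℕ) • a + b) (-2 * ε₂ * t * u) * x ((3 : ℕ) • a + b) (3 * ε₂ * ε₃ * t ^ 2 * u) *
        x ((3 : ℕ) • a + (2 : ℕ) • b) (-3 * ε₂ * ε₅ * t * u ^ 2) ∧
  comm (x ((2 : ℕ) • a + b) u) (x a t) = x ((3 : ℕ) • a + b) (-3 * ε₃ * t * u) ∧
  comm (x ((3 : ℕ) • a + b) u) (x b t) = x ((3 : ℕ) • a + (2 : ℕ) • b) (-ε₄ * t * u) ∧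
  comm (x ((2 : ℕ) • a + b) u) (x (a + b) t) = x ((3 : ℕ) • a + (2 : ℕ) • b) (3 * ε₅ * t * u)

/-- The commutator formulas for two negative roots. -/
def NegativeFormulas {V K G : Type*} [AddCommGroup V] [CommRing K] [Group G] (x : V → K → G)
    (a b : V) (ε₁ ε₂ ε₃ ε₄ ε₅ : K) (t u : K) : Prop :=
  comm (x (-b) u) (x (-a) t) =
      x (-a - b) (ε₁ * t * u) * x (-((2 : ℕ) • a) - b) (ε₁ * ε₂ * t ^ 2 * u) *
        x (-((3 : ℕ) • a) - b) (ε₁ * ε₂ * ε₃ * t ^ 3 * u) *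
        x (-((3 : ℕ) • a) - (2 : ℕ) • b) (-ε₂ * ε₅ * t ^ 3 * u ^ 2) ∧
  comm (x (-a) u) (x (-b) t) =
      x (-a - b) (-ε₁ * t * u) * x (-((2 : ℕ) • a) - b) (-ε₁ * ε₂ * t * u ^ 2) *
        x (-((3 : ℕ) • a) - b) (-ε₁ * ε₂ * ε₃ * t * u ^ 3) *
        x (-((3 : ℕ) • a) - (2 : ℕ) • b) (-2 * ε₂ * ε₅ * t ^ 2 * u ^ 3) ∧
  comm (x (-a - b) u) (x (-a) t) =
      x (-((2 : ℕ) • a) - b) (2 * ε₂ * t * u) * x (-((3 : ℕ) • a) - b) (3 * ε₂ * ε₃ * t ^ 2 * u) *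
        x (-((3 : ℕ) • a) - (2 : ℕ) • b) (-3 * ε₂ * ε₅ * t * u ^ 2) ∧
  comm (x (-((2 : ℕ) • a) - b) u) (x (-a) t) = x (-((3 : ℕ) • a) - b) (3 * ε₃ * t * u) ∧
  comm (x (-((3 : ℕ) • a) - b) u) (x (-b) t) = x (-((3 : ℕ) • a) - (2 : ℕ) • b) (ε₄ * t * u) ∧
  comm (x (-((2 : ℕ) • a) - b) u) (x (-a - b) t) = x (-((3 : ℕ) • a) - (2 : ℕ) • b) (-3 * ε₅ * t * u)

/-- Commutator formulas for a positive and a negative root, first part. -/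
def MixedFormulasI {V K G : Type*} [AddCommGroup V] [CommRing K] [Group G] (x : V → K → G)
    (a b : V) (ε₁ ε₂ ε₃ ε₄ ε₅ : K) (t u : K) : Prop :=
  comm (x (-a - b) u) (x a t) = x (-b) (3 * ε₁ * t * u) ∧
  comm (x (-((2 : ℕ) • a) - b) u) (x a t) =
      x (-a - b) (2 * ε₂ * t * u) * x (-b) (3 * ε₁ * ε₂ * t ^ 2 * u) *
        x (-((3 : ℕ) • a) - (2 : ℕ) • b) (3 * ε₂ * ε₅ * t * u ^ 2) ∧
  comm (x (-((3 : ℕ) • a) - b) u) (x a t) =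
      x (-((2 : ℕ) • a) - b) (ε₃ * t * u) * x (-a - b) (ε₂ * ε₃ * t ^ 2 * u) *
        x (-b) (ε₁ * ε₂ * ε₃ * t ^ 3 * u) * x (-((3 : ℕ) • a) - (2 : ℕ) • b) (ε₂ * ε₅ * t ^ 3 * u ^ 2) ∧
  comm (x a u) (x (-((3 : ℕ) • a) - b) t) =
      x (-((2 : ℕ) • a) - b) (-ε₃ * t * u) * x (-a - b) (-ε₂ * ε₃ * t * u ^ 2) *
        x (-b) (-ε₁ * ε₂ * ε₃ * t * u ^ 3) * x (-((3 : ℕ) • a) - (2 : ℕ) • b) (2 * ε₂ * ε₅ * t ^ 2 * u ^ 3) ∧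
  comm (x b u) (x (-a - b) t) =
      x (-a) (ε₁ * t * u) * x (-((2 : ℕ) • a) - b) (-ε₁ * ε₂ * t ^ 2 * u) *
        x (-((3 : ℕ) • a) - (2 : ℕ) • b) (ε₁ * ε₂ * ε₅ * t ^ 3 * u) *
        x (-((3 : ℕ) • a) - b) (-ε₂ * ε₃ * t ^ 3 * u ^ 2) ∧
  comm (x (-a - b) u) (x b t) =
      x (-a) (-ε₁ * t * u) * x (-((2 : ℕ) • a) - b) (ε₁ * ε₂ * t * u ^ 2) *
        x (-((3 : ℕ) • a) - (2 : ℕ) • b) (-ε₁ * ε₂ * ε₅ * t * u ^ 3) *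
        x (-((3 : ℕ) • a) - b) (-2 * ε₂ * ε₃ * t ^ 2 * u ^ 3) ∧
  comm (x (-((3 : ℕ) • a) - (2 : ℕ) • b) u) (x b t) = x (-((3 : ℕ) • a) - b) (ε₄ * t * u) ∧
  comm (x (-a) u) (x (a + b) t) = x b (3 * ε₁ * t * u) ∧
  comm (x (-b) u) (x (a + b) t) =
      x a (-ε₁ * t * u) * x ((2 : ℕ) • a + b) (-ε₁ * ε₂ * t ^ 2 * u) *
        x ((3 : ℕ) • a + (2 : ℕ) • b) (-ε₁ * ε₂ * ε₅ * t ^ 3 * u) * x ((3 : ℕ) • a + b) (-ε₂ * ε₃ * t ^ 3 * u ^ 2) ∧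
  comm (x (a + b) u) (x (-b) t) =
      x a (ε₁ * t * u) * x ((2 : ℕ) • a + b) (ε₁ * ε₂ * t * u ^ 2) *
        x ((3 : ℕ) • a + (2 : ℕ) • b) (ε₁ * ε₂ * ε₅ * t * u ^ 3) *
        x ((3 : ℕ) • a + b) (-2 * ε₂ * ε₃ * t ^ 2 * u ^ 3)

/-- Commutator formulas for a positive and a negative root, second part. -/
def MixedFormulasII {V K G : Type*} [AddCommGroup V] [CommRing K] [Group G] (x : V → K → G)
    (a b : V) (ε₁ ε₂ ε₃ ε₄ ε₅ : K) (t u : K) : Prop :=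
  comm (x (-((2 : ℕ) • a) - b) u) (x (a + b) t) =
      x (-a) (-2 * ε₂ * t * u) * x b (-3 * ε₁ * ε₂ * t ^ 2 * u) *
        x (-((3 : ℕ) • a) - b) (3 * ε₂ * ε₃ * t * u ^ 2) ∧
  comm (x (-((3 : ℕ) • a) - (2 : ℕ) • b) u) (x (a + b) t) =
      x (-((2 : ℕ) • a) - b) (-ε₅ * t * u) * x (-a) (ε₂ * ε₅ * t ^ 2 * u) *
        x b (ε₁ * ε₂ * ε₅ * t ^ 3 * u) * x (-((3 : ℕ) • a) - b) (ε₂ * ε₃ * t ^ 3 * u ^ 2) ∧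
  comm (x (a + b) u) (x (-((3 : ℕ) • a) - (2 : ℕ) • b) t) =
      x (-((2 : ℕ) • a) - b) (ε₅ * t * u) * x (-a) (-ε₂ * ε₅ * t * u ^ 2) *
        x b (-ε₁ * ε₂ * ε₅ * t * u ^ 3) * x (-((3 : ℕ) • a) - b) (2 * ε₂ * ε₃ * t ^ 2 * u ^ 3) ∧
  comm (x (-a) u) (x ((2 : ℕ) • a + b) t) =
      x (a + b) (2 * ε₂ * t * u) * x ((3 : ℕ) • a + (2 : ℕ) • b) (-3 * ε₂ * ε₅ * t ^ 2 * u) *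
        x b (-3 * ε₁ * ε₂ * t * u ^ 2) ∧
  comm (x (-a - b) u) (x ((2 : ℕ) • a + b) t) =
      x a (-2 * ε₂ * t * u) * x ((3 : ℕ) • a + b) (-3 * ε₂ * ε₃ * t ^ 2 * u) *
        x (-b) (3 * ε₁ * ε₂ * t * u ^ 2) ∧
  comm (x (-((3 : ℕ) • a) - b) u) (x ((2 : ℕ) • a + b) t) =
      x (-a) (-ε₃ * t * u) * x (a + b) (-ε₂ * ε₃ * t ^ 2 * u) *
        x ((3 : ℕ) • a + (2 : ℕ) • b) (ε₂ * ε₃ * ε₅ * t ^ 3 * u) * x b (-ε₁ * ε₂ * t ^ 3 * u ^ 2) ∧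
  comm (x ((2 : ℕ) • a + b) u) (x (-((3 : ℕ) • a) - b) t) =
      x (-a) (ε₃ * t * u) * x (a + b) (ε₂ * ε₃ * t * u ^ 2) *
        x ((3 : ℕ) • a + (2 : ℕ) • b) (-ε₂ * ε₃ * ε₅ * t * u ^ 3) * x b (-2 * ε₁ * ε₂ * t ^ 2 * u ^ 3) ∧
  comm (x (-((3 : ℕ) • a) - (2 : ℕ) • b) u) (x ((2 : ℕ) • a + b) t) =
      x (-a - b) (ε₅ * t * u) * x a (-ε₂ * ε₅ * t ^ 2 * u) *
        x ((3 : ℕ) • a + b) (-ε₂ * ε₃ * ε₅ * t ^ 3 * u) * x (-b) (ε₁ * ε₂ * t ^ 3 * u ^ 2) ∧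
  comm (x ((2 : ℕ) • a + b) u) (x (-((3 : ℕ) • a) - (2 : ℕ) • b) t) =
      x (-a - b) (-ε₅ * t * u) * x a (ε₂ * ε₅ * t * u ^ 2) *
        x ((3 : ℕ) • a + b) (ε₂ * ε₃ * ε₅ * t * u ^ 3) * x (-b) (2 * ε₁ * ε₂ * t ^ 2 * u ^ 3)

/-- Commutator formulas for a positive and a negative root, third part. -/
def MixedFormulasIII {V K G : Type*} [AddCommGroup V] [CommRing K] [Group G] (x : V → K → G)
    (a b : V) (ε₁ ε₂ ε₃ ε₄ ε₅ : K) (t u : K) : Prop :=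
  comm (x (-a) u) (x ((3 : ℕ) • a + b) t) =
      x ((2 : ℕ) • a + b) (ε₃ * t * u) * x (a + b) (-ε₂ * ε₃ * t * u ^ 2) *
        x b (ε₁ * ε₂ * ε₃ * t * u ^ 3) * x ((3 : ℕ) • a + (2 : ℕ) • b) (2 * ε₂ * ε₅ * t ^ 2 * u ^ 3) ∧
  comm (x ((3 : ℕ) • a + b) u) (x (-a) t) =
      x ((2 : ℕ) • a + b) (-ε₃ * t * u) * x (a + b) (ε₂ * ε₃ * t ^ 2 * u) *
        x b (-ε₁ * ε₂ * ε₃ * t ^ 3 * u) * x ((3 : ℕ) • a + (2 : ℕ) • b) (ε₂ * ε₅ * t ^ 3 * u ^ 2) ∧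
  comm (x (-((2 : ℕ) • a) - b) u) (x ((3 : ℕ) • a + b) t) =
      x a (-ε₃ * t * u) * x (-a - b) (ε₂ * ε₃ * t * u ^ 2) *
        x (-((3 : ℕ) • a) - (2 : ℕ) • b) (ε₂ * ε₃ * ε₅ * t * u ^ 3) * x (-b) (-2 * ε₁ * ε₂ * t ^ 2 * u ^ 3) ∧
  comm (x ((3 : ℕ) • a + b) u) (x (-((2 : ℕ) • a) - b) t) =
      x a (ε₃ * t * u) * x (-a - b) (-ε₂ * ε₃ * t ^ 2 * u) *
        x (-((3 : ℕ) • a) - (2 : ℕ) • b) (-ε₂ * ε₃ * ε₅ * t ^ 3 * u) * x (-b) (-ε₁ * ε₂ * t ^ 3 * u ^ 2) ∧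
  comm (x (-((3 : ℕ) • a) - (2 : ℕ) • b) u) (x ((3 : ℕ) • a + b) t) = x (-b) (-ε₄ * t * u) ∧
  comm (x (-a - b) u) (x ((3 : ℕ) • a + (2 : ℕ) • b) t) =
      x ((2 : ℕ) • a + b) (-ε₅ * t * u) * x a (-ε₂ * ε₅ * t * u ^ 2) * x (-b) (ε₁ * ε₂ * ε₅ * t * u ^ 3) *
        x ((3 : ℕ) • a + b) (2 * ε₂ * ε₃ * t ^ 2 * u ^ 3) ∧
  comm (x ((3 : ℕ) • a + (2 : ℕ) • b) u) (x (-a - b) t) =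
      x ((2 : ℕ) • a + b) (ε₅ * t * u) * x a (ε₂ * ε₅ * t ^ 2 * u) * x (-b) (-ε₁ * ε₂ * ε₅ * t ^ 3 * u) *
        x ((3 : ℕ) • a + b) (ε₂ * ε₃ * t ^ 3 * u ^ 2) ∧
  comm (x (-((2 : ℕ) • a) - b) u) (x ((3 : ℕ) • a + (2 : ℕ) • b) t) =
      x (a + b) (ε₅ * t * u) * x (-a) (ε₂ * ε₅ * t * u ^ 2) *
        x (-((3 : ℕ) • a) - b) (-ε₂ * ε₃ * ε₅ * t * u ^ 3) * x b (2 * ε₁ * ε₂ * t ^ 2 * u ^ 3) ∧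
  comm (x ((3 : ℕ) • a + (2 : ℕ) • b) u) (x (-((2 : ℕ) • a) - b) t) =
      x (a + b) (-ε₅ * t * u) * x (-a) (-ε₂ * ε₅ * t ^ 2 * u) *
        x (-((3 : ℕ) • a) - b) (ε₂ * ε₃ * ε₅ * t ^ 3 * u) * x b (ε₁ * ε₂ * t ^ 3 * u ^ 2) ∧
  comm (x (-((3 : ℕ) • a) - b) u) (x ((3 : ℕ) • a + (2 : ℕ) • b) t) = x b (-ε₄ * t * u)

/-- The commutator formulas for the remaining ordered pairs of roots whose sum is a root. (Apart
from the two orders of the pair `-b`, `3a + 2b`, these pairs occur above in the other order.) -/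
def RemainingFormulas {V K G : Type*} [AddCommGroup V] [CommRing K] [Group G] (x : V → K → G)
    (a b : V) (ε₁ ε₂ ε₃ ε₄ ε₅ : K) (t u : K) : Prop :=
  comm (x b u) (x (-((3 : ℕ) • a) - (2 : ℕ) • b) t) = x (-((3 : ℕ) • a) - b) (-ε₄ * t * u) ∧
  comm (x ((3 : ℕ) • a + b) u) (x (-((3 : ℕ) • a) - (2 : ℕ) • b) t) = x (-b) (ε₄ * t * u) ∧
  comm (x (-b) u) (x (-((3 : ℕ) • a) - b) t) = x (-((3 : ℕ) • a) - (2 : ℕ) • b) (-ε₄ * t * u) ∧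
  comm (x ((3 : ℕ) • a + (2 : ℕ) • b) u) (x (-((3 : ℕ) • a) - b) t) = x b (ε₄ * t * u) ∧
  comm (x (-a - b) u) (x (-((2 : ℕ) • a) - b) t) = x (-((3 : ℕ) • a) - (2 : ℕ) • b) (3 * ε₅ * t * u) ∧
  comm (x (-a) u) (x (-((2 : ℕ) • a) - b) t) = x (-((3 : ℕ) • a) - b) (-3 * ε₃ * t * u) ∧
  comm (x a u) (x (-((2 : ℕ) • a) - b) t) =
      x (-a - b) (-2 * ε₂ * t * u) * x (-((3 : ℕ) • a) - (2 : ℕ) • b) (-3 * ε₂ * ε₅ * t ^ 2 * u) *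
        x (-b) (-3 * ε₁ * ε₂ * t * u ^ 2) ∧
  comm (x (a + b) u) (x (-((2 : ℕ) • a) - b) t) =
      x (-a) (2 * ε₂ * t * u) * x (-((3 : ℕ) • a) - b) (-3 * ε₂ * ε₃ * t ^ 2 * u) *
        x b (3 * ε₁ * ε₂ * t * u ^ 2) ∧
  comm (x (-a) u) (x (-a - b) t) =
      x (-((2 : ℕ) • a) - b) (-2 * ε₂ * t * u) * x (-((3 : ℕ) • a) - (2 : ℕ) • b) (3 * ε₂ * ε₅ * t ^ 2 * u) *
        x (-((3 : ℕ) • a) - b) (-3 * ε₂ * ε₃ * t * u ^ 2) ∧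
  comm (x a u) (x (-a - b) t) = x (-b) (-3 * ε₁ * t * u) ∧
  comm (x ((2 : ℕ) • a + b) u) (x (-a - b) t) =
      x a (2 * ε₂ * t * u) * x (-b) (-3 * ε₁ * ε₂ * t ^ 2 * u) *
        x ((3 : ℕ) • a + b) (3 * ε₂ * ε₃ * t * u ^ 2) ∧
  comm (x (a + b) u) (x (-a) t) = x b (-3 * ε₁ * t * u) ∧
  comm (x ((2 : ℕ) • a + b) u) (x (-a) t) =
      x (a + b) (-2 * ε₂ * t * u) * x b (3 * ε₁ * ε₂ * t ^ 2 * u) *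
        x ((3 : ℕ) • a + (2 : ℕ) • b) (3 * ε₂ * ε₅ * t * u ^ 2) ∧
  comm (x ((3 : ℕ) • a + (2 : ℕ) • b) u) (x (-b) t) = x ((3 : ℕ) • a + b) (-ε₄ * t * u) ∧
  comm (x a u) (x (a + b) t) =
      x ((2 : ℕ) • a + b) (2 * ε₂ * t * u) * x ((3 : ℕ) • a + (2 : ℕ) • b) (3 * ε₂ * ε₅ * t ^ 2 * u) *
        x ((3 : ℕ) • a + b) (-3 * ε₂ * ε₃ * t * u ^ 2) ∧
  comm (x a u) (x ((2 : ℕ) • a + b) t) = x ((3 : ℕ) • a + b) (3 * ε₃ * t * u) ∧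
  comm (x (a + b) u) (x ((2 : ℕ) • a + b) t) = x ((3 : ℕ) • a + (2 : ℕ) • b) (-3 * ε₅ * t * u) ∧
  comm (x b u) (x ((3 : ℕ) • a + b) t) = x ((3 : ℕ) • a + (2 : ℕ) • b) (ε₄ * t * u) ∧
  comm (x (-b) u) (x ((3 : ℕ) • a + (2 : ℕ) • b) t) = x ((3 : ℕ) • a + b) (ε₄ * t * u)

/-- The commutator formulas in type `G₂` (`a` short, `b` long) for all ordered pairs of roots whose
sum is a root. -/
def CommutatorFormulas {V K G : Type*} [AddCommGroup V] [CommRing K] [Group G] (x : V → K → G)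
    (a b : V) (ε₁ ε₂ ε₃ ε₄ ε₅ : K) (t u : K) : Prop :=
  PositiveFormulas x a b ε₁ ε₂ ε₃ ε₄ ε₅ t u ∧
  NegativeFormulas x a b ε₁ ε₂ ε₃ ε₄ ε₅ t u ∧
  MixedFormulasI x a b ε₁ ε₂ ε₃ ε₄ ε₅ t u ∧
  MixedFormulasII x a b ε₁ ε₂ ε₃ ε₄ ε₅ t u ∧
  MixedFormulasIII x a b ε₁ ε₂ ε₃ ε₄ ε₅ t u ∧
  RemainingFormulas x a b ε₁ ε₂ ε₃ ε₄ ε₅ t u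

end G2

/-! Chevalley's commutator formula is an identity between exponentials of nilpotent operators.
Conjugation gives `e^y e^x = e^x exp(e^{-x} y e^x)`, and `e^{-x} y e^x = y - f₁ + f₂ - f₃`, where
`fₙ = (ad x)ⁿ y / n!` runs along a root string. In type `G₂` the brackets between the groups of
summands to be separated are central enough for `e^{A+B} = e^A e^B e^{-[A,B]/2}` (`exp_add_of_lie`),
which splits the exponential of the sum into root elements. Only three shapes of pairs occur: equal
lengths with long sum, two short roots with short sum, and a short root with a long one
(`exp_mul_exp_of_short`, `exp_mul_exp_of_long`).

Factorials need not be invertible in `K`, so the identity is proved with indeterminate parameters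
over `End L`. The operators `(ad e_r)ⁿ / n!` preserve `L_ℤ`, so both sides have coefficients in the
subring of lattice preserving operators; the identity descends to that subring and can be
specialised to any `K` (`comm_x_eq`).

The constants come from four relations: antisymmetry, the Jacobi identity, the cyclic relation for
three roots with sum zero (`nCoord_cyclic`), and `N_{-r,-s} = -N_{r,s}` (`nCoord_neg`). One constant
thus determines twelve (`nCoord_triple`), and the 60 ordered pairs form five such families. Four of
them are given by `ε₁, ..., ε₄`; the Jacobi identity for `a, b, 2a+b` yields `N_{a+b,2a+b} = -3ε₅`
for the fifth. All root combinatorics takes place in coordinates in `ℤ × ℤ`, where it is a finite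
check. -/

namespace G2
-- Exponentials of nilpotent elements: conjugation
section Exp
open Finset
open Polynomial
open IsNilpotent hiding pow_succ

attribute [local instance] LieRing.ofAssociativeRing

variable {R : Type*} [Ring R] [Algebra ℚ R]

lemma commute_exp {a b : R} (h : Commute a b) : Commute (exp a) b :=
  Commute.sum_left _ _ _ fun _ _ => (h.pow_left _).smul_left _

/-- Left multiplication by `x` and right multiplication by `-x` commute and add up to `ad x`, so
conjugation by `exp x` is `exp (ad x)`. The scalars 2 and 3 make `fₙ` the divided term `(ad x)ⁿ y /
n!`. -/
lemma exp_mul_mul_exp_neg {x y f₁ f₂ f₃ : R} (hx : IsNilpotent x) (h₀ : ⁅x, y⁆ = f₁)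
    (h₁ : ⁅x, f₁⁆ = (2 : ℚ) • f₂) (h₂ : ⁅x, f₂⁆ = (3 : ℚ) • f₃) (h₃ : ⁅x, f₃⁆ = 0) :
    exp x * y * exp (-x) = y + f₁ + f₂ + f₃ := by
  have hl : exp (LinearMap.mulLeft ℚ x) = LinearMap.mulLeft ℚ (exp x) :=
    (map_exp hx (Algebra.lmul ℚ R)).symm
  have hpow : ∀ n : ℕ, ∀ z : R, (LinearMap.mulRight ℚ z) ^ n = LinearMap.mulRight ℚ (z ^ n) :=
    fun n z => LinearMap.pow_mulRight ℚ R z n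
  have hnl : IsNilpotent (LinearMap.mulLeft ℚ x) := by
    obtain ⟨k, hk⟩ := hx
    exact ⟨k, by rw [LinearMap.pow_mulLeft, hk, LinearMap.mulLeft_zero_eq_zero]⟩
  have hnr : IsNilpotent (LinearMap.mulRight ℚ (-x)) := by
    obtain ⟨k, hk⟩ := hx.neg
    exact ⟨k, by rw [hpow, hk, LinearMap.mulRight_zero_eq_zero]⟩
  have hr : exp (LinearMap.mulRight ℚ (-x)) = LinearMap.mulRight ℚ (exp (-x)) := by
    obtain ⟨k, hk⟩ := hx.neg
    rw [exp_eq_sum (k := k) (by rw [hpow, hk, LinearMap.mulRight_zero_eq_zero]), exp_eq_sum hk]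
    ext v
    simp [LinearMap.sum_apply, mul_sum, hpow]
  have hc : Commute (LinearMap.mulLeft ℚ x) (LinearMap.mulRight ℚ (-x)) :=
    LinearMap.commute_mulLeft_right ..
  have had : ∀ v, (LinearMap.mulLeft ℚ x + LinearMap.mulRight ℚ (-x)) v = ⁅x, v⁆ := fun v => by
    simp [Ring.lie_def, sub_eq_add_neg]
  have hn := hc.isNilpotent_add hnl hnr
  have key := exp_smul_eq_sum (a := LinearMap.mulLeft ℚ x + LinearMap.mulRight ℚ (-x))
    (m := y) (k := 4) (by
      simp only [pow_succ', pow_zero, mul_one, Module.End.smul_def, Module.End.mul_apply, had, h₀,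
        h₁, h₂, h₃, lie_smul, smul_zero]) hn
  rw [exp_add_of_commute hc hnl hnr, hl, hr] at key
  simp only [pow_succ', pow_zero, mul_one, Module.End.smul_def, Module.End.mul_apply, had, h₀,
        h₁, h₂, lie_smul, Module.End.one_apply, Finset.sum_range_succ,
        Finset.sum_range_zero, LinearMap.mulLeft_apply, LinearMap.mulRight_apply,
        ← mul_assoc] at key
  rw [key]
  simp only [Nat.factorial, smul_smul]
  norm_num

/-- Conjugation by a unit commutes with `exp`. The alternating sum is a conjugate of `y`, which is
why it is nilpotent. -/
lemma exp_neg_mul_exp_mul_exp {x y f₁ f₂ f₃ : R} (hx : IsNilpotent x)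
    (h₀ : ⁅x, y⁆ = f₁)
    (h₁ : ⁅x, f₁⁆ = (2 : ℚ) • f₂) (h₂ : ⁅x, f₂⁆ = (3 : ℚ) • f₃) (h₃ : ⁅x, f₃⁆ = 0)
    (hy : IsNilpotent y) :
    IsNilpotent (y - f₁ + f₂ - f₃) ∧
    exp y * exp x = exp x * exp (y - f₁ + f₂ - f₃) := by
  let g : Rˣ := ⟨exp (-x), exp x, exp_neg_mul_exp_self hx, exp_mul_exp_neg_self hx⟩
  have h := exp_mul_mul_exp_neg (x := -x) (y := y) (f₁ := -f₁) (f₂ := f₂) (f₃ := -f₃) hx.neg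
    (by simp [h₀]) (by simp [h₁]) (by simp [h₂]) (by simp [h₃])
  rw [neg_neg] at h
  have e : ∀ v, ConjAct.toConjAct g • v = exp (-x) * v * exp x :=
    fun v => ConjAct.units_smul_def _ _
  have h' : y - f₁ + f₂ - f₃ = ConjAct.toConjAct g • y := by rw [e, h]; abel
  rw [h']
  constructor
  · obtain ⟨k, hk⟩ := hy
    exact ⟨k, by rw [← smul_pow', hk, smul_zero]⟩
  · rw [exp_smul _ hy, e, ← mul_assoc, ← mul_assoc, exp_mul_exp_neg_self hx, one_mul]

/-! ### The Baker-Campbell-Hausdorff formula by formal differentiation -/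

lemma exp_X_pow_mul_C {a : R} {k N : ℕ} (ha : a ^ N = 0) :
    exp (X ^ k * C a : R[X]) = ∑ n ∈ range N, monomial (k * n) ((n.factorial : ℚ)⁻¹ • a ^ n) := by
  have h : ∀ n, (X ^ k * C a : R[X]) ^ n = monomial (k * n) (a ^ n) := fun n => by
    rw [(commute_X_pow _ k).mul_pow, ← pow_mul, ← C_pow, X_pow_mul_C, C_mul_X_pow_eq_monomial]
  rw [exp_eq_sum (k := N) (by rw [h, ha, map_zero])]
  simp only [h, smul_monomial]

lemma derivative_exp {a : R} (k : ℕ) (ha : IsNilpotent a) :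
    derivative (exp (X ^ (k + 1) * C a : R[X])) =
      ((k + 1 : ℕ) : R[X]) * X ^ k * C a * exp (X ^ (k + 1) * C a : R[X]) := by
  obtain ⟨N, hN⟩ := ha
  -- One superfluous vanishing term: once differentiation has removed the constant term, the range
  -- agrees with that of `h₀`.
  have h₁ := exp_X_pow_mul_C (k := k + 1) (show a ^ (N + 1) = 0 by rw [pow_succ, hN, zero_mul])
  have h₀ := exp_X_pow_mul_C (k := k + 1) hN
  generalize exp (X ^ (k + 1) * C a) = p at h₀ h₁
  conv_rhs => rw [h₀]
  rw [h₁, derivative_sum, mul_sum, sum_range_succ']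
  simp only [derivative_monomial, mul_zero, Nat.cast_zero, map_zero, add_zero]
  refine sum_congr rfl fun n _ => ?_
  have h₂ : ((k + 1 : ℕ) : R[X]) * X ^ k * C a = monomial k (((k + 1 : ℕ) : R) * a) := by
    rw [mul_assoc, X_pow_mul_C, C_mul_X_pow_eq_monomial, ← C_eq_natCast, C_mul_monomial]
  rw [h₂, monomial_mul_monomial]
  have h₃ : (k + 1) * (n + 1) - 1 = k + (k + 1) * n := by rw [mul_add]; omega
  rw [h₃]
  congr 1
  rw [Nat.factorial_succ, pow_succ', mul_assoc, mul_smul_comm, smul_mul_assoc, ← nsmul_eq_mul',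
    ← nsmul_eq_mul,
    ← Nat.cast_smul_eq_nsmul ℚ, ← Nat.cast_smul_eq_nsmul ℚ, smul_smul, smul_smul]
  congr 1
  have : (n.factorial : ℚ) ≠ 0 := by positivity
  push_cast
  field_simp

/-- The differential equation forces `G.coeff n = Tⁿ / n!`. Since `G` is a polynomial, `T` must be
nilpotent, so nilpotency of a sum `x + y` need not be known beforehand. -/
lemma exp_eq_of_derivative {T : R} {G : R[X]} (h₀ : G.coeff 0 = 1)
    (h : derivative G = C T * G) : IsNilpotent T ∧ exp T = eval 1 G := by
  have hc : ∀ n, G.coeff n = (n.factorial : ℚ)⁻¹ • T ^ n := fun n => by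
    induction n with
    | zero => simp [h₀]
    | succ n ih =>
      have := congrArg (fun p => coeff p n) h
      simp only [coeff_derivative, coeff_C_mul, ih] at this
      rw [mul_smul_comm, ← pow_succ', ← Nat.cast_succ, ← nsmul_eq_mul',
        ← Nat.cast_smul_eq_nsmul ℚ] at this
      rw [Nat.factorial_succ, Nat.cast_mul, mul_inv, mul_smul, ← this, smul_smul,
        inv_mul_cancel₀ (by positivity), one_smul]
  have hN : T ^ (G.natDegree + 1) = 0 := by
    have := hc (G.natDegree + 1)
    rw [coeff_eq_zero_of_natDegree_lt (Nat.lt_succ_self _)] at this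
    have h2 := (smul_eq_zero.1 this.symm).resolve_left (by positivity)
    exact h2
  refine ⟨⟨_, hN⟩, ?_⟩
  rw [exp_eq_sum hN, eval_eq_sum_range]
  simp [hc]

lemma coeff_zero_exp {a : R} (k : ℕ) (ha : IsNilpotent a) :
    (exp (X ^ (k + 1) * C a : R[X])).coeff 0 = 1 := by
  obtain ⟨N, hN⟩ := ha
  rw [exp_X_pow_mul_C (show a ^ (N + 1) = 0 by rw [pow_succ, hN, zero_mul]), sum_range_succ']
  simp [coeff_monomial]

lemma isNilpotent_X_pow_mul_C {R : Type*} [Ring R] {a : R} (k : ℕ) (ha : IsNilpotent a) :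
    IsNilpotent (X ^ k * C a : R[X]) :=
  (commute_X_pow _ k).isNilpotent_mul_left (ha.map (C : R →+* R[X]))

lemma commute_X_pow_mul_C {R : Type*} [Ring R] {v w : R} (k : ℕ) (h : Commute v w) :
    Commute (X ^ k * C v : R[X]) (C w) :=
  Commute.mul_left (commute_X_pow (C w) k) (h.map (C : R →+* R[X]))

lemma commute_two_mul_X_mul {R : Type*} [Ring R] {p q : R[X]} (h : Commute p q) :
    Commute p (2 * X * q) :=
  ((Commute.ofNat_right p 2).mul_right (commute_X p).symm).mul_right h

/-- As `ad x` kills `z`, conjugation by `e^{Xx}` changes `y` only to first order, into `y + 2Xz`. -/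
lemma exp_X_mul_C_mul_C {x y z : R} (hx : IsNilpotent x) (h : ⁅x, y⁆ = (2 : ℚ) • z)
    (hxz : Commute x z) :
    exp (X ^ (0 + 1) * C x : R[X]) * C y =
      (C y + 2 * X * C z) * exp (X ^ (0 + 1) * C x : R[X]) := by
  have hxy : x * y = y * x + (2 : ℚ) • z := by rw [← h, Ring.lie_def]; abel
  have hn := isNilpotent_X_pow_mul_C (0 + 1) hx
  have e₁ : ⁅(X ^ (0 + 1) * C x : R[X]), C y⁆ = 2 * X * C z := by
    have : (C ((2 : ℚ) • z) : R[X]) = 2 * C z := by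
      rw [ofNat_smul_eq_nsmul, two_nsmul, C_add, two_mul]
    rw [Ring.lie_def, zero_add, pow_one, mul_assoc, ← C_mul, hxy, ← mul_assoc, ← X_mul_C,
      mul_assoc X, ← C_mul, ← mul_sub, ← C_sub, add_sub_cancel_left, this, mul_assoc 2, X_mul_C,
      X_mul, mul_assoc]
  have e₂ : ⁅(X ^ (0 + 1) * C x : R[X]), 2 * X * C z⁆ = (2 : ℚ) • 0 := by
    rw [smul_zero, Ring.lie_def, sub_eq_zero]
    exact commute_two_mul_X_mul (commute_X_pow_mul_C _ hxz)
  have h1 := exp_mul_mul_exp_neg hn e₁ e₂ (f₃ := 0) (by simp) (by simp)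
  rw [add_zero, add_zero] at h1
  rw [← h1, mul_assoc _ _ (exp _), exp_neg_mul_exp_self hn, mul_one]

/-- The Baker-Campbell-Hausdorff formula for nilpotent elements with central commutator. -/
lemma exp_add_of_lie {x y z : R} (hx : IsNilpotent x) (hy : IsNilpotent y) (hz : IsNilpotent z)
    (h : ⁅x, y⁆ = (2 : ℚ) • z) (hxz : ⁅x, z⁆ = 0) (hyz : ⁅y, z⁆ = 0) :
    IsNilpotent (x + y) ∧ exp (x + y) = exp x * exp y * exp (-z) := by
  have hxz' : Commute x z := sub_eq_zero.1 hxz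
  have hyz' : Commute y z := sub_eq_zero.1 hyz
  let ev : R[X] →+* R := eval₂RingHom' (RingHom.id R) 1 (fun _ => Commute.one_right _)
  have hev : ∀ (k : ℕ) (a : R), IsNilpotent a → ev (exp (X ^ k * C a)) = exp a := fun k a ha => by
    rw [map_exp (isNilpotent_X_pow_mul_C _ ha) ev]
    simp [ev]
  have hpz : Commute (exp (X ^ (0 + 1) * C x : R[X])) (C z) :=
    commute_exp (commute_X_pow_mul_C _ hxz')
  have hqz : Commute (exp (X ^ (0 + 1) * C y : R[X])) (C z) :=
    commute_exp (commute_X_pow_mul_C _ hyz')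
  have hpy := exp_X_mul_C_mul_C hx h hxz'
  have hp := derivative_exp 0 hx
  have hq := derivative_exp 0 hy
  have hr := derivative_exp 1 hz.neg
  have cp := coeff_zero_exp 0 hx
  have cq := coeff_zero_exp 0 hy
  have cr := coeff_zero_exp 1 hz.neg
  rw [← hev (0 + 1) x hx, ← hev (0 + 1) y hy, ← hev (1 + 1) _ hz.neg]
  generalize exp (X ^ (0 + 1) * C x : R[X]) = p at *
  generalize exp (X ^ (0 + 1) * C y : R[X]) = q at *
  generalize exp (X ^ (1 + 1) * C (-z) : R[X]) = r at *
  -- Here `p = e^{Xx}`, `q = e^{Xy}`, `r = e^{-X²z}`. Moving `y` to the left past `p` costs `2Xz`,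
  -- which the factor `-2Xz` from the derivative of `r` cancels.
  have hG : derivative (p * q * r) = C (x + y) * (p * q * r) := by
    rw [derivative_mul, derivative_mul, hp, hq, hr]
    have e : p * q * (2 * X * C z) = 2 * X * C z * (p * q) := by
      exact (commute_two_mul_X_mul hpz).mul_left (commute_two_mul_X_mul hqz)
    have e' : p * q * (((1 + 1 : ℕ) : R[X]) * X ^ 1 * C (-z) * r) =
        -(2 * X * C z * (p * q)) * r := by
      rw [← e, C_neg]; simp only [Nat.reduceAdd, Nat.cast_ofNat, pow_one]; noncomm_ring
    have e'' : p * (((0 + 1 : ℕ) : R[X]) * X ^ 0 * C y * q) = (C y + 2 * X * C z) * p * q := by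
      rw [← hpy]; simp [mul_assoc]
    rw [e', e'', C_add]
    simp only [zero_add, Nat.cast_one, pow_zero, one_mul]
    noncomm_ring
  have h1 := exp_eq_of_derivative
    (by rw [mul_coeff_zero, mul_coeff_zero, cp, cq, cr, one_mul, one_mul]) hG
  rw [← map_mul, ← map_mul]
  exact h1

/-! ### Commutators of exponentials along the root strings of type G₂ -/

/-- The bracket `[y, -f₁ + f₂] = -2h` commutes with both of its entries, so separating `y` from the
rest costs exactly `exp h`. -/
lemma exp_mul_exp_of_short {x y f₁ f₂ h : R} (hx : IsNilpotent x) (hy : IsNilpotent y)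
    (n₁ : IsNilpotent f₁) (n₂ : IsNilpotent f₂) (nh : IsNilpotent h)
    (h₀ : ⁅x, y⁆ = f₁) (h₁ : ⁅x, f₁⁆ = (2 : ℚ) • f₂) (h₂ : ⁅x, f₂⁆ = 0)
    (k₁ : ⁅y, f₁⁆ = (2 : ℚ) • h) (k₂ : ⁅y, f₂⁆ = 0) (k₃ : ⁅y, h⁆ = 0)
    (l₂ : ⁅f₁, f₂⁆ = 0) (l₃ : ⁅f₁, h⁆ = 0) (m₃ : ⁅f₂, h⁆ = 0) :
    exp y * exp x = exp x * exp y * (exp (-f₁) * exp f₂ * exp h) := by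
  obtain ⟨-, e⟩ := exp_neg_mul_exp_mul_exp (f₃ := 0) hx h₀ h₁ (by simp [h₂]) (by simp) hy
  have hc : Commute (-f₁) f₂ := Commute.neg_left (sub_eq_zero.1 l₂)
  obtain ⟨-, e'⟩ := exp_add_of_lie (x := y) (y := -f₁ + f₂) (z := -h) hy
    (hc.isNilpotent_add n₁.neg n₂) nh.neg (by simp [k₁, k₂]) (by simp [k₃]) (by simp [l₃, m₃])
  rw [e, sub_zero, show y - f₁ + f₂ = y + (-f₁ + f₂) by abel, e',
    exp_add_of_commute hc n₁.neg n₂, neg_neg]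
  simp only [mul_assoc]

/-- In `y - f₁ + f₂ - f₃`, separating `y` contributes `-k/2` and separating `-f₁` from `f₂`
contributes `3k/2`, together `k`. In the opposite order the product is inverted, and bringing `exp
(-f₂) * exp f₁` back into order costs `3k`, so the exponent becomes `-k + 3k = 2k`. This is the
origin of the factor 2 that distinguishes `C₂₃` from `C₃₂`. -/
lemma exp_mul_exp_of_long {x y f₁ f₂ f₃ k : R} (hx : IsNilpotent x) (hy : IsNilpotent y)
    (n₁ : IsNilpotent f₁) (n₂ : IsNilpotent f₂) (n₃ : IsNilpotent f₃) (nk : IsNilpotent k)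
    (h₀ : ⁅x, y⁆ = f₁) (h₁ : ⁅x, f₁⁆ = (2 : ℚ) • f₂) (h₂ : ⁅x, f₂⁆ = (3 : ℚ) • f₃)
    (h₃ : ⁅x, f₃⁆ = 0) (k₁ : ⁅y, f₁⁆ = 0) (k₂ : ⁅y, f₂⁆ = 0) (k₃ : ⁅y, f₃⁆ = -k)
    (k₄ : ⁅y, k⁆ = 0) (l₂ : ⁅f₁, f₂⁆ = (3 : ℚ) • k) (l₃ : ⁅f₁, f₃⁆ = 0) (l₄ : ⁅f₁, k⁆ = 0)
    (m₃ : ⁅f₂, f₃⁆ = 0) (m₄ : ⁅f₂, k⁆ = 0) (o₄ : ⁅f₃, k⁆ = 0) :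
    exp y * exp x = exp x * exp y * (exp (-f₁) * exp f₂ * exp (-f₃) * exp k) ∧
    exp x * exp y = exp y * exp x * (exp f₁ * exp (-f₂) * exp f₃ * exp ((2 : ℚ) • k)) := by
  have nq : ∀ q : ℚ, IsNilpotent (q • k) := fun q => nk.smul q
  have hc : ∀ {a b : R}, ⁅a, b⁆ = 0 → Commute a b := fun h => sub_eq_zero.1 h
  obtain ⟨-, e⟩ := exp_neg_mul_exp_mul_exp hx h₀ h₁ h₂ h₃ hy
  obtain ⟨n₅, e₅⟩ := exp_add_of_lie (x := -f₁) (y := f₂) (z := (-(3 / 2) : ℚ) • k) n₁.neg n₂ (nq _)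
    (by rw [neg_lie, l₂, smul_smul]; norm_num) (by simp [l₄]) (by simp [m₄])
  have c₅ : Commute (-f₁ + f₂) (-f₃) := hc (by simp [l₃, m₃])
  obtain ⟨-, e₆⟩ := exp_add_of_lie (x := y) (y := -f₁ + f₂ + -f₃) (z := ((1 / 2) : ℚ) • k) hy
    (c₅.isNilpotent_add n₅ n₃.neg) (nq _)
    (by simp [k₁, k₂, k₃]) (by simp [k₄]) (by simp [l₄, m₄, o₄])
  have cq : ∀ q : ℚ, exp (q • k) * exp (-f₃) = exp (-f₃) * exp (q • k) := fun q =>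
    (commute_exp (commute_exp (hc (a := -f₃) (b := q • k) (by simp [o₄]))).symm).eq
  have key : exp y * exp x = exp x * exp y * (exp (-f₁) * exp f₂ * exp (-f₃) * exp k) := by
    have ek : exp k = exp ((3 / 2 : ℚ) • k) * exp (-((1 / 2 : ℚ) • k)) := by
      rw [← exp_add_of_commute _ (nq _) (nq _).neg, ← neg_smul, ← add_smul]
      · norm_num
      · exact hc (by simp)
    rw [e, show y - f₁ + f₂ - f₃ = y + (-f₁ + f₂ + -f₃) by abel, e₆,
      exp_add_of_commute c₅ n₅ n₃.neg, e₅, ek, neg_smul, neg_neg]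
    simp only [mul_assoc]
    rw [← mul_assoc (exp ((3 / 2 : ℚ) • k)), cq, mul_assoc]
  refine ⟨key, ?_⟩
  obtain ⟨-, e₇⟩ := exp_add_of_lie (x := f₁) (y := -f₂) (z := (-(3 / 2) : ℚ) • k) n₁ n₂.neg (nq _)
    (by rw [lie_neg, l₂, smul_smul]; norm_num) (by simp [l₄]) (by simp [m₄])
  have ce : ∀ {a b : R}, Commute a b → Commute (exp a) (exp b) := fun h =>
    commute_exp (commute_exp h.symm).symm
  have cA : Commute (exp (-f₃) * exp k) (exp f₁ * exp (-f₂)) := by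
    refine Commute.mul_left (Commute.mul_right ?_ ?_) (Commute.mul_right ?_ ?_) <;>
      refine ce (Commute.symm (hc ?_)) <;> simp [*]
  have ca : Commute (exp ((3 / 2 : ℚ) • k)) (exp f₁ * exp (-f₂)) := by
    refine Commute.mul_right ?_ ?_ <;> refine ce (Commute.symm (hc ?_)) <;> simp [*]
  have cf : Commute (exp k) (exp f₃) := ce (Commute.symm (hc o₄))
  have e₈ : exp k * exp ((2 : ℚ) • k) = exp ((3 / 2 : ℚ) • k) * exp ((3 / 2 : ℚ) • k) := by
    rw [← exp_add_of_commute (hc (by simp)) nk (nq _),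
      ← exp_add_of_commute (hc (by simp)) (nq _) (nq _), ← add_smul]
    nth_rewrite 1 [← one_smul ℚ k]
    rw [← add_smul]
    norm_num
  -- The inverse is verified by multiplication: the central `k + 2k` is split into two halves
  -- `3k/2`, which complete the outer factors to `exp (-f₁ + f₂)` and its inverse.
  have e₉ : exp (-f₁) * exp f₂ * exp (-f₃) * exp k *
      (exp f₁ * exp (-f₂) * exp f₃ * exp ((2 : ℚ) • k)) = 1 := by
    calc _ = exp (-f₁) * exp f₂ * ((exp (-f₃) * exp k) * (exp f₁ * exp (-f₂))) *
          (exp f₃ * exp ((2 : ℚ) • k)) := by simp only [mul_assoc]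
      _ = exp (-f₁) * exp f₂ * (exp f₁ * exp (-f₂)) * (exp (-f₃) * (exp k * exp f₃)) *
          exp ((2 : ℚ) • k) := by rw [cA.eq]; simp only [mul_assoc]
      _ = exp (-f₁) * exp f₂ * (exp f₁ * exp (-f₂)) * (exp k * exp ((2 : ℚ) • k)) := by
        rw [cf.eq, ← mul_assoc (exp (-f₃)), exp_neg_mul_exp_self n₃]; simp only [mul_assoc, one_mul]
      _ = exp (-f₁) * exp f₂ * ((exp f₁ * exp (-f₂)) * exp ((3 / 2 : ℚ) • k)) *
          exp ((3 / 2 : ℚ) • k) := by rw [e₈]; simp only [mul_assoc]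
      _ = exp (-f₁ + f₂) * exp (f₁ + -f₂) := by
        rw [← ca.eq, e₅, e₇, neg_smul, neg_neg]; simp only [mul_assoc]
      _ = 1 := by
        rw [show f₁ + -f₂ = -(-f₁ + f₂) by abel, exp_mul_exp_neg_self n₅]
  rw [key, mul_assoc (exp x * exp y), e₉, mul_one]

end Exp
end G2

namespace G2
open Module TensorProduct
namespace ChevalleyBasis
-- From operators over ℂ to operators over an arbitrary commutative ring
section Transfer
open LieAlgebra.IsKilling (rootSystem)
open Polynomial IsNilpotent

/-- Integral polynomials in two variables as (central) polynomials with coefficients in `A`. -/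
noncomputable def coeffHom (A : Type*) [Ring A] : ℤ[X][X] →+* A[X][X] :=
  mapRingHom (mapRingHom (Int.castRingHom A))

lemma commute_coeffHom {A : Type*} [Ring A] (c : ℤ[X][X]) (a : A[X][X]) :
    Commute (coeffHom A c) a := by
  have h1 : ∀ (c : ℤ[X]) (a : A[X]), Commute (mapRingHom (Int.castRingHom A) c) a := fun c a => by
    induction c using Polynomial.induction_on' with
    | add p q hp hq => rw [map_add]; exact hp.add_left hq
    | monomial n c =>
      rw [coe_mapRingHom, map_monomial, ← C_mul_X_pow_eq_monomial]
      exact Commute.mul_left (by simp) (commute_X_pow a n)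
  induction c using Polynomial.induction_on' with
  | add p q hp hq => rw [map_add]; exact hp.add_left hq
  | monomial n c =>
    rw [coeffHom, coe_mapRingHom, map_monomial, ← C_mul_X_pow_eq_monomial]
    refine Commute.mul_left ?_ (commute_X_pow a n)
    induction a using Polynomial.induction_on' with
    | add p q hp hq => exact hp.add_right hq
    | monomial m d =>
      rw [← C_mul_X_pow_eq_monomial]
      exact Commute.mul_right ((h1 c d).map Polynomial.C) (commute_X_pow _ m).symm

section Generic

attribute [local instance] LieRing.ofAssociativeRing

variable {A : Type*} [Ring A] [Algebra ℚ A]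

/-- The element `c a` of the polynomial ring over `A`, for an integral polynomial `c`. -/
noncomputable def polyMul {A : Type*} [Ring A] (c : ℤ[X][X]) (a : A) : A[X][X] :=
  coeffHom A c * Polynomial.C (Polynomial.C a)

lemma lie_polyMul {A : Type*} [Ring A] (c d : ℤ[X][X]) (a b : A) :
    ⁅polyMul c a, polyMul d b⁆ = polyMul (c * d) ⁅a, b⁆ := by
  have h := commute_coeffHom (A := A)
  rw [polyMul, polyMul, polyMul, Ring.lie_def, (h c _).symm.mul_mul_mul_comm,
    (h d _).symm.mul_mul_mul_comm, (h d _).eq, ← mul_sub, Ring.lie_def]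
  simp

lemma polyMul_zero {A : Type*} [Ring A] (c : ℤ[X][X]) : polyMul c (0 : A) = 0 := by
  simp [polyMul]

lemma polyMul_zsmul {A : Type*} [Ring A] (c : ℤ[X][X]) (n : ℤ) (a : A) :
    polyMul c (n • a) = polyMul (n * c) a := by
  have h := commute_coeffHom (A := A) c
  rw [polyMul, polyMul, map_mul, map_zsmul, map_zsmul, map_intCast, ← (h _).eq, mul_assoc,
    zsmul_eq_mul]

lemma polyMul_neg {A : Type*} [Ring A] (c : ℤ[X][X]) (a : A) :
    polyMul (-c) a = -polyMul c a := by
  refine eq_neg_of_add_eq_zero_left ?_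
  rw [polyMul, polyMul, ← add_mul, ← map_add, neg_add_cancel, map_zero, zero_mul]

lemma ofNat_smul_polyMul (n : ℕ) [n.AtLeastTwo] (c : ℤ[X][X]) (a : A) :
    (OfNat.ofNat n : ℚ) • polyMul c a = polyMul (OfNat.ofNat n * c) a := by
  rw [ofNat_smul_eq_nsmul, polyMul, polyMul, map_mul, map_ofNat, mul_assoc, nsmul_eq_mul]
  rfl

lemma isNilpotent_polyMul {A : Type*} [Ring A] (c : ℤ[X][X]) {a : A} (ha : IsNilpotent a) :
    IsNilpotent (polyMul c a) :=
  (commute_coeffHom _ _).isNilpotent_mul_left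
    ((ha.map (Polynomial.C : A →+* A[X])).map (Polynomial.C : A[X] →+* A[X][X]))

/-- The integer `m` is the coefficient accumulated by the preceding term of the string and is
already contained in `c * d`. Keeping it on both sides of `h` avoids division. -/
lemma lie_polyMul_eq {A : Type*} [Ring A] {c d f : ℤ[X][X]} {m n : ℤ} {a b v : A}
    (h : m • ⁅a, b⁆ = n • v) (hf : c * d = m * f) :
    ⁅polyMul c a, polyMul d b⁆ = polyMul (n * f) v := by
  rw [lie_polyMul, hf, ← polyMul_zsmul, h, polyMul_zsmul]

lemma lie_polyMul_eq_zero {A : Type*} [Ring A] {c d : ℤ[X][X]} {a b : A}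
    (h : ⁅a, b⁆ = 0) : ⁅polyMul c a, polyMul d b⁆ = 0 := by
  rw [lie_polyMul, h, polyMul_zero]

lemma exp_polyMul {a : A} (c : ℤ[X][X]) (ha : IsNilpotent a) :
    exp (polyMul c a) = ∑ n ∈ Finset.range (nilpotencyClass a),
      coeffHom _ c ^ n * Polynomial.C (Polynomial.C ((n.factorial : ℚ)⁻¹ • a ^ n)) := by
  have hp : ∀ n, polyMul c a ^ n =
      coeffHom _ c ^ n * Polynomial.C (Polynomial.C (a ^ n)) := fun n => by
    rw [polyMul, (commute_coeffHom _ _).mul_pow, map_pow Polynomial.C, map_pow Polynomial.C]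
  rw [exp_eq_sum (k := nilpotencyClass a) (by rw [hp, pow_nilpotencyClass ha]; simp)]
  refine Finset.sum_congr rfl fun n _ => ?_
  rw [hp, ← mul_smul_comm, smul_C, smul_C]

lemma exp_polyMul_of_short {x y f₁ f₂ h : A} {k₁ k₂ l : ℤ} (t u : ℤ[X][X]) (hx : IsNilpotent x)
    (hy : IsNilpotent y) (n₁ : IsNilpotent f₁) (n₂ : IsNilpotent f₂) (nh : IsNilpotent h)
    (h₀ : ⁅x, y⁆ = k₁ • f₁) (h₁ : k₁ • ⁅x, f₁⁆ = (2 * k₂) • f₂) (h₂ : ⁅x, f₂⁆ = 0)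
    (g₁ : k₁ • ⁅y, f₁⁆ = (2 * l) • h) (g₂ : ⁅y, f₂⁆ = 0) (g₃ : ⁅y, h⁆ = 0)
    (l₂ : ⁅f₁, f₂⁆ = 0) (l₃ : ⁅f₁, h⁆ = 0) (m₃ : ⁅f₂, h⁆ = 0) :
    exp (polyMul u y) * exp (polyMul t x) = exp (polyMul t x) * exp (polyMul u y) *
      (exp (polyMul (-(k₁ * (t * u))) f₁) * exp (polyMul (k₂ * (t ^ 2 * u)) f₂) *
        exp (polyMul (l * (t * u ^ 2)) h)) := by
  rw [polyMul_neg]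
  refine exp_mul_exp_of_short (isNilpotent_polyMul _ hx) (isNilpotent_polyMul _ hy)
    (isNilpotent_polyMul _ n₁) (isNilpotent_polyMul _ n₂) (isNilpotent_polyMul _ nh)
    (lie_polyMul_eq (m := 1) (by simpa using h₀) (by simp))
    ?_ (lie_polyMul_eq_zero h₂) ?_ (lie_polyMul_eq_zero g₂) (lie_polyMul_eq_zero g₃)
    (lie_polyMul_eq_zero l₂) (lie_polyMul_eq_zero l₃) (lie_polyMul_eq_zero m₃)
  · rw [lie_polyMul_eq (f := t ^ 2 * u) h₁ (by ring), ofNat_smul_polyMul]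
    push_cast; rw [mul_assoc]
  · rw [lie_polyMul_eq (f := t * u ^ 2) g₁ (by ring), ofNat_smul_polyMul]
    push_cast; rw [mul_assoc]

/-- The divided brackets are `k₁tu f₁`, `k₂t²u f₂`, `k₃t³u f₃`, and the central term is `l t³u² g`.
The factors 2 and 3 in `h₁` and `h₂` are the denominators of the divided powers. -/
lemma exp_polyMul_of_long {x y f₁ f₂ f₃ g : A} {k₁ k₂ k₃ l : ℤ} (t u : ℤ[X][X])
    (hx : IsNilpotent x) (hy : IsNilpotent y)
    (n₁ : IsNilpotent f₁) (n₂ : IsNilpotent f₂) (n₃ : IsNilpotent f₃) (ng : IsNilpotent g)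
    (h₀ : ⁅x, y⁆ = k₁ • f₁) (h₁ : k₁ • ⁅x, f₁⁆ = (2 * k₂) • f₂)
    (h₂ : k₂ • ⁅x, f₂⁆ = (3 * k₃) • f₃) (h₃ : ⁅x, f₃⁆ = 0)
    (g₁ : ⁅y, f₁⁆ = 0) (g₂ : ⁅y, f₂⁆ = 0) (g₃ : k₃ • ⁅y, f₃⁆ = (-l) • g) (g₄ : ⁅y, g⁆ = 0)
    (l₂ : (k₁ * k₂) • ⁅f₁, f₂⁆ = (3 * l) • g) (l₃ : ⁅f₁, f₃⁆ = 0) (l₄ : ⁅f₁, g⁆ = 0)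
    (m₃ : ⁅f₂, f₃⁆ = 0) (m₄ : ⁅f₂, g⁆ = 0) (o₄ : ⁅f₃, g⁆ = 0) :
    exp (polyMul u y) * exp (polyMul t x) = exp (polyMul t x) * exp (polyMul u y) *
      (exp (polyMul (-(k₁ * (t * u))) f₁) * exp (polyMul (k₂ * (t ^ 2 * u)) f₂) *
        exp (polyMul (-(k₃ * (t ^ 3 * u))) f₃) * exp (polyMul (l * (t ^ 3 * u ^ 2)) g)) ∧
    exp (polyMul t x) * exp (polyMul u y) = exp (polyMul u y) * exp (polyMul t x) *
      (exp (polyMul (k₁ * (t * u)) f₁) * exp (polyMul (-(k₂ * (t ^ 2 * u))) f₂) *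
        exp (polyMul (k₃ * (t ^ 3 * u)) f₃) * exp (polyMul (2 * (l * (t ^ 3 * u ^ 2))) g)) := by
  rw [polyMul_neg, polyMul_neg, polyMul_neg, ← ofNat_smul_polyMul]
  refine exp_mul_exp_of_long (isNilpotent_polyMul _ hx) (isNilpotent_polyMul _ hy)
    (isNilpotent_polyMul _ n₁) (isNilpotent_polyMul _ n₂) (isNilpotent_polyMul _ n₃)
    (isNilpotent_polyMul _ ng)
    (lie_polyMul_eq (m := 1) (by simpa using h₀) (by simp))
    ?_ ?_ (lie_polyMul_eq_zero h₃) (lie_polyMul_eq_zero g₁) (lie_polyMul_eq_zero g₂)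
    ?_ (lie_polyMul_eq_zero g₄) ?_ (lie_polyMul_eq_zero l₃) (lie_polyMul_eq_zero l₄)
    (lie_polyMul_eq_zero m₃) (lie_polyMul_eq_zero m₄) (lie_polyMul_eq_zero o₄)
  · rw [lie_polyMul_eq (f := t ^ 2 * u) h₁ (by ring), ofNat_smul_polyMul]
    push_cast; rw [mul_assoc]
  · rw [lie_polyMul_eq (f := t ^ 3 * u) h₂ (by ring), ofNat_smul_polyMul]
    push_cast; rw [mul_assoc]
  · rw [lie_polyMul_eq (f := t ^ 3 * u ^ 2) g₃ (by ring), ← polyMul_neg]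
    congr 1
    push_cast
    ring
  · rw [lie_polyMul_eq (f := t ^ 3 * u ^ 2) l₂ (by push_cast; ring), ofNat_smul_polyMul]
    push_cast; rw [mul_assoc]

lemma zsmul_lie_ad {L : Type*} [LieRing L] [LieAlgebra ℂ L] {m n : ℤ} {v w z : L}
    (h : m • ⁅v, w⁆ = n • z) :
    m • ⁅LieAlgebra.ad ℂ L v, LieAlgebra.ad ℂ L w⁆ = n • LieAlgebra.ad ℂ L z := by
  rw [← LieHom.map_lie, ← map_zsmul, h, map_zsmul]

lemma lie_ad_eq_zero {L : Type*} [LieRing L] [LieAlgebra ℂ L] {v w : L} (h : ⁅v, w⁆ = 0) :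
    ⁅LieAlgebra.ad ℂ L v, LieAlgebra.ad ℂ L w⁆ = 0 := by
  rw [← LieHom.map_lie, h, map_zero]

end Generic

variable {L : Type*} [LieRing L] [LieAlgebra ℂ L] [FiniteDimensional ℂ L]
  [LieAlgebra.IsSimple ℂ L] {H : LieSubalgebra ℂ L} [H.IsCartanSubalgebra] (B : ChevalleyBasis H)

/-- The endomorphisms of `L` that preserve the lattice `L_ℤ`. -/
def latticeEnd : Subring (Module.End ℂ L) where
  carrier := {f | ∀ v ∈ B.lattice, f v ∈ B.lattice}
  mul_mem' hf hg v hv := hf _ (hg v hv)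
  one_mem' _ hv := hv
  add_mem' hf hg v hv := add_mem (hf v hv) (hg v hv)
  zero_mem' _ _ := zero_mem _
  neg_mem' hf v hv := neg_mem (hf v hv)

/-- Restriction of a lattice preserving endomorphism to the lattice. -/
def restrictLattice : B.latticeEnd →+* Module.End ℤ B.lattice where
  toFun f := ((f : Module.End ℂ L).restrictScalars ℤ).restrict f.2
  map_one' := rfl
  map_mul' _ _ := rfl
  map_zero' := rfl
  map_add' _ _ := rfl

/-- The operator `(ad e_r)ⁿ / n!` as a lattice preserving endomorphism. -/
noncomputable def divEnd (r : Dual ℂ H) (n : ℕ) : B.latticeEnd := ⟨B.adDiv r n, B.adDiv_mem r n⟩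

lemma restrictLattice_divEnd (r : Dual ℂ H) (n : ℕ) :
    B.restrictLattice (B.divEnd r n) = B.latticeDiv r n := rfl

/-- The root element `x_r(c)` with parameter a polynomial `c` in two variables. -/
noncomputable def polyExp (r : Dual ℂ H) (c : ℤ[X][X]) : B.latticeEnd[X][X] :=
  ∑ n ∈ Finset.range (nilpotencyClass (LieAlgebra.ad ℂ L (B.e r))),
    coeffHom _ c ^ n * Polynomial.C (Polynomial.C (B.divEnd r n))

variable (K : Type*) [CommRing K]

/-- Evaluation of polynomials with coefficients in the lattice preserving endomorphisms. -/
noncomputable def evalEnd (t u : K) : B.latticeEnd[X][X] →+* Module.End K (K ⊗[ℤ] B.lattice) :=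
  eval₂RingHom' (eval₂RingHom' ((Module.End.baseChangeHom ℤ K B.lattice).toRingHom.comp
    B.restrictLattice) (algebraMap K _ t) fun _ => (Algebra.commutes _ _).symm)
    (algebraMap K _ u) fun _ => (Algebra.commutes _ _).symm

/-- Evaluation of integral polynomials in two variables. -/
noncomputable def evalCoeff {K : Type*} [CommRing K] (t u : K) : ℤ[X][X] →+* K :=
  eval₂RingHom (eval₂RingHom (Int.castRingHom K) t) u

/-- The inner of the two variables. -/
noncomputable abbrev varT : ℤ[X][X] := Polynomial.C X

lemma evalCoeff_varT {K : Type*} [CommRing K] (t u : K) : evalCoeff t u varT = t := by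
  simp [evalCoeff]

lemma evalCoeff_X {K : Type*} [CommRing K] (t u : K) : evalCoeff t u X = u := by simp [evalCoeff]

lemma evalEnd_coeffHom (t u : K) (c : ℤ[X][X]) :
    B.evalEnd K t u (coeffHom _ c) = algebraMap K _ (evalCoeff t u c) := by
  have : (B.evalEnd K t u).comp (coeffHom _) = (algebraMap K _).comp (evalCoeff t u) := by
    ext <;> simp [evalEnd, coeffHom, evalCoeff]
  exact congrArg (fun f => f c) this

lemma evalEnd_polyExp (t u : K) (r : Dual ℂ H) (c : ℤ[X][X]) :
    B.evalEnd K t u (B.polyExp r c) = B.expEnd K r (evalCoeff t u c) := by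
  rw [polyExp, expEnd, map_sum]
  refine Finset.sum_congr rfl fun n _ => ?_
  rw [map_mul, map_pow, evalEnd_coeffHom, ← map_pow, ← Algebra.smul_def]
  congr 1
  simp [evalEnd, restrictLattice_divEnd]
  rfl

/-- The endomorphism ring of `L` as an algebra over `ℚ`. -/
@[reducible]
noncomputable def ratAlgebra (L : Type*) [LieRing L] [LieAlgebra ℂ L] :
    Algebra ℚ (Module.End ℂ L) :=
  Algebra.compHom _ (algebraMap ℚ ℂ)

attribute [local instance] ratAlgebra

/-- The inclusion of polynomial rings induced by that of the coefficient rings. -/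
noncomputable def inclusionPoly : B.latticeEnd[X][X] →+* (Module.End ℂ L)[X][X] :=
  mapRingHom (mapRingHom B.latticeEnd.subtype)

/-- This is what makes the descent possible: identities between integral exponentials may be checked
over `End L`, where factorials are invertible. -/
lemma inclusionPoly_injective : Function.Injective B.inclusionPoly :=
  map_injective _ (map_injective _ Subtype.val_injective)

lemma inclusionPoly_coeffHom (c : ℤ[X][X]) :
    B.inclusionPoly (coeffHom _ c) = coeffHom (Module.End ℂ L) c := by
  have : (B.inclusionPoly).comp (coeffHom _) = coeffHom _ := by
    ext <;> simp [inclusionPoly, coeffHom]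
  exact congrArg (fun f => f c) this

lemma inclusionPoly_polyExp (r : Dual ℂ H) (c : ℤ[X][X]) :
    B.inclusionPoly (B.polyExp r c) = exp (polyMul c (LieAlgebra.ad ℂ L (B.e r))) := by
  rw [exp_polyMul c (B.isNilpotent_ad r), polyExp, map_sum]
  refine Finset.sum_congr rfl fun n _ => ?_
  rw [map_mul, map_pow, inclusionPoly_coeffHom]
  have : (n.factorial : ℚ)⁻¹ • (LieAlgebra.ad ℂ L (B.e r) ^ n) = B.adDiv r n := by
    -- `ℚ` acts through `ℂ`, so the rational inverse factorial is the complex one in `adDiv`.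
    change (algebraMap ℚ ℂ (n.factorial : ℚ)⁻¹) • (LieAlgebra.ad ℂ L (B.e r) ^ n) = _
    rw [adDiv, map_inv₀, map_natCast]
  rw [this]
  simp only [inclusionPoly, coe_mapRingHom, map_C]
  rfl

variable {K : Type*} [CommRing K]

lemma comm_eq_iff {G : Type*} [Group G] {g h p : G} : comm g h = p ↔ g * h = h * g * p := by
  rw [comm, mul_assoc, ← mul_inv_rev, inv_mul_eq_iff_eq_mul]

/-- The identity over `End L` is pulled back along the injective inclusion and then evaluated at
`(t, u)`. The polynomials `c` and `d` are left free so that both assignments of the two variables to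
the two roots are covered. -/
lemma comm_x_eq {g : B.chevalleyGroup K} {r s : Dual ℂ H} {t u t' u' : K}
    {c d : ℤ[X][X]} {P : B.latticeEnd[X][X]}
    (hc : evalCoeff t u c = t') (hd : evalCoeff t u d = u')
    (hP : ((g : LinearMap.GeneralLinearGroup K (K ⊗[ℤ] B.lattice)) :
      Module.End K (K ⊗[ℤ] B.lattice)) = B.evalEnd K t u P)
    (h : B.inclusionPoly (B.polyExp s d) * B.inclusionPoly (B.polyExp r c) =
      B.inclusionPoly (B.polyExp r c) * B.inclusionPoly (B.polyExp s d) * B.inclusionPoly P) :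
    comm (B.x s u') (B.x r t') = g := by
  rw [comm_eq_iff]
  rw [← map_mul, ← map_mul, ← map_mul] at h
  have h' := congrArg (B.evalEnd K t u) (B.inclusionPoly_injective h)
  rw [map_mul, map_mul, map_mul, evalEnd_polyExp, evalEnd_polyExp, hc, hd, ← hP] at h'
  exact Subtype.ext (Units.ext h')

attribute [local instance] LieRing.ofAssociativeRing

lemma comm_x_of_short {r s p₁ p₂ p₃ : Dual ℂ H} {k₁ k₂ l : ℤ}
    (h₀ : ⁅B.e r, B.e s⁆ = k₁ • B.e p₁) (h₁ : k₁ • ⁅B.e r, B.e p₁⁆ = (2 * k₂) • B.e p₂)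
    (h₂ : ⁅B.e r, B.e p₂⁆ = 0) (g₁ : k₁ • ⁅B.e s, B.e p₁⁆ = (2 * l) • B.e p₃)
    (g₂ : ⁅B.e s, B.e p₂⁆ = 0) (g₃ : ⁅B.e s, B.e p₃⁆ = 0) (l₂ : ⁅B.e p₁, B.e p₂⁆ = 0)
    (l₃ : ⁅B.e p₁, B.e p₃⁆ = 0) (m₃ : ⁅B.e p₂, B.e p₃⁆ = 0) (t u : K) :
    comm (B.x s u) (B.x r t) = B.x p₁ (-(k₁ * (t * u))) * B.x p₂ (k₂ * (t ^ 2 * u)) *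
      B.x p₃ (l * (t * u ^ 2)) := by
  have n := B.isNilpotent_ad
  have key := exp_polyMul_of_short (varT) X (n r) (n s) (n p₁) (n p₂) (n p₃)
    ((one_smul ℤ _).symm.trans (zsmul_lie_ad ((one_smul ℤ _).trans h₀))) (zsmul_lie_ad h₁)
    (lie_ad_eq_zero h₂) (zsmul_lie_ad g₁) (lie_ad_eq_zero g₂) (lie_ad_eq_zero g₃)
    (lie_ad_eq_zero l₂) (lie_ad_eq_zero l₃) (lie_ad_eq_zero m₃)
  refine B.comm_x_eq (t := t) (u := u) (c := varT) (d := X)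
    (P := B.polyExp p₁ (-((k₁ : ℤ[X][X]) * (varT * X))) *
      B.polyExp p₂ ((k₂ : ℤ[X][X]) * (varT ^ 2 * X)) *
      B.polyExp p₃ ((l : ℤ[X][X]) * (varT * X ^ 2)))
    (evalCoeff_varT t u) (evalCoeff_X t u) ?_ ?_
  · simp only [map_mul, evalEnd_polyExp, map_neg, map_pow, map_intCast, evalCoeff_varT,
      evalCoeff_X]
    rfl
  · simp only [inclusionPoly_polyExp, map_mul]
    exact key

lemma comm_x_of_long {r s p₁ p₂ p₃ p₄ : Dual ℂ H} {k₁ k₂ k₃ l : ℤ}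
    (h₀ : ⁅B.e r, B.e s⁆ = k₁ • B.e p₁) (h₁ : k₁ • ⁅B.e r, B.e p₁⁆ = (2 * k₂) • B.e p₂)
    (h₂ : k₂ • ⁅B.e r, B.e p₂⁆ = (3 * k₃) • B.e p₃) (h₃ : ⁅B.e r, B.e p₃⁆ = 0)
    (g₁ : ⁅B.e s, B.e p₁⁆ = 0) (g₂ : ⁅B.e s, B.e p₂⁆ = 0)
    (g₃ : k₃ • ⁅B.e s, B.e p₃⁆ = (-l) • B.e p₄) (g₄ : ⁅B.e s, B.e p₄⁆ = 0)
    (l₂ : (k₁ * k₂) • ⁅B.e p₁, B.e p₂⁆ = (3 * l) • B.e p₄) (l₃ : ⁅B.e p₁, B.e p₃⁆ = 0)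
    (l₄ : ⁅B.e p₁, B.e p₄⁆ = 0) (m₃ : ⁅B.e p₂, B.e p₃⁆ = 0) (m₄ : ⁅B.e p₂, B.e p₄⁆ = 0)
    (o₄ : ⁅B.e p₃, B.e p₄⁆ = 0) (t u : K) :
    comm (B.x s u) (B.x r t) = B.x p₁ (-(k₁ * (t * u))) * B.x p₂ (k₂ * (t ^ 2 * u)) *
      B.x p₃ (-(k₃ * (t ^ 3 * u))) * B.x p₄ (l * (t ^ 3 * u ^ 2)) ∧
    comm (B.x r t) (B.x s u) = B.x p₁ (k₁ * (t * u)) * B.x p₂ (-(k₂ * (t ^ 2 * u))) *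
      B.x p₃ (k₃ * (t ^ 3 * u)) * B.x p₄ (2 * (l * (t ^ 3 * u ^ 2))) := by
  have n := B.isNilpotent_ad
  obtain ⟨key, key'⟩ := exp_polyMul_of_long (varT) X (n r) (n s) (n p₁) (n p₂) (n p₃)
    (n p₄) ((one_smul ℤ _).symm.trans (zsmul_lie_ad ((one_smul ℤ _).trans h₀)))
    (zsmul_lie_ad h₁) (zsmul_lie_ad h₂)
    (lie_ad_eq_zero h₃) (lie_ad_eq_zero g₁) (lie_ad_eq_zero g₂) (zsmul_lie_ad g₃)
    (lie_ad_eq_zero g₄) (zsmul_lie_ad l₂) (lie_ad_eq_zero l₃) (lie_ad_eq_zero l₄)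
    (lie_ad_eq_zero m₃) (lie_ad_eq_zero m₄) (lie_ad_eq_zero o₄)
  constructor
  · refine B.comm_x_eq (t := t) (u := u) (c := varT) (d := X)
      (P := B.polyExp p₁ (-((k₁ : ℤ[X][X]) * (varT * X))) *
        B.polyExp p₂ ((k₂ : ℤ[X][X]) * (varT ^ 2 * X)) *
        B.polyExp p₃ (-((k₃ : ℤ[X][X]) * (varT ^ 3 * X))) *
        B.polyExp p₄ ((l : ℤ[X][X]) * (varT ^ 3 * X ^ 2)))
      (evalCoeff_varT t u) (evalCoeff_X t u) ?_ ?_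
    · simp only [map_mul, evalEnd_polyExp, map_neg, map_pow, map_intCast, evalCoeff_varT,
        evalCoeff_X]
      rfl
    · simp only [inclusionPoly_polyExp, map_mul]
      exact key
  -- In the opposite order the inner variable belongs to the left entry of the commutator.
  · refine B.comm_x_eq (t := t) (u := u) (c := X) (d := varT)
      (P := B.polyExp p₁ ((k₁ : ℤ[X][X]) * (varT * X)) *
        B.polyExp p₂ (-((k₂ : ℤ[X][X]) * (varT ^ 2 * X))) *
        B.polyExp p₃ ((k₃ : ℤ[X][X]) * (varT ^ 3 * X)) *
        B.polyExp p₄ (2 * ((l : ℤ[X][X]) * (varT ^ 3 * X ^ 2))))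
      (evalCoeff_X t u) (evalCoeff_varT t u) ?_ ?_
    · simp only [map_mul, evalEnd_polyExp, map_neg, map_pow, map_intCast, map_ofNat,
        evalCoeff_varT, evalCoeff_X]
      rfl
    · simp only [inclusionPoly_polyExp, map_mul]
      exact key'

end Transfer
end ChevalleyBasis
end G2

namespace G2
open Module TensorProduct
-- Roots of type G₂ in integral coordinates
section Coordinates
open LieAlgebra.IsKilling (rootSystem)

/-- The coordinates of the roots of type `G₂` in terms of fundamental roots. -/
def rootCoords : Finset (ℤ × ℤ) :=
  {(1, 0), (0, 1), (1, 1), (2, 1), (3, 1), (3, 2),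
    (-1, 0), (0, -1), (-1, -1), (-2, -1), (-3, -1), (-3, -2)}

/-- The square of the length of a vector, where the short roots have length one. -/
def normSq (p : ℤ × ℤ) : ℤ := p.1 ^ 2 - 3 * p.1 * p.2 + 3 * p.2 ^ 2

/-- Twice the scalar product of two vectors. -/
def twiceInner (p q : ℤ × ℤ) : ℤ :=
  2 * p.1 * q.1 - 3 * p.1 * q.2 - 3 * p.2 * q.1 + 6 * p.2 * q.2

/-- The vector with given coordinates with respect to `a` and `b`. -/
def ofCoords {V : Type*} [AddCommGroup V] (a b : V) : ℤ × ℤ →+ V where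
  toFun p := p.1 • a + p.2 • b
  map_zero' := by simp
  map_add' p q := by simp only [Prod.fst_add, Prod.snd_add, add_smul]; abel

lemma ofCoords_apply {V : Type*} [AddCommGroup V] (a b : V) (p : ℤ × ℤ) :
    ofCoords a b p = p.1 • a + p.2 • b := rfl

variable {L : Type*} [LieRing L] [LieAlgebra ℂ L] [FiniteDimensional ℂ L]
  [LieAlgebra.IsSimple ℂ L] {H : LieSubalgebra ℂ L} [H.IsCartanSubalgebra] {a b : Dual ℂ H}

/-- A fundamental pair distinguishes an embedded root system of type `G₂`. -/
@[reducible]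
noncomputable def embeddedG2 {i j : H.root} (h : (rootSystem H).pairing j i = -3) :
    (rootSystem H).EmbeddedG2 where
  long := j
  short := i
  pairingIn_long_short := by
    have := (rootSystem H).algebraMap_pairingIn ℤ j i
    rw [h, algebraMap_int_eq, eq_intCast] at this
    exact_mod_cast this

lemma ofCoords_injective (hab : IsFundamentalPair H a b) :
    Function.Injective (ofCoords a b) := by
  obtain ⟨i, j, rfl, rfl, h⟩ := hab
  let _ := embeddedG2 h
  have hli := RootPairing.EmbeddedG2.linearIndependent_short_long (rootSystem H)
  rw [injective_iff_map_eq_zero]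
  rintro ⟨m, n⟩ h0
  have := LinearIndependent.pair_iff.1 hli (m : ℂ) (n : ℂ) (by
    rw [ofCoords_apply, ← Int.cast_smul_eq_zsmul ℂ, ← Int.cast_smul_eq_zsmul ℂ] at h0
    exact h0)
  ext
  · exact_mod_cast this.1
  · exact_mod_cast this.2

lemma mem_roots_iff (hab : IsFundamentalPair H a b) (r : Dual ℂ H) :
    r ∈ roots H ↔ ∃ p ∈ rootCoords, ofCoords a b p = r := by
  classical
  obtain ⟨i, j, rfl, rfl, h⟩ := hab
  let _ := embeddedG2 h
  have h1 : r ∈ roots H ↔ r ∈ RootPairing.EmbeddedG2.allRoots (rootSystem H) := by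
    constructor
    · rintro ⟨k, rfl⟩
      exact RootPairing.EmbeddedG2.mem_allRoots _ k
    · intro hr
      exact RootPairing.EmbeddedG2.allRoots_subset_range_root (rootSystem H) 
        (by simpa only [List.coe_toFinset, Set.mem_ofPred_eq] using hr)
  rw [h1, RootPairing.EmbeddedG2.allRoots_eq_map_allCoeffs]
  have hc : ∀ c : Fin 2 → ℤ, Fintype.linearCombination ℤ
      ![(rootSystem H).root i, (rootSystem H).root j] c =
        ofCoords ((rootSystem H).root i) ((rootSystem H).root j) (c 0, c 1) := fun c => by
    simp only [ofCoords_apply, Fintype.linearCombination_apply, Fin.sum_univ_two,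
      Matrix.cons_val_zero, Matrix.cons_val_one]
  rw [List.mem_map]
  constructor
  · rintro ⟨c, hc', rfl⟩
    have hd : ∀ c ∈ RootPairing.EmbeddedG2.allCoeffs, (c 0, c 1) ∈ rootCoords := by decide
    exact ⟨_, hd c hc', (hc c).symm⟩
  · rintro ⟨p, hp, rfl⟩
    have hd : ∀ p ∈ rootCoords, ![p.1, p.2] ∈ RootPairing.EmbeddedG2.allCoeffs := by decide
    exact ⟨_, hd p hp, hc _⟩

/-- Turns questions about roots into finite computations in `ℤ × ℤ`. -/
lemma ofCoords_mem_roots_iff (hab : IsFundamentalPair H a b) (p : ℤ × ℤ) :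
    ofCoords a b p ∈ roots H ↔ p ∈ rootCoords := by
  rw [mem_roots_iff hab]
  constructor
  · rintro ⟨q, hq, h⟩
    rwa [← ofCoords_injective hab h]
  · exact fun h => ⟨p, h, rfl⟩

/-- The pairings `-3` and `-1` determine an invariant form up to scale: if `(a,a) = 1`, then `(a,b)
= -3/2` and `(b,b) = 3`. `normSq` and `twiceInner` are written in this normalisation, and a pairing
is `2(p,q)/(q,q)`. -/
lemma pairing_mul_normSq (hab : IsFundamentalPair H a b) {i j : H.root} {p q : ℤ × ℤ}
    (hi : (rootSystem H).root i = ofCoords a b p) (hj : (rootSystem H).root j = ofCoords a b q) :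
    (rootSystem H).pairing i j * normSq q = twiceInner p q := by
  obtain ⟨k, l, rfl, rfl, h⟩ := hab
  let _ := embeddedG2 h
  let F := ((rootSystem H).posRootForm ℚ).toInvariantForm
  have h' : (rootSystem H).pairing k l = -1 :=
    RootPairing.EmbeddedG2.pairing_short_long (rootSystem H)
  have e := F.two_mul_apply_root_root i j
  have e1 := F.two_mul_apply_root_root k l
  have e2 := F.two_mul_apply_root_root l k
  have e3 := F.symm.eq ((rootSystem H).root k) ((rootSystem H).root l)
  have e4 := F.ne_zero k
  rw [hi, hj] at e
  simp only [ofCoords_apply, map_add, LinearMap.add_apply, LinearMap.smul_apply,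
    ← Int.cast_smul_eq_zsmul ℂ, map_smul, smul_eq_mul, RingHom.id_apply] at e e3
  rw [h'] at e1
  rw [h] at e2
  have e5 : F.form ((rootSystem H).root l) ((rootSystem H).root k) =
    -3 / 2 * F.form ((rootSystem H).root k) ((rootSystem H).root k) := by linear_combination e2 / 2
  rw [e5] at e3
  have e6 : F.form ((rootSystem H).root l) ((rootSystem H).root l) =
    3 * F.form ((rootSystem H).root k) ((rootSystem H).root k) := by
      linear_combination e1 - 2 * e3
  rw [e5, e6, e3] at e
  refine mul_left_cancel₀ e4 ?_
  simp only [normSq, twiceInner]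
  push_cast
  linear_combination -e

end Coordinates
end G2

namespace G2
open Module TensorProduct
-- Relations between the structure constants
section StructureConstants

open LieAlgebra.IsKilling (rootSystem)

/-- The greatest `n` for which `q - n p` is a root. -/
def chainBot (p q : ℤ × ℤ) : ℕ :=
  if q - p ∉ rootCoords then 0 else if q - 2 • p ∉ rootCoords then 1 else
    if q - 3 • p ∉ rootCoords then 2 else 3

lemma neg_mem_rootCoords : ∀ p ∈ rootCoords, -p ∈ rootCoords := by decide

lemma normSq_pos : ∀ p ∈ rootCoords, 0 < normSq p := by decide

/-- Linear independence of two roots whose sum is a root, in the form needed to cancel the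
determinant. -/
lemma det_ne_zero : ∀ p ∈ rootCoords, ∀ q ∈ rootCoords, p + q ∈ rootCoords →
    p.1 * q.2 - p.2 * q.1 ≠ 0 := by decide +kernel

lemma zero_notMem_rootCoords : 0 ∉ rootCoords := by decide

namespace ChevalleyBasis

variable {L : Type*} [LieRing L] [LieAlgebra ℂ L] [FiniteDimensional ℂ L]
  [LieAlgebra.IsSimple ℂ L] {H : LieSubalgebra ℂ L} [H.IsCartanSubalgebra] (B : ChevalleyBasis H)
  (a b : Dual ℂ H)

/-- The root vector of the root with given coordinates. -/
def eCoord (p : ℤ × ℤ) : L := B.e (ofCoords a b p)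

/-- The structure constants of roots with given coordinates. -/
def nCoord (p q : ℤ × ℤ) : ℤ := B.N (ofCoords a b p) (ofCoords a b q)

variable {a b} (hab : IsFundamentalPair H a b)
include hab

lemma eCoord_eq_zero {p : ℤ × ℤ} (hp : p ∉ rootCoords) : B.eCoord a b p = 0 :=
  B.e_eq_zero _ (by rwa [ofCoords_mem_roots_iff hab])

lemma nCoord_eq_zero {p q : ℤ × ℤ}
    (h : ¬(p ∈ rootCoords ∧ q ∈ rootCoords ∧ p + q ∈ rootCoords)) : B.nCoord a b p q = 0 :=
  B.N_eq_zero _ _ (by rwa [← map_add, ofCoords_mem_roots_iff hab, ofCoords_mem_roots_iff hab,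
    ofCoords_mem_roots_iff hab])

/-- The extension of `e` and `N` by zero makes one formula valid for all coordinates, so that Jacobi
identities need no case distinction. Opposite roots are excluded because their bracket is a coroot.
-/
lemma lie_eCoord {p q : ℤ × ℤ} (h : p + q ≠ 0) :
    ⁅B.eCoord a b p, B.eCoord a b q⁆ = B.nCoord a b p q • B.eCoord a b (p + q) := by
  by_cases hp : p ∈ rootCoords
  swap; · simp [B.eCoord_eq_zero hab hp, B.nCoord_eq_zero hab (p := p) (q := q) (by tauto)]
  by_cases hq : q ∈ rootCoords
  swap; · simp [B.eCoord_eq_zero hab hq, B.nCoord_eq_zero hab (p := p) (q := q) (by tauto)]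
  have hp' := (ofCoords_mem_roots_iff hab p).2 hp
  have hq' := (ofCoords_mem_roots_iff hab q).2 hq
  by_cases hpq : p + q ∈ rootCoords
  · rw [eCoord, eCoord, B.lie_e_e _ hp' _ hq'
      (by rwa [← map_add, ofCoords_mem_roots_iff hab]), ← map_add]
    rfl
  · rw [B.nCoord_eq_zero hab (by tauto), zero_smul]
    refine B.lie_eq_zero hp' hq' ?_ (by rwa [← map_add, ofCoords_mem_roots_iff hab])
    rw [← map_add]
    exact fun h0 => h (ofCoords_injective hab (by rw [h0, map_zero]))

lemma exists_coroot {p : ℤ × ℤ} (hp : p ∈ rootCoords) : ∃ h : H,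
    ⁅B.eCoord a b p, B.eCoord a b (-p)⁆ = (h : L) ∧
    (∀ q ∈ rootCoords, ⁅(h : L), B.eCoord a b q⁆ = ofCoords a b q h • B.eCoord a b q) ∧
    (∀ q ∈ rootCoords, ofCoords a b q h * normSq p = twiceInner q p) := by
  obtain ⟨i, hi⟩ := (ofCoords_mem_roots_iff hab p).2 hp
  refine ⟨(rootSystem H).coroot i, ?_, fun q hq => ?_, fun q hq => ?_⟩
  · have := B.lie_e_neg i
    rw [hi] at this
    rw [← this, ← map_neg]
    rfl
  · exact LieAlgebra.IsKilling.lie_eq_smul_of_mem_rootSpace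
      (B.e_mem _ ((ofCoords_mem_roots_iff hab q).2 hq)) _
  · obtain ⟨j, hj⟩ := (ofCoords_mem_roots_iff hab q).2 hq
    rw [← pairing_mul_normSq hab hj hi, ← hj]
    rfl

/-- `[e_p, e_{-p}]` is the coroot of `p`, on which `p` takes the value 2. -/
lemma eCoord_ne_zero {p : ℤ × ℤ} (hp : p ∈ rootCoords) : B.eCoord a b p ≠ 0 := by
  intro h0
  obtain ⟨h, h₁, -, h₂⟩ := B.exists_coroot hab hp
  rw [h0, zero_lie] at h₁
  have h₃ := h₂ p hp
  have hh : h = 0 := Subtype.ext h₁.symm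
  have h₄ : ∀ p ∈ rootCoords, twiceInner p p ≠ 0 := by decide
  rw [hh, map_zero, zero_mul] at h₃
  exact h₄ p hp (by exact_mod_cast h₃.symm)

lemma zsmul_eCoord_inj {p : ℤ × ℤ} (hp : p ∈ rootCoords) {m n : ℤ}
    (h : m • B.eCoord a b p = n • B.eCoord a b p) : m = n := by
  rw [← Int.cast_smul_eq_zsmul ℂ, ← Int.cast_smul_eq_zsmul ℂ] at h
  exact_mod_cast smul_left_injective ℂ (B.eCoord_ne_zero hab hp) h

lemma nCoord_swap (p q : ℤ × ℤ) : B.nCoord a b q p = -B.nCoord a b p q := by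
  by_cases h : p ∈ rootCoords ∧ q ∈ rootCoords ∧ p + q ∈ rootCoords
  · have h0 : p + q ≠ 0 := fun h0 => zero_notMem_rootCoords (h0 ▸ h.2.2)
    have e := B.lie_eCoord hab h0
    rw [← lie_skew, B.lie_eCoord hab (by rwa [add_comm]), add_comm q p, ← neg_smul] at e
    have := B.zsmul_eCoord_inj hab h.2.2 e
    omega
  · rw [B.nCoord_eq_zero hab h, B.nCoord_eq_zero hab (by rw [add_comm]; tauto), neg_zero]

lemma nCoord_jacobi {p q w : ℤ × ℤ} (h : p + q + w ∈ rootCoords) (hpq : p + q ≠ 0)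
    (hqw : q + w ≠ 0) (hpw : p + w ≠ 0) :
    B.nCoord a b q w * B.nCoord a b p (q + w) =
      B.nCoord a b p q * B.nCoord a b (p + q) w + B.nCoord a b p w * B.nCoord a b q (p + w) := by
  have h0 : p + q + w ≠ 0 := fun h0 => zero_notMem_rootCoords (h0 ▸ h)
  have e := leibniz_lie (B.eCoord a b p) (B.eCoord a b q) (B.eCoord a b w)
  rw [B.lie_eCoord hab hqw, B.lie_eCoord hab hpq, B.lie_eCoord hab hpw, lie_zsmul, lie_zsmul,
    zsmul_lie, B.lie_eCoord hab (by rwa [← add_assoc]), B.lie_eCoord hab h0,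
    B.lie_eCoord hab (by rwa [add_left_comm, ← add_assoc]), smul_smul, smul_smul, smul_smul,
    add_left_comm q p w, ← add_assoc, ← add_smul] at e
  exact B.zsmul_eCoord_inj hab h e

lemma abs_nCoord {p q : ℤ × ℤ} (hp : p ∈ rootCoords) (hq : q ∈ rootCoords)
    (hpq : p + q ∈ rootCoords) : |B.nCoord a b p q| = chainBot p q + 1 := by
  obtain ⟨i, hi⟩ := (ofCoords_mem_roots_iff hab p).2 hp
  obtain ⟨j, hj⟩ := (ofCoords_mem_roots_iff hab q).2 hq
  have hij : (rootSystem H).root i + (rootSystem H).root j ∈ roots H := by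
    rwa [hi, hj, ← map_add, ofCoords_mem_roots_iff hab]
  have hli := (rootSystem H).linearIndependent_of_add_mem_range_root' hij
  have hc : ∀ n : ℕ, q - n • p ∈ rootCoords ↔ n ≤ (rootSystem H).chainBotCoeff i j := fun n => by
    rw [← RootPairing.root_sub_nsmul_mem_range_iff_le_chainBotCoeff hli, hi, hj, ← map_nsmul,
      ← map_sub]
    exact (ofCoords_mem_roots_iff hab _).symm
  have h := B.abs_N i j hij
  rw [hi, hj] at h
  rw [nCoord, h]
  -- Bounds the string from below, so that the four cases of `chainBot` are exhaustive.
  have h4 : ∀ p ∈ rootCoords, ∀ q ∈ rootCoords, p + q ∈ rootCoords →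
    q - 4 • p ∉ rootCoords := by decide +kernel
  have h4 := h4 p hp q hq hpq
  have h1 := hc 1
  rw [one_smul] at h1
  rw [hc] at h4
  have h2 := hc 2
  have h3 := hc 3
  congr 2
  unfold chainBot
  split_ifs <;> simp_all <;> omega

/-- The relation between the structure constants of three roots whose sum is zero. -/
lemma nCoord_cyclic {p q : ℤ × ℤ} (hp : p ∈ rootCoords) (hq : q ∈ rootCoords)
    (hpq : p + q ∈ rootCoords) :
    B.nCoord a b q (-(p + q)) * normSq (p + q) = B.nCoord a b p q * normSq p := by
  have hw := neg_mem_rootCoords _ hpq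
  have hp0 : p ≠ 0 := fun h => zero_notMem_rootCoords (h ▸ hp)
  have hq0 : q ≠ 0 := fun h => zero_notMem_rootCoords (h ▸ hq)
  have hpq0 : p + q ≠ 0 := fun h => zero_notMem_rootCoords (h ▸ hpq)
  obtain ⟨h₁, e₁, -, f₁⟩ := B.exists_coroot hab hp
  obtain ⟨h₂, e₂, -, f₂⟩ := B.exists_coroot hab hq
  obtain ⟨h₃, e₃, -, f₃⟩ := B.exists_coroot hab hw
  have q₁ : q + -(p + q) = -p := by abel
  have q₂ : -(p + q) + p = -q := by abel
  have e := lie_jacobi (B.eCoord a b p) (B.eCoord a b q) (B.eCoord a b (-(p + q)))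
  rw [B.lie_eCoord hab hpq0, B.lie_eCoord hab (by rw [q₁]; exact neg_ne_zero.2 hp0),
    B.lie_eCoord hab (by rw [q₂]; exact neg_ne_zero.2 hq0), q₁, q₂, lie_zsmul, lie_zsmul,
    lie_zsmul, e₁, e₂] at e
  rw [neg_neg] at e₃
  rw [e₃] at e
  -- The Jacobi identity becomes a linear relation between three coroots. A coroot corresponds to
  -- `2r/(r,r)`, and `p, q` are independent, so the coefficients are proportional to the squared
  -- lengths.
  have e' : B.nCoord a b q (-(p + q)) • h₁ + B.nCoord a b (-(p + q)) p • h₂ +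
      B.nCoord a b p q • h₃ = 0 := Subtype.ext (by simpa using e)
  set x := B.nCoord a b q (-(p + q))
  set y := B.nCoord a b (-(p + q)) p
  set z := B.nCoord a b p q
  have key : ∀ v ∈ rootCoords, x * twiceInner v p * normSq q * normSq (p + q) +
      y * twiceInner v q * normSq p * normSq (p + q) -
      z * twiceInner v (p + q) * normSq p * normSq q = 0 := fun v hv => by
    have e₄ := congrArg (ofCoords a b v) e'
    simp only [map_add, map_zero, ← Int.cast_smul_eq_zsmul ℂ, map_smul, smul_eq_mul] at e₄
    have g₁ := f₁ v hv
    have g₂ := f₂ v hv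
    have g₃ := f₃ v hv
    have n₁ : normSq (-(p + q)) = normSq (p + q) := by simp [normSq]; ring
    have n₂ : twiceInner v (-(p + q)) = -twiceInner v (p + q) := by simp [twiceInner]; ring
    rw [n₁, n₂] at g₃
    push_cast at g₃
    have : ((x * twiceInner v p * normSq q * normSq (p + q) +
      y * twiceInner v q * normSq p * normSq (p + q) -
      z * twiceInner v (p + q) * normSq p * normSq q : ℤ) : ℂ) = 0 := by
      push_cast
      linear_combination (-x * normSq q * normSq (p + q) : ℂ) * g₁ -
        (y * normSq p * normSq (p + q) : ℂ) * g₂ - (z * normSq p * normSq q : ℂ) * g₃ +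
        (normSq p * normSq q * normSq (p + q) : ℂ) * e₄
    exact_mod_cast this
  have k₁ := key (1, 0) (by decide)
  have k₂ := key (0, 1) (by decide)
  have hd := det_ne_zero p hp q hq hpq
  have hn := (normSq_pos q hq).ne'
  refine mul_left_cancel₀ (mul_ne_zero (mul_ne_zero hd hn) three_ne_zero) ?_
  generalize normSq q = n₂ at *
  generalize normSq p = n₁ at *
  generalize normSq (p + q) = n₃ at *
  simp only [twiceInner, Prod.fst_add, Prod.snd_add] at k₁ k₂
  -- This combination is the determinant with `q`, which eliminates `y`. The factor 3 is the
  -- determinant of the matrix of `twiceInner`.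
  linear_combination (2 * q.2 * 3 - 3 * q.1) * k₁ + (3 * q.2 - 2 * q.1) * k₂

/-- The Jacobi identity for `e_{-p}, e_p, e_q`, read as a recursion: the product on the right is the
one on the left, moved one step down the `p`-string. -/
lemma nCoord_mul_nCoord {p q : ℤ × ℤ} (hp : p ∈ rootCoords) (hq : q ∈ rootCoords)
    (h : q ≠ p) (h' : q ≠ -p) :
    B.nCoord a b p q * B.nCoord a b (-p) (p + q) * normSq p =
      B.nCoord a b p (q - p) * B.nCoord a b (-p) q * normSq p - twiceInner q p := by
  obtain ⟨h₁, e₁, f₁, g₁⟩ := B.exists_coroot hab hp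
  have hq0 : q ≠ 0 := fun h => zero_notMem_rootCoords (h ▸ hq)
  have e := leibniz_lie (B.eCoord a b (-p)) (B.eCoord a b p) (B.eCoord a b q)
  have q₁ : -p + (p + q) = q := by abel
  have q₂ : p + (-p + q) = q := by abel
  have hs : ⁅B.eCoord a b (-p), B.eCoord a b p⁆ = -(h₁ : L) := by rw [← lie_skew, e₁]
  rw [B.lie_eCoord hab (p := p) (q := q) (fun h0 => h' (eq_neg_of_add_eq_zero_right h0)),
    lie_zsmul, B.lie_eCoord hab (by rwa [q₁]), hs, neg_lie, f₁ q hq,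
    B.lie_eCoord hab (p := -p) (q := q) (fun h0 => h (eq_of_neg_add_eq_zero h0).symm), lie_zsmul,
    B.lie_eCoord hab (by rwa [q₂]), q₁, q₂, ← Int.cast_smul_eq_zsmul ℂ,
    ← Int.cast_smul_eq_zsmul ℂ, ← Int.cast_smul_eq_zsmul ℂ, ← Int.cast_smul_eq_zsmul ℂ,
    smul_smul, smul_smul, ← neg_smul, ← add_smul] at e
  have e' := smul_left_injective ℂ (B.eCoord_ne_zero hab hq) e
  have := g₁ q hq
  rw [neg_add_eq_sub p q] at e'
  have goal : ((B.nCoord a b p q * B.nCoord a b (-p) (p + q) * normSq p : ℤ) : ℂ) =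
      (B.nCoord a b p (q - p) * B.nCoord a b (-p) q * normSq p - twiceInner q p : ℤ) := by
    push_cast
    linear_combination (normSq p : ℂ) * e' - this
  exact_mod_cast goal

/-- The recursion along the `p`-string evaluates `N_{p,q} N_{-p,p+q}`, and the cyclic relation turns
the second factor into a multiple of `N_{-p,-q}`. The outcome is `N_{p,q} N_{-p,-q} = -(c+1)²` with
`c = chainBot p q`, while `N_{p,q}² = (c+1)²`. -/
lemma nCoord_neg {p q : ℤ × ℤ} (hp : p ∈ rootCoords) (hq : q ∈ rootCoords)
    (hpq : p + q ∈ rootCoords) : B.nCoord a b (-p) (-q) = -B.nCoord a b p q := by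
  have habs := B.abs_nCoord hab hp hq hpq
  -- The last clause is the relation between the position in the string and the lengths of `p`, `q`
  -- and `p + q`, checked root by root.
  have hne : ∀ p ∈ rootCoords, ∀ q ∈ rootCoords, p + q ∈ rootCoords →
      (∀ k ∈ Finset.range 4, q - k • p ≠ p ∧ q - k • p ≠ -p) ∧ q - 4 • p ∉ rootCoords ∧
      (-(chainBot p q + 1) * twiceInner q p + chainBot p q * (chainBot p q + 1) * normSq p) *
        normSq (p + q) = (chainBot p q + 1) ^ 2 * normSq p * normSq q := by decide +kernel
  obtain ⟨hk, h₄, hK⟩ := hne p hp q hq hpq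
  have cyc := B.nCoord_cyclic hab (neg_mem_rootCoords q hq) (neg_mem_rootCoords p hp)
    (by rw [← neg_add_rev]; exact neg_mem_rootCoords _ hpq)
  have hn : normSq (-(p + q)) = normSq (p + q) ∧ normSq (-q) = normSq q := by
    simp [normSq]; ring
  rw [show -(-q + -p) = p + q by abel, show -q + -p = -(p + q) by abel, hn.1, hn.2,
    B.nCoord_swap hab (-p) (-q)] at cyc
  -- The product of constants `k` steps down the string. It vanishes below the bottom, so the
  -- recursion can be summed to give `F 0`.
  set F : ℕ → ℤ := fun k => B.nCoord a b p (q - k • p) * B.nCoord a b (-p) (p + (q - k • p))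
  have hz : ∀ k, q - k • p ∉ rootCoords → F k = 0 := fun k h => by
    simp only [F]
    rw [B.nCoord_eq_zero hab (by tauto), zero_mul]
  have hs : ∀ k ∈ Finset.range 4, q - k • p ∈ rootCoords →
      F k * normSq p = F (k + 1) * normSq p - (twiceInner q p - 2 * k * normSq p) :=
    fun k h h' => by
    have e := B.nCoord_mul_nCoord hab hp h' (hk k h).1 (hk k h).2
    simp only [F]
    rw [e, show p + (q - (k + 1) • p) = q - k • p by rw [add_smul, one_smul]; abel,
      show q - k • p - p = q - (k + 1) • p by rw [add_smul, one_smul]; abel]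
    congr 1
    simp [twiceInner, normSq]
    ring
  have hF : F 0 * normSq p =
      -(chainBot p q + 1) * twiceInner q p + chainBot p q * (chainBot p q + 1) * normSq p := by
    have s₀ := hs 0 (by simp) (by simpa using hq)
    have s₁ := hs 1 (by simp)
    have s₂ := hs 2 (by simp)
    have s₃ := hs 3 (by simp)
    have z₁ := hz 1
    have z₂ := hz 2
    have z₃ := hz 3
    have z₄ := hz 4 h₄
    simp only [one_smul, Nat.reduceAdd, zero_add] at s₀ s₁ s₂ s₃ z₁ z₂ z₃
    unfold chainBot
    split_ifs with g₁ g₂ g₃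
    · rw [s₀, s₁ g₁, s₂ g₂, s₃ g₃, z₄]; push_cast; ring
    · rw [s₀, s₁ g₁, s₂ g₂, z₃ g₃]; push_cast; ring
    · rw [s₀, s₁ g₁, z₂ g₂]; push_cast; ring
    · rw [s₀, z₁ g₁]; push_cast; ring
  simp only [F, zero_smul, sub_zero] at hF
  set n := B.nCoord a b p q
  have hn2 : n ^ 2 = (chainBot p q + 1) ^ 2 := by rw [← sq_abs, habs]
  have hn0 : n ≠ 0 := by
    intro h
    rw [h, abs_zero] at habs
    omega
  have hQp := (normSq_pos p hp).ne'
  have hQq := (normSq_pos q hq).ne'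
  refine mul_left_cancel₀ (mul_ne_zero (mul_ne_zero hn0 hQp) hQq) ?_
  rw [← hF, ← hn2] at hK
  linear_combination (n * normSq p) * cyc - hK

end ChevalleyBasis
end StructureConstants
end G2

namespace G2
open Module TensorProduct
-- Commutators of root elements for the three shapes of pairs
section RootElements

namespace ChevalleyBasis

variable {L : Type*} [LieRing L] [LieAlgebra ℂ L] [FiniteDimensional ℂ L]
  [LieAlgebra.IsSimple ℂ L] {H : LieSubalgebra ℂ L} [H.IsCartanSubalgebra] (B : ChevalleyBasis H)
  {a b : Dual ℂ H} (hab : IsFundamentalPair H a b)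

variable {K : Type*} [CommRing K]

variable (a b) in
/-- The root elements of the root with given coordinates. -/
noncomputable def xCoord (p : ℤ × ℤ) (t : K) : B.chevalleyGroup K := B.x (ofCoords a b p) t

lemma x_eq_one {r : Dual ℂ H} (hr : r ∉ roots H) (t : K) : B.x r t = 1 := by
  ext1
  ext1
  change B.expEnd K r t = 1
  rw [← B.expEnd_zero K r, expEnd, expEnd]
  refine Finset.sum_congr rfl fun n _ => ?_
  rcases eq_or_ne n 0 with rfl | h0
  · simp
  · have : B.latticeDiv r n = 0 := by
      ext v; simp [latticeDiv, adDiv, B.e_eq_zero r hr, h0]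
    simp [this]

include hab

lemma xCoord_eq_one {p : ℤ × ℤ} (hp : p ∉ rootCoords) (t : K) : B.xCoord a b p t = 1 :=
  B.x_eq_one (by rwa [ofCoords_mem_roots_iff hab]) t

/-- Zero has to be inserted because opposite root vectors do not commute. -/
lemma lie_eCoord_eq_zero {p q : ℤ × ℤ} (h : p + q ∉ insert 0 rootCoords) :
    ⁅B.eCoord a b p, B.eCoord a b q⁆ = 0 := by
  rw [Finset.mem_insert, not_or] at h
  rw [B.lie_eCoord hab h.1, B.eCoord_eq_zero hab h.2, smul_zero]

/-- The commutator formula for roots of the same length whose sum is long. -/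
lemma comm_xCoord_single {p q : ℤ × ℤ} (hp : p ∈ rootCoords) (hq : q ∈ rootCoords)
    (hpq : p + q ∈ rootCoords) (h : normSq p = normSq q) (h' : normSq (p + q) = 3) {k : ℤ}
    (hk : B.nCoord a b p q = k) (t u : K) :
    comm (B.xCoord a b q u) (B.xCoord a b p t) = B.xCoord a b (p + q) (-(k * (t * u))) := by
  have hz : ∀ p ∈ rootCoords, ∀ q ∈ rootCoords, p + q ∈ rootCoords → normSq p = normSq q →
      normSq (p + q) = 3 → p + q ≠ 0 ∧ p + (p + q) ∉ insert 0 rootCoords ∧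
      q + (p + q) ∉ insert 0 rootCoords := by decide +kernel
  obtain ⟨z₀, z₁, z₂⟩ := hz p hp q hq hpq h h'
  have e₀ : B.e (ofCoords a b 0) = 0 := B.eCoord_eq_zero hab zero_notMem_rootCoords
  -- The two factors that do not occur are placed at 0, which is not a root: there `e` vanishes and
  -- root elements are trivial.
  have := B.comm_x_of_short (r := ofCoords a b p) (s := ofCoords a b q)
    (p₁ := ofCoords a b (p + q)) (p₂ := ofCoords a b 0) (p₃ := ofCoords a b 0)
    (k₁ := k) (k₂ := 0) (l := 0) (by rw [← hk]; exact B.lie_eCoord hab z₀)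
    (by rw [show ⁅B.e _, B.e _⁆ = 0 from B.lie_eCoord_eq_zero hab z₁]; simp)
    (by rw [e₀, lie_zero])
    (by rw [show ⁅B.e _, B.e _⁆ = 0 from B.lie_eCoord_eq_zero hab z₂]; simp)
    (by rw [e₀, lie_zero]) (by rw [e₀, lie_zero]) (by rw [e₀, lie_zero]) (by rw [e₀, lie_zero])
    (by rw [e₀, lie_zero]) t u
  rw [show B.x (ofCoords a b 0) _ = 1 from B.xCoord_eq_one hab zero_notMem_rootCoords _,
    show B.x (ofCoords a b 0) _ = 1 from B.xCoord_eq_one hab zero_notMem_rootCoords _,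
    mul_one, mul_one] at this
  exact this

/-- The commutator formula for short roots whose sum is short. -/
lemma comm_xCoord_short {p q : ℤ × ℤ} (hp : p ∈ rootCoords) (hq : q ∈ rootCoords)
    (hpq : p + q ∈ rootCoords) (h : normSq p = 1) (h' : normSq q = 1) (h'' : normSq (p + q) = 1)
    {k m n : ℤ} (hk : B.nCoord a b p q = 2 * k) (hm : B.nCoord a b p (p + q) = 3 * m)
    (hn : B.nCoord a b q (p + q) = 3 * n) (t u : K) :
    comm (B.xCoord a b q u) (B.xCoord a b p t) = B.xCoord a b (p + q) (-(2 * k * (t * u))) *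
      B.xCoord a b (2 • p + q) (3 * (k * m) * (t ^ 2 * u)) *
      B.xCoord a b (p + 2 • q) (3 * (k * n) * (t * u ^ 2)) := by
  have hz : ∀ p ∈ rootCoords, ∀ q ∈ rootCoords, p + q ∈ rootCoords → normSq p = 1 →
      normSq q = 1 → normSq (p + q) = 1 → p + q ≠ 0 ∧ p + (p + q) ≠ 0 ∧ q + (p + q) ≠ 0 ∧
      p + (2 • p + q) ∉ insert 0 rootCoords ∧
      q + (2 • p + q) ∉ insert 0 rootCoords ∧
      q + (p + 2 • q) ∉ insert 0 rootCoords ∧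
      p + q + (2 • p + q) ∉ insert 0 rootCoords ∧
      p + q + (p + 2 • q) ∉ insert 0 rootCoords ∧
      2 • p + q + (p + 2 • q) ∉ insert 0 rootCoords := by decide +kernel
  obtain ⟨z₀, z₁, z₂, z₃, z₄, z₅, z₆, z₇, z₈⟩ := hz p hp q hq hpq h h' h''
  have e₁ := B.lie_eCoord hab z₁
  have e₂ := B.lie_eCoord hab z₂
  rw [hm, show p + (p + q) = 2 • p + q by rw [two_smul]; abel] at e₁
  rw [hn, show q + (p + q) = p + 2 • q by rw [two_smul]; abel] at e₂
  -- `k₂` and `l` are half the products of consecutive constants: `2k·3m = 2·(3km)` and `2k·3n =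
  -- 2·(3kn)`.
  have := B.comm_x_of_short (r := ofCoords a b p) (s := ofCoords a b q)
    (p₁ := ofCoords a b (p + q)) (p₂ := ofCoords a b (2 • p + q)) (p₃ := ofCoords a b (p + 2 • q))
    (k₁ := 2 * k) (k₂ := 3 * (k * m)) (l := 3 * (k * n))
    (by rw [← hk]; exact B.lie_eCoord hab z₀)
    (by rw [show ⁅B.e _, B.e _⁆ = _ from e₁, smul_smul]; congr 1; ring)
    (B.lie_eCoord_eq_zero hab z₃)
    (by rw [show ⁅B.e _, B.e _⁆ = _ from e₂, smul_smul]; congr 1; ring)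
    (B.lie_eCoord_eq_zero hab z₄) (B.lie_eCoord_eq_zero hab z₅) (B.lie_eCoord_eq_zero hab z₆)
    (B.lie_eCoord_eq_zero hab z₇) (B.lie_eCoord_eq_zero hab z₈) t u
  push_cast at this
  exact this

/-- The commutator formulas for a short root and a long root. -/
lemma comm_xCoord_long {p q : ℤ × ℤ} (hp : p ∈ rootCoords) (hq : q ∈ rootCoords)
    (hpq : p + q ∈ rootCoords) (h : normSq p = 1) (h' : normSq q = 3)
    {k m n l : ℤ} (hk : B.nCoord a b p q = k) (hm : B.nCoord a b p (p + q) = 2 * m)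
    (hn : B.nCoord a b p (2 • p + q) = 3 * n) (hl : B.nCoord a b (p + q) (2 • p + q) = 3 * l)
    (t u : K) :
    comm (B.xCoord a b q u) (B.xCoord a b p t) = B.xCoord a b (p + q) (-(k * (t * u))) *
      B.xCoord a b (2 • p + q) (k * m * (t ^ 2 * u)) *
      B.xCoord a b (3 • p + q) (-(k * m * n * (t ^ 3 * u))) *
      B.xCoord a b (3 • p + 2 • q) (m * l * (t ^ 3 * u ^ 2)) ∧
    comm (B.xCoord a b p t) (B.xCoord a b q u) = B.xCoord a b (p + q) (k * (t * u)) *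
      B.xCoord a b (2 • p + q) (-(k * m * (t ^ 2 * u))) *
      B.xCoord a b (3 • p + q) (k * m * n * (t ^ 3 * u)) *
      B.xCoord a b (3 • p + 2 • q) (2 * (m * l * (t ^ 3 * u ^ 2))) := by
  have hz : ∀ p ∈ rootCoords, ∀ q ∈ rootCoords, p + q ∈ rootCoords → normSq p = 1 →
      normSq q = 3 → p + q ≠ 0 ∧ p + (p + q) ≠ 0 ∧ p + (2 • p + q) ≠ 0 ∧ q + (3 • p + q) ≠ 0 ∧
      p + q + (2 • p + q) ≠ 0 ∧
      p + q + (2 • p + q) ∈ rootCoords ∧ chainBot p q = 0 ∧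
      p + (3 • p + q) ∉ insert 0 rootCoords ∧
      q + (p + q) ∉ insert 0 rootCoords ∧
      q + (2 • p + q) ∉ insert 0 rootCoords ∧
      q + (3 • p + 2 • q) ∉ insert 0 rootCoords ∧
      p + q + (3 • p + q) ∉ insert 0 rootCoords ∧
      p + q + (3 • p + 2 • q) ∉ insert 0 rootCoords ∧
      2 • p + q + (3 • p + q) ∉ insert 0 rootCoords ∧
      2 • p + q + (3 • p + 2 • q) ∉ insert 0 rootCoords ∧
      3 • p + q + (3 • p + 2 • q) ∉ insert 0 rootCoords := by
    decide +kernel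
  obtain ⟨z₀, z₁, z₂, z₃, z₄, z, hc, y₁, y₂, y₃, y₄, y₅, y₆, y₇, y₈, y₉⟩ :=
    hz p hp q hq hpq h h'
  have e₁ := B.lie_eCoord hab z₁
  have e₂ := B.lie_eCoord hab z₂
  have e₃ := B.lie_eCoord hab z₃
  have e₄ := B.lie_eCoord hab z₄
  have r₁ : p + (p + q) = 2 • p + q := by abel
  have r₂ : p + (2 • p + q) = 3 • p + q := by abel
  have r₃ : q + (3 • p + q) = 3 • p + 2 • q := by abel
  have r₄ : p + q + (2 • p + q) = 3 • p + 2 • q := by abel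
  have y₃' := y₃
  rw [Finset.mem_insert, not_or] at y₃'
  have habs := B.abs_nCoord hab hp hq hpq
  have hk2 : k ^ 2 = 1 := by rw [← hk, ← sq_abs, habs, hc]; rfl
  -- As `q + (2p + q)` is not a root, one term of the Jacobi identity drops out and `n N_{q,3p+q} =
  -- -kl`. With `k² = 1` this supplies both brackets that lead to `3p + 2q`.
  have hj := B.nCoord_jacobi hab z z₀ y₃'.1 z₂
  rw [B.nCoord_eq_zero hab (p := q) (fun h => y₃'.2 h.2.2), zero_mul, hk, hl, hn, r₂] at hj
  rw [hm, r₁] at e₁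
  rw [hn, r₂] at e₂
  rw [r₃] at e₃
  rw [hl, r₄] at e₄
  have := B.comm_x_of_long (r := ofCoords a b p) (s := ofCoords a b q)
    (p₁ := ofCoords a b (p + q)) (p₂ := ofCoords a b (2 • p + q)) (p₃ := ofCoords a b (3 • p + q))
    (p₄ := ofCoords a b (3 • p + 2 • q))
    (k₁ := k) (k₂ := k * m) (k₃ := k * m * n) (l := m * l)
    (by rw [← hk]; exact B.lie_eCoord hab z₀)
    (by rw [show ⁅B.e _, B.e _⁆ = _ from e₁, smul_smul]; congr 1; ring)
    (by rw [show ⁅B.e _, B.e _⁆ = _ from e₂, smul_smul]; congr 1; ring)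
    (B.lie_eCoord_eq_zero hab y₁) (B.lie_eCoord_eq_zero hab y₂) (B.lie_eCoord_eq_zero hab y₃)
    (by
      rw [show ⁅B.e _, B.e _⁆ = _ from e₃, smul_smul]; congr 1
      refine mul_left_cancel₀ (three_ne_zero (α := ℤ)) ?_
      linear_combination -(k * m) * hj - 3 * m * l * hk2)
    (B.lie_eCoord_eq_zero hab y₄)
    (by
      rw [show ⁅B.e _, B.e _⁆ = _ from e₄, smul_smul]; congr 1
      linear_combination 3 * m * l * hk2)
    (B.lie_eCoord_eq_zero hab y₅) (B.lie_eCoord_eq_zero hab y₆) (B.lie_eCoord_eq_zero hab y₇)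
    (B.lie_eCoord_eq_zero hab y₈) (B.lie_eCoord_eq_zero hab y₉) t u
  push_cast at this
  exact this

end ChevalleyBasis
end RootElements
end G2

namespace G2
open Module TensorProduct
-- Chevalley's commutator formula for arbitrary pairs
section Chevalley

lemma abs_det_le : ∀ p ∈ rootCoords, ∀ q ∈ rootCoords, |p.1 * q.2 - p.2 * q.1| ≤ 3 := by
  decide +kernel

/-- The determinant of `ip + jq` with `q` is `i` times that of `p` with `q`. Determinants of two
roots are at most 3 in absolute value and this one is nonzero, so `i ≤ 3`; likewise `j ≤ 3`, and
finitely many cases remain. -/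
lemma mem_orderedPairs {p q : ℤ × ℤ} (hp : p ∈ rootCoords) (hq : q ∈ rootCoords)
    (hpq : p + q ∈ rootCoords) {i j : ℕ} (hi : 0 < i) (hj : 0 < j)
    (h : i • p + j • q ∈ rootCoords) : (i, j) ∈ orderedPairs := by
  have hd := Int.one_le_abs (det_ne_zero p hp q hq hpq)
  have h₁ := abs_det_le _ h q hq
  have h₂ := abs_det_le p hp _ h
  have e₁ : (i • p + j • q).1 * q.2 - (i • p + j • q).2 * q.1 =
      i * (p.1 * q.2 - p.2 * q.1) := by simp; ring
  have e₂ : p.1 * (i • p + j • q).2 - p.2 * (i • p + j • q).1 =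
      j * (p.1 * q.2 - p.2 * q.1) := by simp; ring
  rw [e₁, abs_mul, Nat.abs_cast] at h₁
  rw [e₂, abs_mul, Nat.abs_cast] at h₂
  have hi' : i < 4 := by zify; nlinarith
  have hj' : j < 4 := by zify; nlinarith
  have key : ∀ p ∈ rootCoords, ∀ q ∈ rootCoords, p + q ∈ rootCoords → ∀ i ∈ Finset.range 4,
      ∀ j ∈ Finset.range 4, 0 < i → 0 < j → i • p + j • q ∈ rootCoords →
        (i, j) ∈ orderedPairs := by decide +kernel
  exact key p hp q hq hpq i (Finset.mem_range.2 hi') j (Finset.mem_range.2 hj') hi hj h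

/-- Root elements at non-roots are trivial, so the filter in `rootProduct` can be dropped. -/
lemma prod_map_filter {α M : Type*} [Monoid M] (P : α → Prop) [DecidablePred P] (f : α → M)
    (h : ∀ x, ¬P x → f x = 1) (l : List α) : ((l.filter P).map f).prod = (l.map f).prod := by
  induction l with
  | nil => rfl
  | cons x l ih => by_cases hx : P x <;> simp [hx, ih, h]

namespace ChevalleyBasis

variable {L : Type*} [LieRing L] [LieAlgebra ℂ L] [FiniteDimensional ℂ L]
  [LieAlgebra.IsSimple ℂ L] {H : LieSubalgebra ℂ L} [H.IsCartanSubalgebra] (B : ChevalleyBasis H)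
  {a b : Dual ℂ H}

variable (a b) in
/-- The constants of Chevalley's commutator formula for roots with given coordinates. -/
def cCoord (i j : ℕ) (p q : ℤ × ℤ) : ℚ := B.C i j (ofCoords a b p) (ofCoords a b q)

lemma M_ofCoords (p q : ℤ × ℤ) (i : ℕ) : B.M (ofCoords a b p) (ofCoords a b q) i =
    (∏ k ∈ Finset.range i, (B.nCoord a b p (k • p + q) : ℚ)) / i.factorial := by
  simp only [M, nCoord, map_add, map_nsmul]

lemma cCoord_one_one (p q : ℤ × ℤ) : B.cCoord a b 1 1 p q = B.nCoord a b p q := by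
  simp [cCoord, C, M_ofCoords]

lemma cCoord_two_one (p q : ℤ × ℤ) : B.cCoord a b 2 1 p q =
    B.nCoord a b p q * B.nCoord a b p (p + q) / 2 := by
  simp [cCoord, C, M_ofCoords, Finset.prod_range_succ, Nat.factorial]

lemma cCoord_three_one (p q : ℤ × ℤ) : B.cCoord a b 3 1 p q =
    B.nCoord a b p q * B.nCoord a b p (p + q) * B.nCoord a b p (2 • p + q) / 6 := by
  simp [cCoord, C, M_ofCoords, Finset.prod_range_succ, Nat.factorial]

lemma cCoord_one_two (p q : ℤ × ℤ) : B.cCoord a b 1 2 p q =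
    B.nCoord a b q p * B.nCoord a b q (q + p) / 2 := by
  simp [cCoord, C, M_ofCoords, Finset.prod_range_succ, Nat.factorial]

lemma cCoord_one_three (p q : ℤ × ℤ) : B.cCoord a b 1 3 p q =
    -(B.nCoord a b q p * B.nCoord a b q (q + p) * B.nCoord a b q (2 • q + p) / 6) := by
  simp [cCoord, C, M_ofCoords, Finset.prod_range_succ, Nat.factorial, pow_succ]

lemma cCoord_three_two (p q : ℤ × ℤ) : B.cCoord a b 3 2 p q =
    B.nCoord a b (p + q) p * B.nCoord a b (p + q) (p + q + p) / 6 := by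
  simp only [cCoord, C, ← map_add, M_ofCoords, Finset.prod_range_succ, Nat.factorial]
  simp
  ring

lemma cCoord_two_three (p q : ℤ × ℤ) : B.cCoord a b 2 3 p q =
    -(B.nCoord a b (q + p) q * B.nCoord a b (q + p) (q + p + q) / 3) := by
  simp only [cCoord, C, ← map_add, M_ofCoords, Finset.prod_range_succ, Nat.factorial]
  simp

variable {K : Type*} [CommRing K]

lemma rootProduct_ofCoords (c : ℕ → ℕ → ℤ) (p q : ℤ × ℤ) (t u : K) :
    rootProduct B c (ofCoords a b p) (ofCoords a b q) t u =
      (orderedPairs.map fun k =>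
        B.xCoord a b (k.1 • p + k.2 • q) ((c k.1 k.2 : K) * (-t) ^ k.1 * u ^ k.2)).prod := by
  classical
  rw [rootProduct, prod_map_filter _ _ (fun k hk => B.x_eq_one hk _)]
  simp only [xCoord, map_add, map_nsmul]

variable (hab : IsFundamentalPair H a b)
include hab

/-- Divisibility by `c + 1` is all that is kept; it makes the constants `C_{ij}` integral. -/
lemma exists_nCoord_eq {p q : ℤ × ℤ} (hp : p ∈ rootCoords) (hq : q ∈ rootCoords)
    (hpq : p + q ∈ rootCoords) {c : ℕ} (hc : chainBot p q = c) :
    ∃ k : ℤ, B.nCoord a b p q = (c + 1) * k := by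
  have h := B.abs_nCoord hab hp hq hpq
  rw [hc] at h
  rcases abs_choice (B.nCoord a b p q) with h' | h'
  · exact ⟨1, by linarith⟩
  · exact ⟨-1, by linarith⟩

/-- Chevalley's commutator formula. -/
lemma exists_comm_xCoord_eq {p q : ℤ × ℤ} (hp : p ∈ rootCoords) (hq : q ∈ rootCoords)
    (hpq : p + q ∈ rootCoords) : ∃ c : ℕ → ℕ → ℤ,
    (∀ i j : ℕ, (i, j) ∈ orderedPairs → i • p + j • q ∈ rootCoords →
      (c i j : ℚ) = B.cCoord a b i j p q) ∧
    ∀ t u : K, comm (B.xCoord a b q u) (B.xCoord a b p t) =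
      rootProduct B c (ofCoords a b p) (ofCoords a b q) t u := by
  have hl : ∀ p ∈ rootCoords, normSq p = 1 ∨ normSq p = 3 := by decide
  have hlong : ∀ p ∈ rootCoords, ∀ q ∈ rootCoords, p + q ∈ rootCoords → normSq p = 3 →
      normSq q = 3 → normSq (p + q) = 3 := by decide +kernel
  have hI : ∀ p ∈ rootCoords, ∀ q ∈ rootCoords, p + q ∈ rootCoords → normSq p = normSq q →
      normSq (p + q) = 3 → ∀ k ∈ orderedPairs, k.1 • p + k.2 • q ∈ rootCoords → k = (1, 1) := by
    decide +kernel
  have hII : ∀ p ∈ rootCoords, ∀ q ∈ rootCoords, p + q ∈ rootCoords → normSq p = 1 →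
      normSq q = 1 → normSq (p + q) = 1 →
      p + (p + q) ∈ rootCoords ∧ q + (p + q) ∈ rootCoords ∧
      chainBot p q = 1 ∧ chainBot p (p + q) = 2 ∧ chainBot q (p + q) = 2 ∧
      ∀ k ∈ orderedPairs, k.1 • p + k.2 • q ∈ rootCoords →
        k = (1, 1) ∨ k = (2, 1) ∨ k = (1, 2) := by
    decide +kernel
  have hIII : ∀ p ∈ rootCoords, ∀ q ∈ rootCoords, p + q ∈ rootCoords → normSq p = 1 →
      normSq q = 3 →
      p + (p + q) ∈ rootCoords ∧ 2 • p + q ∈ rootCoords ∧ p + (2 • p + q) ∈ rootCoords ∧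
      p + q + (2 • p + q) ∈ rootCoords ∧ chainBot p q = 0 ∧ chainBot p (p + q) = 1 ∧
      chainBot p (2 • p + q) = 2 ∧ chainBot (p + q) (2 • p + q) = 2 ∧
      (∀ k ∈ orderedPairs, k.1 • p + k.2 • q ∈ rootCoords →
        k = (1, 1) ∨ k = (2, 1) ∨ k = (3, 1) ∨ k = (3, 2)) ∧
      (∀ k ∈ orderedPairs, k.1 • q + k.2 • p ∈ rootCoords →
        k = (1, 1) ∨ k = (1, 2) ∨ k = (1, 3) ∨ k = (2, 3)) := by
    decide +kernel
  -- In each case the constants at roots turn out to be integers, so they equal their numerators.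
  refine ⟨fun i j => (B.cCoord a b i j p q).num, ?_⟩
  by_cases h : normSq p = normSq q ∧ normSq (p + q) = 3
  · have hm := hI p hp q hq hpq h.1 h.2
    have c₁ := B.cCoord_one_one (a := a) (b := b) p q
    refine ⟨fun i j hi hij => ?_, fun t u => ?_⟩
    · obtain ⟨rfl, rfl⟩ := Prod.mk.inj (hm (i, j) hi hij)
      simp only [c₁, Rat.num_intCast]
    · have hx (i j : ℕ) (hi : (i, j) ∈ orderedPairs) (hij : (i, j) ≠ (1, 1)) (v : K) :
          B.xCoord a b (i • p + j • q) v = 1 :=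
        B.xCoord_eq_one hab (fun h' => hij (hm (i, j) hi h')) v
      rw [B.rootProduct_ofCoords, B.comm_xCoord_single hab hp hq hpq h.1 h.2 rfl]
      simp only [orderedPairs, List.map_cons, List.map_nil, List.prod_cons, List.prod_nil, mul_one]
      rw [hx 2 1, hx 1 2, hx 3 1, hx 1 3, hx 3 2, hx 2 3]
      · simp [c₁, mul_assoc]
      all_goals decide
  -- What remains is two short roots with short sum, or a short and a long root in either order.
  by_cases h₁ : normSq p = 1 <;> by_cases h₂ : normSq q = 1
  · have h₃ : normSq (p + q) = 1 := by
      have := hl _ hpq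
      rw [h₁, h₂] at h
      tauto
    obtain ⟨r₁, r₂, b₀, b₁, b₂, hm⟩ := hII p hp q hq hpq h₁ h₂ h₃
    obtain ⟨k, hk⟩ : ∃ k, B.nCoord a b p q = 2 * k :=
      B.exists_nCoord_eq hab hp hq hpq b₀
    obtain ⟨m, hm'⟩ : ∃ m, B.nCoord a b p (p + q) = 3 * m :=
      B.exists_nCoord_eq hab hp hpq r₁ b₁
    obtain ⟨n, hn⟩ : ∃ n, B.nCoord a b q (p + q) = 3 * n :=
      B.exists_nCoord_eq hab hq hpq r₂ b₂
    have c₁ : B.cCoord a b 1 1 p q = (2 * k : ℤ) := by rw [cCoord_one_one, hk]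
    have c₂ : B.cCoord a b 2 1 p q = (3 * (k * m) : ℤ) := by
      rw [cCoord_two_one, hk, hm']; push_cast; ring
    have c₃ : B.cCoord a b 1 2 p q = (-(3 * (k * n)) : ℤ) := by
      rw [cCoord_one_two, add_comm q p, B.nCoord_swap hab, hk, hn]; push_cast; ring
    refine ⟨fun i j hi hij => ?_, fun t u => ?_⟩
    · rcases hm (i, j) hi hij with e | e | e <;> obtain ⟨rfl, rfl⟩ := Prod.mk.inj e
      · simp only [c₁, Rat.num_intCast]
      · simp only [c₂, Rat.num_intCast]
      · simp only [c₃, Rat.num_intCast]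
    · have hx (i j : ℕ) (hi : (i, j) ∈ orderedPairs)
          (hij : ¬((i, j) = (1, 1) ∨ (i, j) = (2, 1) ∨ (i, j) = (1, 2))) (v : K) :
          B.xCoord a b (i • p + j • q) v = 1 :=
        B.xCoord_eq_one hab (fun h' => hij (hm (i, j) hi h')) v
      rw [B.rootProduct_ofCoords, B.comm_xCoord_short hab hp hq hpq h₁ h₂ h₃ hk hm' hn]
      simp only [orderedPairs, List.map_cons, List.map_nil, List.prod_cons, List.prod_nil, mul_one]
      rw [hx 3 1, hx 1 3, hx 3 2, hx 2 3]
      · simp only [mul_one, c₁, c₂, c₃, Rat.num_intCast, one_smul, ← mul_assoc]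
        refine congrArg₂ (· * ·) (congrArg₂ (· * ·) (congrArg _ ?_) (congrArg _ ?_))
          (congrArg _ ?_) <;> push_cast <;> ring
      all_goals decide
  · have h₃ := (hl q hq).resolve_left h₂
    obtain ⟨r₁, r₂, r₃, r₄, b₀, b₁, b₂, b₃, hm, -⟩ := hIII p hp q hq hpq h₁ h₃
    obtain ⟨k, hk⟩ : ∃ k, B.nCoord a b p q = k := ⟨_, rfl⟩
    obtain ⟨m, hm'⟩ : ∃ m, B.nCoord a b p (p + q) = 2 * m :=
      B.exists_nCoord_eq hab hp hpq r₁ b₁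
    obtain ⟨n, hn⟩ : ∃ n, B.nCoord a b p (2 • p + q) = 3 * n :=
      B.exists_nCoord_eq hab hp r₂ r₃ b₂
    obtain ⟨l, hl⟩ : ∃ l, B.nCoord a b (p + q) (2 • p + q) = 3 * l :=
      B.exists_nCoord_eq hab hpq r₂ r₄ b₃
    have c₁ : B.cCoord a b 1 1 p q = (k : ℤ) := by rw [cCoord_one_one, hk]
    have c₂ : B.cCoord a b 2 1 p q = (k * m : ℤ) := by
      rw [cCoord_two_one, hk, hm']; push_cast; ring
    have c₃ : B.cCoord a b 3 1 p q = (k * m * n : ℤ) := by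
      rw [cCoord_three_one, hk, hm', hn]; push_cast; ring
    have c₄ : B.cCoord a b 3 2 p q = (-(m * l) : ℤ) := by
      rw [cCoord_three_two, B.nCoord_swap hab p (p + q), hm',
        show p + q + p = 2 • p + q by abel, hl]
      push_cast; ring
    refine ⟨fun i j hi hij => ?_, fun t u => ?_⟩
    · rcases hm (i, j) hi hij with e | e | e | e <;> obtain ⟨rfl, rfl⟩ := Prod.mk.inj e
      · simp only [c₁, Rat.num_intCast]
      · simp only [c₂, Rat.num_intCast]
      · simp only [c₃, Rat.num_intCast]
      · simp only [c₄, Rat.num_intCast]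
    · have hx (i j : ℕ) (hi : (i, j) ∈ orderedPairs)
          (hij : ¬((i, j) = (1, 1) ∨ (i, j) = (2, 1) ∨ (i, j) = (3, 1) ∨ (i, j) = (3, 2))) (v : K) :
          B.xCoord a b (i • p + j • q) v = 1 :=
        B.xCoord_eq_one hab (fun h' => hij (hm (i, j) hi h')) v
      rw [B.rootProduct_ofCoords,
        (B.comm_xCoord_long hab hp hq hpq h₁ h₃ hk hm' hn hl t u).1]
      simp only [orderedPairs, List.map_cons, List.map_nil, List.prod_cons, List.prod_nil, mul_one]
      rw [hx 1 2, hx 1 3, hx 2 3]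
      · simp only [one_mul, mul_one, c₁, c₂, c₃, c₄, Rat.num_intCast, one_smul, ← mul_assoc]
        refine congrArg₂ (· * ·) (congrArg₂ (· * ·) (congrArg₂ (· * ·) (congrArg _ ?_)
          (congrArg _ ?_)) (congrArg _ ?_)) (congrArg _ ?_) <;> push_cast <;> ring
      all_goals decide
  -- Now `p` is long: the second half of `comm_xCoord_long` applies with `p` and `q` exchanged.
  · have h₃ := (hl p hp).resolve_left h₁
    rw [add_comm] at hpq
    obtain ⟨r₁, r₂, r₃, r₄, b₀, b₁, b₂, b₃, -, hm⟩ := hIII q hq p hp hpq h₂ h₃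
    obtain ⟨k, hk⟩ : ∃ k, B.nCoord a b q p = k := ⟨_, rfl⟩
    obtain ⟨m, hm'⟩ : ∃ m, B.nCoord a b q (q + p) = 2 * m :=
      B.exists_nCoord_eq hab hq hpq r₁ b₁
    obtain ⟨n, hn⟩ : ∃ n, B.nCoord a b q (2 • q + p) = 3 * n :=
      B.exists_nCoord_eq hab hq r₂ r₃ b₂
    obtain ⟨l, hl⟩ : ∃ l, B.nCoord a b (q + p) (2 • q + p) = 3 * l :=
      B.exists_nCoord_eq hab hpq r₂ r₄ b₃
    have c₁ : B.cCoord a b 1 1 p q = (-k : ℤ) := by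
      rw [cCoord_one_one, B.nCoord_swap hab q p, hk]
    have c₂ : B.cCoord a b 1 2 p q = (k * m : ℤ) := by
      rw [cCoord_one_two, hk, hm']; push_cast; ring
    have c₃ : B.cCoord a b 1 3 p q = (-(k * m * n) : ℤ) := by
      rw [cCoord_one_three, hk, hm', hn]; push_cast; ring
    have c₄ : B.cCoord a b 2 3 p q = (2 * (m * l) : ℤ) := by
      rw [cCoord_two_three, B.nCoord_swap hab q (q + p), hm',
        show q + p + q = 2 • q + p by abel, hl]
      push_cast; ring
    refine ⟨fun i j hi hij => ?_, fun t u => ?_⟩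
    · rcases hm (i, j) hi hij with e | e | e | e <;> obtain ⟨rfl, rfl⟩ := Prod.mk.inj e
      · simp only [c₁, Rat.num_intCast]
      · simp only [c₂, Rat.num_intCast]
      · simp only [c₃, Rat.num_intCast]
      · simp only [c₄, Rat.num_intCast]
    · have hx (i j : ℕ) (hi : (i, j) ∈ orderedPairs)
          (hij : ¬((i, j) = (1, 1) ∨ (i, j) = (1, 2) ∨ (i, j) = (1, 3) ∨ (i, j) = (2, 3))) (v : K) :
          B.xCoord a b (i • p + j • q) v = 1 :=
        B.xCoord_eq_one hab (fun h' => hij (hm (i, j) hi h')) v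
      rw [B.rootProduct_ofCoords,
        (B.comm_xCoord_long hab hq hp hpq h₂ h₃ hk hm' hn hl u t).2]
      simp only [orderedPairs, List.map_cons, List.map_nil, List.prod_cons, List.prod_nil, mul_one]
      rw [hx 2 1, hx 3 1, hx 3 2]
      · simp only [one_mul, c₁, c₂, c₃, c₄, Rat.num_intCast, one_smul, add_comm q p,
          add_comm (2 • q) p, add_comm (3 • q), ← mul_assoc]
        refine congrArg₂ (· * ·) (congrArg₂ (· * ·) (congrArg₂ (· * ·) (congrArg _ ?_)
          (congrArg _ ?_)) (congrArg _ ?_)) (congrArg _ ?_) <;> push_cast <;> ring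
      all_goals decide
  -- Two long roots whose sum is a root have a long sum, which is the case treated at the start.
  · exact absurd ⟨((hl p hp).resolve_left h₁).trans ((hl q hq).resolve_left h₂).symm,
      hlong p hp q hq hpq ((hl p hp).resolve_left h₁) ((hl q hq).resolve_left h₂)⟩ h

end ChevalleyBasis
end Chevalley
end G2

namespace G2
open Module TensorProduct
-- The table of constants and the explicit formulas
section Table

namespace ChevalleyBasis

variable {L : Type*} [LieRing L] [LieAlgebra ℂ L] [FiniteDimensional ℂ L]
  [LieAlgebra.IsSimple ℂ L] {H : LieSubalgebra ℂ L} [H.IsCartanSubalgebra] (B : ChevalleyBasis H)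
  {a b : Dual ℂ H} (hab : IsFundamentalPair H a b)
include hab

/-- The twelve structure constants determined by two roots whose sum is a root. -/
lemma nCoord_triple {p q w v₁ v₂ v₃ : ℤ × ℤ} {m₀ m₁ m₂ ε : ℤ}
    (h : p ∈ rootCoords ∧ q ∈ rootCoords ∧ w ∈ rootCoords ∧ p + q = w ∧
      m₁ * normSq w = m₀ * normSq p ∧ m₂ * normSq w = m₀ * normSq q ∧
      v₁ = -p ∧ v₂ = -q ∧ v₃ = -w) (h₀ : B.nCoord a b p q = m₀ * ε) :
    B.nCoord a b p q = m₀ * ε ∧ B.nCoord a b q p = m₀ * -ε ∧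
    B.nCoord a b v₁ v₂ = m₀ * -ε ∧ B.nCoord a b v₂ v₁ = m₀ * ε ∧
    B.nCoord a b q v₃ = m₁ * ε ∧ B.nCoord a b v₃ q = m₁ * -ε ∧
    B.nCoord a b v₂ w = m₁ * -ε ∧ B.nCoord a b w v₂ = m₁ * ε ∧
    B.nCoord a b v₃ p = m₂ * ε ∧ B.nCoord a b p v₃ = m₂ * -ε ∧
    B.nCoord a b w v₁ = m₂ * -ε ∧ B.nCoord a b v₁ w = m₂ * ε := by
  obtain ⟨hp, hq, hpq, rfl, h₁, h₂, rfl, rfl, rfl⟩ := h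
  have hw := neg_mem_rootCoords _ hpq
  have hp' := neg_mem_rootCoords _ hp
  have e₁ : q + -(p + q) = -p := by abel
  have e₂ : -(p + q) + p = -q := by abel
  have hU := (normSq_pos _ hpq).ne'
  have hS := (normSq_pos _ hp).ne'
  -- `m₁` and `m₂` are `m₀` rescaled by the squared lengths of `p` and `q` relative to `w`, as the
  -- cyclic relation demands.
  have n₁ : B.nCoord a b q (-(p + q)) = m₁ * ε := by
    refine mul_right_cancel₀ hU ?_
    rw [B.nCoord_cyclic hab hp hq hpq, h₀]
    linear_combination -ε * h₁
  have n₂ : B.nCoord a b (-(p + q)) p = m₂ * ε := by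
    have c := B.nCoord_cyclic hab hq hw (e₁ ▸ hp')
    rw [e₁, neg_neg, n₁, show normSq (-p) = normSq p by simp [normSq]] at c
    refine mul_right_cancel₀ hS (mul_right_cancel₀ hU ?_)
    linear_combination normSq (p + q) * c + ε * normSq q * h₁ - ε * normSq p * h₂
  -- The other nine values follow by antisymmetry and by negating both roots.
  have s₀ := B.nCoord_swap hab p q
  have s₁ := B.nCoord_swap hab q (-(p + q))
  have s₂ := B.nCoord_swap hab (-(p + q)) p
  have t₀ := B.nCoord_neg hab hp hq hpq
  have t₁ := B.nCoord_neg hab hq hw (e₁ ▸ hp')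
  have t₂ := B.nCoord_neg hab hw hp (e₂ ▸ neg_mem_rootCoords _ hq)
  have u₀ := B.nCoord_swap hab (-p) (-q)
  have u₁ := B.nCoord_swap hab (-q) (p + q)
  have u₂ := B.nCoord_swap hab (p + q) (-p)
  rw [neg_neg] at t₁ t₂
  refine ⟨h₀, ?_, ?_, ?_, n₁, ?_, ?_, ?_, n₂, ?_, ?_, ?_⟩ <;> linarith

/-- The last relation is the Jacobi identity for `p, q, 2p + q`, where `q + (2p + q)` is not a root.
At `p = a`, `q = b` it gives the one constant not prescribed by `ε₁, ..., ε₄`. -/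
lemma nCoord_long_short {p q : ℤ × ℤ} (hp : p ∈ rootCoords) (hq : q ∈ rootCoords)
    (hpq : p + q ∈ rootCoords) (h : normSq p = 1) (h' : normSq q = 3) :
    B.nCoord a b p q ^ 2 = 1 ∧ B.nCoord a b q (3 • p + q) ^ 2 = 1 ∧
    B.nCoord a b p q * B.nCoord a b (p + q) (2 • p + q) +
      B.nCoord a b p (2 • p + q) * B.nCoord a b q (3 • p + q) = 0 := by
  have hz : ∀ p ∈ rootCoords, ∀ q ∈ rootCoords, p + q ∈ rootCoords → normSq p = 1 →
      normSq q = 3 → chainBot p q = 0 ∧ chainBot q (3 • p + q) = 0 ∧ 3 • p + q ∈ rootCoords ∧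
      q + (3 • p + q) ∈ rootCoords ∧ p + q + (2 • p + q) ∈ rootCoords ∧
      p + q ≠ 0 ∧ q + (2 • p + q) ≠ 0 ∧ q + (2 • p + q) ∉ rootCoords ∧ p + (2 • p + q) ≠ 0 := by
    decide +kernel
  obtain ⟨c₁, c₂, r₁, r₂, r₃, z₁, z₂, z₃, z₄⟩ := hz p hp q hq hpq h h'
  refine ⟨by rw [← sq_abs, B.abs_nCoord hab hp hq hpq, c₁]; rfl,
    by rw [← sq_abs, B.abs_nCoord hab hq r₁ r₂, c₂]; rfl, ?_⟩
  have hj := B.nCoord_jacobi hab r₃ z₁ z₂ z₄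
  rw [B.nCoord_eq_zero hab (p := q) (fun h => z₃ h.2.2), zero_mul,
    show p + (2 • p + q) = 3 • p + q by abel] at hj
  exact hj.symm

variable {K : Type*} [CommRing K]

/-- In the `_eq` variants the sums of roots and the parameters are variables, so that they match
formulas with evaluated coordinates; the side conditions are left to `decide` and `ring`. -/
lemma comm_xCoord_single_eq {p q p₁ : ℤ × ℤ} {k : ℤ} {t u y : K}
    (h : p ∈ rootCoords ∧ q ∈ rootCoords ∧ p₁ ∈ rootCoords ∧ p + q = p₁ ∧
      normSq p = normSq q ∧ normSq p₁ = 3) (hk : B.nCoord a b p q = k)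
    (hy : y = -(k * (t * u))) :
    comm (B.xCoord a b q u) (B.xCoord a b p t) = B.xCoord a b p₁ y := by
  obtain ⟨hp, hq, hpq, rfl, h₁, h₂⟩ := h
  rw [hy, B.comm_xCoord_single hab hp hq hpq h₁ h₂ hk]

lemma comm_xCoord_short_eq {p q p₁ p₂ p₃ : ℤ × ℤ} {k m n : ℤ} {t u y₁ y₂ y₃ : K}
    (h : p ∈ rootCoords ∧ q ∈ rootCoords ∧ p₁ ∈ rootCoords ∧ p + q = p₁ ∧ 2 • p + q = p₂ ∧
      p + 2 • q = p₃ ∧ normSq p = 1 ∧ normSq q = 1 ∧ normSq p₁ = 1)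
    (hk : B.nCoord a b p q = 2 * k) (hm : B.nCoord a b p p₁ = 3 * m)
    (hn : B.nCoord a b q p₁ = 3 * n)
    (hy₁ : y₁ = -(2 * k * (t * u))) (hy₂ : y₂ = 3 * (k * m) * (t ^ 2 * u))
    (hy₃ : y₃ = 3 * (k * n) * (t * u ^ 2)) :
    comm (B.xCoord a b q u) (B.xCoord a b p t) =
      B.xCoord a b p₁ y₁ * B.xCoord a b p₂ y₂ * B.xCoord a b p₃ y₃ := by
  obtain ⟨hp, hq, hpq, rfl, rfl, rfl, h₁, h₂, h₃⟩ := h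
  rw [hy₁, hy₂, hy₃, B.comm_xCoord_short hab hp hq hpq h₁ h₂ h₃ hk hm hn]

lemma comm_xCoord_long_eq {p q p₁ p₂ p₃ p₄ : ℤ × ℤ} {k m n l : ℤ} {t u y₁ y₂ y₃ y₄ : K}
    (h : p ∈ rootCoords ∧ q ∈ rootCoords ∧ p₁ ∈ rootCoords ∧ p + q = p₁ ∧ 2 • p + q = p₂ ∧
      3 • p + q = p₃ ∧ 3 • p + 2 • q = p₄ ∧ normSq p = 1 ∧ normSq q = 3)
    (hk : B.nCoord a b p q = k) (hm : B.nCoord a b p p₁ = 2 * m)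
    (hn : B.nCoord a b p p₂ = 3 * n) (hl : B.nCoord a b p₁ p₂ = 3 * l)
    (hy₁ : y₁ = -(k * (t * u))) (hy₂ : y₂ = k * m * (t ^ 2 * u))
    (hy₃ : y₃ = -(k * m * n * (t ^ 3 * u))) (hy₄ : y₄ = m * l * (t ^ 3 * u ^ 2)) :
    comm (B.xCoord a b q u) (B.xCoord a b p t) =
      B.xCoord a b p₁ y₁ * B.xCoord a b p₂ y₂ * B.xCoord a b p₃ y₃ * B.xCoord a b p₄ y₄ := by
  obtain ⟨hp, hq, hpq, rfl, rfl, rfl, rfl, h₁, h₂⟩ := h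
  rw [hy₁, hy₂, hy₃, hy₄, (B.comm_xCoord_long hab hp hq hpq h₁ h₂ hk hm hn hl t u).1]

lemma comm_xCoord_long_swap_eq {p q p₁ p₂ p₃ p₄ : ℤ × ℤ} {k m n l : ℤ} {t u y₁ y₂ y₃ y₄ : K}
    (h : p ∈ rootCoords ∧ q ∈ rootCoords ∧ p₁ ∈ rootCoords ∧ p + q = p₁ ∧ 2 • p + q = p₂ ∧
      3 • p + q = p₃ ∧ 3 • p + 2 • q = p₄ ∧ normSq p = 1 ∧ normSq q = 3)
    (hk : B.nCoord a b p q = k) (hm : B.nCoord a b p p₁ = 2 * m)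
    (hn : B.nCoord a b p p₂ = 3 * n) (hl : B.nCoord a b p₁ p₂ = 3 * l)
    (hy₁ : y₁ = k * (t * u)) (hy₂ : y₂ = -(k * m * (t ^ 2 * u)))
    (hy₃ : y₃ = k * m * n * (t ^ 3 * u)) (hy₄ : y₄ = 2 * (m * l * (t ^ 3 * u ^ 2))) :
    comm (B.xCoord a b p t) (B.xCoord a b q u) =
      B.xCoord a b p₁ y₁ * B.xCoord a b p₂ y₂ * B.xCoord a b p₃ y₃ * B.xCoord a b p₄ y₄ := by
  obtain ⟨hp, hq, hpq, rfl, rfl, rfl, rfl, h₁, h₂⟩ := h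
  rw [hy₁, hy₂, hy₃, hy₄, (B.comm_xCoord_long hab hp hq hpq h₁ h₂ hk hm hn hl t u).2]

/-- The values of the constants and the commutator formulas in coordinates. -/
lemma constantTable_commutatorFormulas {ε₁ ε₂ ε₃ ε₄ ε₅ : ℤ}
    (h₁ : B.nCoord a b (1, 0) (0, 1) = ε₁) (h₂ : B.nCoord a b (1, 0) (1, 1) = 2 * ε₂)
    (h₃ : B.nCoord a b (1, 0) (2, 1) = 3 * ε₃) (h₄ : B.nCoord a b (0, 1) (3, 1) = ε₄)
    (h₅ : (ε₅ : ℚ) = ε₁ * ε₃ / ε₄) :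
    ConstantTable (B.cCoord a b) (1, 0) (0, 1) ε₁ ε₂ ε₃ ε₄ ε₅ ∧
    ∀ t u : K, CommutatorFormulas (B.xCoord a b) (1, 0) (0, 1) (ε₁ : K) ε₂ ε₃ ε₄ ε₅ t u := by
  obtain ⟨q₁, q₄, hj⟩ := B.nCoord_long_short hab (p := (1, 0)) (q := (0, 1)) (by decide)
    (by decide) (by decide) (by decide) (by decide)
  norm_num [h₁, h₂, h₃, h₄] at q₁ q₄ hj
  -- The Jacobi relation reads `ε₁ N_{a+b,2a+b} + 3ε₃ε₄ = 0`. As `ε₁` and `ε₄` are signs, `ε₅ =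
  -- ε₁ε₃ε₄`.
  have h₅' : B.nCoord a b (1, 1) (2, 1) = 3 * -ε₅ := by
    have h₆ : ε₅ = ε₁ * ε₃ * ε₄ := by
      rcases q₄ with rfl | rfl <;> norm_num at h₅ <;> push_cast [← @Int.cast_inj ℚ] <;>
        linarith
    rw [h₆]
    rcases q₁ with rfl | rfl <;> linarith
  -- One family for each way of writing a positive root as an unordered sum of two positive roots:
  -- five families of twelve constants, 60 in all.
  have v₁ := B.nCoord_triple hab (p := (1, 0)) (q := (0, 1)) (w := (1, 1)) (v₁ := (-1, 0))
    (v₂ := (0, -1)) (v₃ := (-1, -1)) (m₀ := 1) (m₁ := 1) (m₂ := 3) (ε := ε₁)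
    (by decide) (by omega)
  have v₂ := B.nCoord_triple hab (p := (1, 0)) (q := (1, 1)) (w := (2, 1)) (v₁ := (-1, 0))
    (v₂ := (-1, -1)) (v₃ := (-2, -1)) (m₀ := 2) (m₁ := 2) (m₂ := 2) (ε := ε₂)
    (by decide) h₂
  have v₃ := B.nCoord_triple hab (p := (1, 0)) (q := (2, 1)) (w := (3, 1)) (v₁ := (-1, 0))
    (v₂ := (-2, -1)) (v₃ := (-3, -1)) (m₀ := 3) (m₁ := 1) (m₂ := 1) (ε := ε₃)
    (by decide) h₃
  have v₄ := B.nCoord_triple hab (p := (0, 1)) (q := (3, 1)) (w := (3, 2)) (v₁ := (0, -1))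
    (v₂ := (-3, -1)) (v₃ := (-3, -2)) (m₀ := 1) (m₁ := 1) (m₂ := 1) (ε := ε₄)
    (by decide) (by omega)
  have v₅ := B.nCoord_triple hab (p := (1, 1)) (q := (2, 1)) (w := (3, 2)) (v₁ := (-1, -1))
    (v₂ := (-2, -1)) (v₃ := (-3, -2)) (m₀ := 3) (m₁ := 1) (m₂ := 1) (ε := -ε₅)
    (by decide) h₅'
  constructor
  · simp only [ConstantTable, ConstantsAre, List.forall_mem_cons,
      and_true, cCoord_one_one, cCoord_two_one, cCoord_three_one, cCoord_one_two,
      cCoord_one_three, cCoord_three_two, cCoord_two_three, List.not_mem_nil, IsEmpty.forall_iff,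
      implies_true, Prod.mk_add_mk, Prod.smul_mk, Prod.neg_mk, Prod.mk_sub_mk, nsmul_eq_mul,
      Nat.cast_ofNat, Int.reduceAdd, Int.reduceMul, Int.reduceNeg, Int.reduceSub, neg_zero,
      v₁, v₂, v₃, v₄, v₅]
    repeat' apply And.intro
    all_goals push_cast
    all_goals ring
  · intro t u
    simp only [CommutatorFormulas, PositiveFormulas, NegativeFormulas, MixedFormulasI,
      MixedFormulasII, MixedFormulasIII, RemainingFormulas,
      Prod.mk_add_mk, Prod.smul_mk, Prod.neg_mk, Prod.mk_sub_mk, nsmul_eq_mul,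
      Nat.cast_ofNat, Int.reduceAdd, Int.reduceMul, Int.reduceNeg, Int.reduceSub, neg_zero]
    obtain ⟨_, _, _, _, _, _, _, _, _, _, _, _⟩ := v₁
    obtain ⟨_, _, _, _, _, _, _, _, _, _, _, _⟩ := v₂
    obtain ⟨_, _, _, _, _, _, _, _, _, _, _, _⟩ := v₃
    obtain ⟨_, _, _, _, _, _, _, _, _, _, _, _⟩ := v₄
    obtain ⟨_, _, _, _, _, _, _, _, _, _, _, _⟩ := v₅
    repeat' apply And.intro
    -- The number of factors and the lengths of the roots single out the formula; the search through
    -- the hypotheses finds the structure constants and thereby fixes `k, m, n, l`.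
    all_goals first
      | with_reducible refine B.comm_xCoord_single_eq hab (by decide) ‹_› ?_
      | with_reducible refine B.comm_xCoord_short_eq hab (by decide) ‹_› ‹_› ‹_› ?_ ?_ ?_
      | with_reducible refine B.comm_xCoord_long_eq hab (by decide) ‹_› ‹_› ‹_› ‹_› ?_ ?_ ?_ ?_
      | with_reducible refine B.comm_xCoord_long_swap_eq hab (by decide) ‹_› ‹_› ‹_› ‹_› ?_ ?_ ?_ ?_
    all_goals push_cast
    all_goals ring

end ChevalleyBasis
end Table
end G2

/-! ### The main theorem: from coordinates back to roots -/

open Module in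
theorem mainTheorem2 {L : Type*} [LieRing L] [LieAlgebra ℂ L] [FiniteDimensional ℂ L]
    [LieAlgebra.IsSimple ℂ L] (H : LieSubalgebra ℂ L) [H.IsCartanSubalgebra]
    (a b : Dual ℂ H) (hab : G2.IsFundamentalPair H a b) (B : G2.ChevalleyBasis H)
    (ε₁ ε₂ ε₃ ε₄ ε₅ : ℤ) (h₁ : B.N a b = ε₁) (h₂ : B.N a (a + b) = 2 * ε₂)
    (h₃ : B.N a (2 • a + b) = 3 * ε₃) (h₄ : B.N b (3 • a + b) = ε₄)
    (h₅ : (ε₅ : ℚ) = ε₁ * ε₃ / ε₄) (K : Type*) [CommRing K] :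
    (∀ r ∈ G2.roots H, ∀ s ∈ G2.roots H, r + s ∈ G2.roots H →
      (∀ i j : ℕ, 0 < i → 0 < j → i • r + j • s ∈ G2.roots H → (i, j) ∈ G2.orderedPairs) ∧
      ∃ c : ℕ → ℕ → ℤ,
        (∀ i j : ℕ, 0 < i → 0 < j → i • r + j • s ∈ G2.roots H → (c i j : ℚ) = B.C i j r s) ∧
        ∀ t u : K, G2.comm (B.x s u) (B.x r t) = G2.rootProduct B c r s t u) ∧
    G2.ConstantTable B.C a b ε₁ ε₂ ε₃ ε₄ ε₅ ∧
    ∀ t u : K, G2.CommutatorFormulas B.x a b (ε₁ : K) ε₂ ε₃ ε₄ ε₅ t u := by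
  refine ⟨fun r hr s hs hrs => ?_, ?_⟩
  · obtain ⟨p, hp, rfl⟩ := (G2.mem_roots_iff hab r).1 hr
    obtain ⟨q, hq, rfl⟩ := (G2.mem_roots_iff hab s).1 hs
    rw [← map_add, G2.ofCoords_mem_roots_iff hab] at hrs
    simp only [← map_nsmul, ← map_add, G2.ofCoords_mem_roots_iff hab]
    have hm : ∀ i j : ℕ, 0 < i → 0 < j → i • p + j • q ∈ G2.rootCoords →
        (i, j) ∈ G2.orderedPairs := fun i j hi hj h => G2.mem_orderedPairs hp hq hrs hi hj h
    obtain ⟨c, hc, hcomm⟩ := B.exists_comm_xCoord_eq hab (K := K) hp hq hrs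
    exact ⟨hm, c, fun i j hi hj h => hc i j (hm i j hi hj h) h, hcomm⟩
  · have ea : G2.ofCoords a b (1, 0) = a := by simp [G2.ofCoords_apply]
    have eb : G2.ofCoords a b (0, 1) = b := by simp [G2.ofCoords_apply]
    have hN (p q : ℤ × ℤ) :
        B.nCoord a b p q = B.N (G2.ofCoords a b p) (G2.ofCoords a b q) := rfl
    have key := B.constantTable_commutatorFormulas hab (K := K) (ε₁ := ε₁) (ε₂ := ε₂) (ε₃ := ε₃)
      (ε₄ := ε₄) (ε₅ := ε₅) (by rw [hN, ea, eb, h₁])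
      (by rw [hN, show ((1, 1) : ℤ × ℤ) = (1, 0) + (0, 1) from rfl, map_add, ea, eb, h₂])
      (by rw [hN, show ((2, 1) : ℤ × ℤ) = 2 • (1, 0) + (0, 1) from rfl, map_add, map_nsmul, ea,
        eb, h₃])
      (by rw [hN, show ((3, 1) : ℤ × ℤ) = 3 • (1, 0) + (0, 1) from rfl, map_add, map_nsmul, ea,
        eb, h₄]) h₅
    simpa only [G2.ConstantTable, G2.ConstantsAre, G2.CommutatorFormulas, G2.PositiveFormulas,
      G2.NegativeFormulas, G2.MixedFormulasI, G2.MixedFormulasII, G2.MixedFormulasIII,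
      G2.RemainingFormulas, G2.ChevalleyBasis.cCoord, G2.ChevalleyBasis.xCoord, map_add, map_sub,
      map_neg, map_nsmul, ea, eb] using key
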